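/- Let $a\ge 1$ be an integer and $\theta>0$. Let $\mathbb S'_\theta$ be the set of pairs $(r,\eta)$ with $r\in\mathbb Z$ and $\eta:\{\dots,r-1,r\}\to\mathbb N=\{0,1,2,\dots\}$ such that $\sum_{x\le r}e^{\theta(x-r)}\eta(x)<\infty$, with the metric $$d((r,\eta),(r',\eta'))=|r-r'|+\sum_{x\le 0}e^{\theta x}\,|\eta(x+r)-\eta'(x+r')| .$$ Let $Y_{x,i}$ ($x\in\mathbb Z$, $i=1,2,\dots$) be independent continuous-time simple symmetric random walks on $\mathbb Z$ with total jump rate $2$ and $Y_{x,i}(0)=x$, with right-continuous nearest-neighbour step paths, defined on a probability space with probability $P$. For $(r,\eta)$ with finitely many particles, define a process $(r_t,\eta(t))_{t\ge0}$ as follows. Initially there are particles $(x,i)$ with $x\le r$, $1\le i\le\eta(x)$, and particle $(x,i)$ is at $Y_{x,i}(t)$ at time $t$. Put $\tau_0=0$. For $n\ge1$ let $\tau_n$ be the first time at which one of the particles $(x,i)$ with $x\le r+n-1$ hits $r+n$; at that time the particles $(r+n,1),\dots,(r+n,a)$ are added, and $(r+n,i)$ is at $Y_{r+n,i}(t-\tau_n)$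 at time $t\ge\tau_n$. Let $r_t=r+n$ for $\tau_n\le t<\tau_{n+1}$, and let $\eta(t,z)$ be the number of particles present at time $t$ that are at $z$. For $(r,\eta)\in\mathbb S'_\theta$ and $\ell\ge1$ let $\eta^\ell(x)=\eta(x)$ for $r-\ell<x\le r$ and $\eta^\ell(x)=0$ for $x\le r-\ell$, and let $(r^\ell_t,\eta^\ell(t))$ be the process started from $(r,\eta^\ell)$. Then the following hold for every $(r,\eta)\in\mathbb S'_\theta$. 1. Almost surely, for every $\ell$ the times $\tau_n$ of the process started from $(r,\eta^\ell)$ tend to $\infty$ as $n\to\infty$. 2. Almost surely, for every $t\ge0$, the limits $r_t=\lim_{\ell\to\infty}r^\ell_t$ and $\eta(t,x)=\lim_{\ell\to\infty}\eta^\ell(t,x)$, $x\in\mathbb Z$, exist and are finite, and $(r_t,\eta(t))\in\mathbb S'_\theta$. 3. The limit $(r_t,\eta(t))_{t\ge 0}$ is a Markov process on $\mathbb S'_\theta$ with respect to its natural filtration; its transition probabilities are the kernels sending $(r,\eta)$ to the law of $(r_t,\eta(t))$ for the process started from $(r,\eta)$. 4. With $E_{r,\eta}$ the expectation for the process started from $(r,\eta)$,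 the operators $P_tf(r,\eta)=E_{r,\eta}[f(r_t,\eta(t))]$, $t\ge0$, form a Feller semigroup on the space $C_b(\mathbb S'_\theta)$ of bounded continuous functions. That is, each $P_t$ is a positive linear contraction of $C_b(\mathbb S'_\theta)$ into itself with $P_t1=1$; $P_0f=f$ and $P_{t+u}f=P_tP_uf$; $P_tf$ vanishes at infinity (outside compact sets) whenever $f\in C_b(\mathbb S'_\theta)$ does; and $P_tf\to f$ as $t\to0$ uniformly on compact sets, for every $f\in C_b(\mathbb S'_\theta)$. -/

import Mathlib

open MeasureTheory ProbabilityTheory Filter Topology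
open scoped NNReal ENNReal BoundedContinuousFunction

namespace Combustion

/-! ### The state space -/

/-- States: a rightmost visited site `front` and particle numbers `occ x` at the sites
`x ≤ front` (extended by `0` to the right of `front`), such that
`∑_{x ≤ front} e^{θ (x - front)} occ x < ∞`. -/
@[ext]
structure State (θ : ℝ) where
  front : ℤ
  occ : ℤ → ℕ
  occ_eq_zero : ∀ x, front < x → occ x = 0
  summable_occ : Summable fun x : ℤ => Real.exp (θ * ((x - front : ℤ) : ℝ)) * (occ x : ℝ)

namespace State

variable {θ : ℝ}

/-- The terms of the distance between two configurations seen from their fronts. -/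
noncomputable def distTerm (s t : State θ) (x : ℤ) : ℝ :=
  Real.exp (θ * (x : ℝ)) * |(s.occ (x + s.front) : ℝ) - (t.occ (x + t.front) : ℝ)|

theorem summable_shift (s : State θ) :
    Summable fun x : ℤ => Real.exp (θ * (x : ℝ)) * (s.occ (x + s.front) : ℝ) := by
  have h := (Equiv.addRight s.front).summable_iff.mpr s.summable_occ
  refine h.congr fun x => ?_
  simp [Function.comp]

theorem distTerm_nonneg (s t : State θ) (x : ℤ) : 0 ≤ distTerm s t x := by
  unfold distTerm; positivity

theorem summable_distTerm (s t : State θ) : Summable (distTerm s t) := by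
  refine Summable.of_nonneg_of_le (distTerm_nonneg s t) (fun x => ?_)
    (s.summable_shift.add t.summable_shift)
  unfold distTerm
  rw [← mul_add]
  refine mul_le_mul_of_nonneg_left ?_ (Real.exp_pos _).le
  refine (abs_sub _ _).trans ?_
  simp

/-- The metric `|r - r'| + ∑_{x ≤ 0} e^{θ x} |η (x + r) - η' (x + r')|`; the terms with `x > 0`
vanish. -/
noncomputable instance : MetricSpace (State θ) where
  dist s t := |(s.front : ℝ) - (t.front : ℝ)| + ∑' x : ℤ, distTerm s t x
  dist_self s := by simp [distTerm]
  dist_comm s t := by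
    simp only [distTerm, abs_sub_comm]
  dist_triangle s t u := by
    have h : ∑' x : ℤ, distTerm s u x ≤ ∑' x : ℤ, distTerm s t x + ∑' x : ℤ, distTerm t u x := by
      rw [← (summable_distTerm s t).tsum_add (summable_distTerm t u)]
      refine (summable_distTerm s u).tsum_le_tsum (fun x => ?_)
        ((summable_distTerm s t).add (summable_distTerm t u))
      unfold distTerm
      rw [← mul_add]
      exact mul_le_mul_of_nonneg_left (abs_sub_le _ _ _) (Real.exp_pos _).le
    have h' := abs_sub_le (s.front : ℝ) (t.front : ℝ) (u.front : ℝ)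
    linarith
  eq_of_dist_eq_zero := by
    intro s t h
    change |(s.front : ℝ) - (t.front : ℝ)| + ∑' x : ℤ, distTerm s t x = 0 at h
    have h1 := abs_nonneg ((s.front : ℝ) - (t.front : ℝ))
    have h2 : 0 ≤ ∑' x : ℤ, distTerm s t x := tsum_nonneg (distTerm_nonneg s t)
    have hf : s.front = t.front := by
      have : |(s.front : ℝ) - (t.front : ℝ)| = 0 := by linarith
      exact_mod_cast sub_eq_zero.mp (abs_eq_zero.mp this)
    have h3 : ∑' x : ℤ, distTerm s t x = 0 := by linarith
    have h4 := (hasSum_zero_iff_of_nonneg (distTerm_nonneg s t)).mp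
      (h3 ▸ (summable_distTerm s t).hasSum)
    refine State.ext hf (funext fun x => ?_)
    have h5 : distTerm s t (x - s.front) = 0 := congrFun h4 _
    unfold distTerm at h5
    rcases mul_eq_zero.mp h5 with h6 | h6
    · exact absurd h6 (Real.exp_pos _).ne'
    · rw [← hf, sub_add_cancel] at h6
      exact_mod_cast sub_eq_zero.mp (abs_eq_zero.mp h6)

noncomputable instance : MeasurableSpace (State θ) := borel _

instance : BorelSpace (State θ) := ⟨rfl⟩

end State

/-! ### The driving random walks -/

/-- Right-continuous step functions that start at `x` and have jumps of size one. -/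
structure IsWalkPath (x : ℤ) (y : ℝ≥0 → ℤ) : Prop where
  start : y 0 = x
  right_cont : ∀ t, ∀ᶠ u in 𝓝[≥] t, y u = y t
  left_lim : ∀ t, ∃ z : ℤ, |y t - z| ≤ 1 ∧ ∀ᶠ u in 𝓝[<] t, y u = z

/-- The law at time `t` of the walk on `ℤ` started at `0` that jumps by `+1` at rate `1` and by
`-1` at rate `1` (total jump rate `2`). -/
noncomputable def walkLaw (t : ℝ≥0) : Measure ℤ :=
  ((poissonMeasure t).prod (poissonMeasure t)).map fun p => (p.1 : ℤ) - (p.2 : ℤ)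

/-- `Y x i`, for `x ∈ ℤ` and `i ∈ ℕ`, are independent continuous time simple symmetric random
walks of jump rate `2`, with `Y x i` started at `x`. -/
structure IsWalkFamily {Ω : Type*} [MeasurableSpace Ω] (P : Measure Ω)
    (Y : ℤ → ℕ → ℝ≥0 → Ω → ℤ) : Prop where
  measurable : ∀ x i t, Measurable (Y x i t)
  path : ∀ x i ω, IsWalkPath x fun t => Y x i t ω
  indep_increments : ∀ x i, HasIndepIncrements (Y x i) P
  law_increment : ∀ x i s t, P.map (fun ω => Y x i (s + t) ω - Y x i s ω) = walkLaw t
  indep : iIndepFun (fun (p : ℤ × ℕ) (ω : Ω) (t : ℝ≥0) => Y p.1 p.2 t ω) P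

/-! ### The process with finitely many particles

Here `y x i` is a realization of the walks, `(r, η)` an initial configuration, and `a` the number
of sleeping particles per site. Particles are labelled `(x, i)`: those with `x ≤ r`, `i < η x` are
there from the beginning, and those with `x > r`, `i < a` wake up when `x` is first visited. -/

/-- The number of particles that originate at `x`. -/
def supply (a : ℕ) (r : ℤ) (η : ℤ → ℕ) (x : ℤ) : ℕ := if x ≤ r then η x else a

/-- The first time at which the path `y` is at `z` (`∞` if there is none). -/
noncomputable def hitTime (y : ℝ≥0 → ℤ) (z : ℤ) : ℝ≥0∞ := ⨅ (t : ℝ≥0) (_ : y t = z), (t : ℝ≥0∞)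

/-- `frontTime a y r η n` is the time `τ_n` at which `r + n` is first visited: `τ_0 = 0`, and
`τ_{n+1}` is the first time at which one of the particles that originate at a site `x ≤ r + n` hits
`r + n + 1`. Such a particle starts its walk at time `0` if `x ≤ r`, and at time `τ_{x-r}` if
`x > r`; that is `τ_{(x - r).toNat}` in both cases. -/
noncomputable def frontTime (a : ℕ) (y : ℤ → ℕ → ℝ≥0 → ℤ) (r : ℤ) (η : ℤ → ℕ) : ℕ → ℝ≥0∞
  | 0 => 0
  | n + 1 => ⨅ (x : ℤ) (_ : x ≤ r + n) (i : ℕ) (_ : i < supply a r η x),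
      frontTime a y r η (x - r).toNat + hitTime (y x i) (r + n + 1)
  termination_by n => n
  decreasing_by omega

/-- The time at which the particles that originate at `x` start to move. -/
noncomputable def birthTime (a : ℕ) (y : ℤ → ℕ → ℝ≥0 → ℤ) (r : ℤ) (η : ℤ → ℕ) (x : ℤ) : ℝ≥0∞ :=
  frontTime a y r η (x - r).toNat

/-- The front `r_t`: it is `r + n` for `τ_n ≤ t < τ_{n+1}`. -/
noncomputable def frontAt (a : ℕ) (y : ℤ → ℕ → ℝ≥0 → ℤ) (r : ℤ) (η : ℤ → ℕ) (t : ℝ≥0) : ℤ :=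
  r + ((sSup {n : ℕ | frontTime a y r η n ≤ t} : ℕ) : ℤ)

/-- The number `η (t, z)` of moving particles at `z` at time `t`. -/
noncomputable def occAt (a : ℕ) (y : ℤ → ℕ → ℝ≥0 → ℤ) (r : ℤ) (η : ℤ → ℕ) (t : ℝ≥0) (z : ℤ) : ℕ :=
  Set.ncard {p : ℤ × ℕ | p.2 < supply a r η p.1 ∧ birthTime a y r η p.1 ≤ t ∧
    y p.1 p.2 (t - (birthTime a y r η p.1).toNNReal) = z}

/-! ### The limit of the truncated processes -/

/-- The truncated configuration `η^ℓ`. -/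
def truncate (r : ℤ) (η : ℤ → ℕ) (l : ℕ) (x : ℤ) : ℕ := if x ≤ r - l then 0 else η x

/-- The truncated processes started from `s` converge at time `t` to the state `s'`. -/
def ConvergesTo {θ : ℝ} (a : ℕ) (y : ℤ → ℕ → ℝ≥0 → ℤ) (s : State θ) (t : ℝ≥0)
    (s' : State θ) : Prop :=
  Tendsto (fun l : ℕ => frontAt a y s.front (truncate s.front s.occ l) t) atTop (𝓝 s'.front) ∧
  ∀ x : ℤ, Tendsto (fun l : ℕ => occAt a y s.front (truncate s.front s.occ l) t x) atTop
    (𝓝 (s'.occ x))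

open Classical in
/-- The process `(r_t, η (t))` started from `s`: the limit of the truncated processes, with the
convention that it is `s` if there is no limit in the state space. -/
noncomputable def process {θ : ℝ} {Ω : Type*} (a : ℕ) (Y : ℤ → ℕ → ℝ≥0 → Ω → ℤ) (s : State θ)
    (t : ℝ≥0) (ω : Ω) : State θ :=
  if h : ∃ s' : State θ, ConvergesTo a (fun x i u => Y x i u ω) s t s' then h.choose else s

/-! ### Markov processes and Feller semigroups -/

/-- `X` is a Markov process with transition probabilities `κ t`, with respect to its natural
filtration. -/
structure IsMarkovProcess {Ω S : Type*} [MeasurableSpace Ω] [MeasurableSpace S] (P : Measure Ω)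
    (κ : ℝ≥0 → Kernel S S) (X : ℝ≥0 → Ω → S) : Prop where
  measurable : ∀ t, Measurable (X t)
  markov : ∀ u t (B : Set S), MeasurableSet B →
    P[(X (u + t) ⁻¹' B).indicator (fun _ => (1 : ℝ)) |
        ⨆ v : Set.Iic u, MeasurableSpace.comap (X v) inferInstance]
      =ᵐ[P] fun ω => (κ t (X u ω)).real B

/-- Feller semigroups on the bounded continuous functions: semigroups of positive contractions
that preserve the constants and the functions that vanish at infinity, and that are strongly
continuous for uniform convergence on compact sets. -/
structure IsFellerSemigroup {S : Type*} [TopologicalSpace S]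
    (T : ℝ≥0 → (S →ᵇ ℝ) →L[ℝ] (S →ᵇ ℝ)) : Prop where
  zero : ∀ f, T 0 f = f
  add : ∀ t u f, T (t + u) f = T t (T u f)
  one : ∀ t, T t 1 = 1
  nonneg : ∀ t (f : S →ᵇ ℝ), (∀ s, 0 ≤ f s) → ∀ s, 0 ≤ T t f s
  norm_le : ∀ t f, ‖T t f‖ ≤ ‖f‖
  vanish : ∀ t (f : S →ᵇ ℝ), Tendsto f (cocompact S) (𝓝 0) → Tendsto (T t f) (cocompact S) (𝓝 0)
  continuous_zero : ∀ (f : S →ᵇ ℝ) (K : Set S), IsCompact K →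
    TendstoUniformlyOn (fun t s => T t f s) f (𝓝 0) K

end Combustion

/-! All walks, moved to the origin, have one common law on the space of step paths: independent
stationary increments determine it (`IsWalkLaw.unique`). Hence the driving family has law `familyLaw
W`, an infinite product, and the whole argument runs on that product space;
`IsWalkFamily.map_family` carries it back to an arbitrary probability space.

No explosion. Exponential moments bound the probability of reaching a distant site before a given
time, which gives `E exp(-2cH) ≤ K exp(-mk)` for the hitting time `H` of `k`, where `c = expRate m`.
The time `τ_{n+1}` is a birth time plus the hitting time of an independent walk. Summing over the
particles that may be responsible and inducting on `n`, the Laplace transform of `τ_{n+1}` is at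
most a constant times `(exp(-m) (1 + aK))^n`. For large `m` this is summable, so `τ_n → ∞` almost
surely.

Convergence. Give an initial particle at `x` the weight `exp(θ(x - r))` times a bound for the
exponential of its displacement up to time `N`. The expected total weight is finite, so almost
surely only finitely many initial particles ever enter a given half-line before `N`. A long
truncation contains all of them, and the truncated processes become constant in `ℓ` at every site
(`IsGood.convergesTo`).

Markov property. Each particle runs its walk on a clock that starts at its birth, so cutting at a
fixed time `u` does not cut all walks at the same place. The map `ownTime` repairs this: it feeds to
each particle the increments after its birth of a path in ambient time. A birth time depends only on
walks from sites further left, so this map preserves the product law. In ambient time the family is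
a concatenation at `u` of two independent families. The first determines the process up to `u`. The
second, relabelled by an injection that depends only on the first, drives the process restarted from
the state at `u` (`IsRestart.dyn_add`). Fubini then gives the Markov property.

Feller property. Run two states with equal fronts on the same walks. If the particles in which they
differ have total weight below one, none of them can advance the front before `N`, and the distance
of the processes is at most twice that weight (`ofReal_dist_dyn_le`). The mean weight is a constant
times the initial distance, so the process depends continuously in probability on its starting
point. Together with right continuity at time `0` this yields strong continuity on compact sets.
Preservation of functions vanishing at infinity is degenerate: compact sets have empty interior, so
`0` is the only such function. -/

namespace Combustion

/-! ### Paths started at the origin -/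

/-- Step paths that start at `0`. -/
abbrev WalkPath : Type := {e : ℝ≥0 → ℤ // IsWalkPath 0 e}

/-- Families of paths, indexed by the labels of the particles. -/
abbrev Family : Type := ℤ × ℕ → WalkPath

/-- The walks driven by a family of paths. -/
def walks (x : ℤ) (i : ℕ) (t : ℝ≥0) (y : Family) : ℤ := x + (y (x, i)).1 t

theorem IsWalkPath.add_const {x : ℤ} {y : ℝ≥0 → ℤ} (h : IsWalkPath x y) (c : ℤ) :
    IsWalkPath (x + c) fun t => y t + c where
  start := by rw [h.start]
  right_cont t := (h.right_cont t).mono fun u hu => by rw [hu]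
  left_lim t := by
    obtain ⟨z, hz, h'⟩ := h.left_lim t
    exact ⟨z + c, by simpa using hz, h'.mono fun u hu => by rw [hu]⟩

theorem isWalkPath_walks (y : Family) (x : ℤ) (i : ℕ) :
    IsWalkPath x fun t => walks x i t y := by
  have := (y (x, i)).2.add_const x
  simpa [walks, add_comm] using this

theorem IsWalkPath.exists_gt {x : ℤ} {y : ℝ≥0 → ℤ} (h : IsWalkPath x y) (t : ℝ≥0) :
    ∃ b, t < b ∧ ∀ u, t ≤ u → u < b → y u = y t := by
  obtain ⟨b, hb, hs⟩ := (mem_nhdsGE_iff_exists_Ico_subset (a := t)).1 (h.right_cont t)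
  exact ⟨b, hb, fun u h1 h2 => hs ⟨h1, h2⟩⟩

/-- A condition on the values of a path that holds somewhere holds at a first time. -/
theorem IsWalkPath.exists_first {x : ℤ} {y : ℝ≥0 → ℤ} (h : IsWalkPath x y) (p : ℤ → Prop)
    {t : ℝ≥0} (ht : p (y t)) : ∃ s ≤ t, p (y s) ∧ ∀ u < s, ¬ p (y u) := by
  set S : Set ℝ≥0 := {u | p (y u)} with hS
  have hne : S.Nonempty := ⟨t, ht⟩
  refine ⟨sInf S, csInf_le (OrderBot.bddBelow _) ht, ?_, fun u hu hp => ?_⟩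
  · by_contra hp
    obtain ⟨b, hb, hc⟩ := h.exists_gt (sInf S)
    obtain ⟨u, hu, hub⟩ := exists_lt_of_csInf_lt hne hb
    have := hc u (csInf_le (OrderBot.bddBelow _) hu) hub
    exact hp (this ▸ hu)
  · exact absurd (csInf_le (OrderBot.bddBelow _) (show u ∈ S from hp)) (not_le.2 hu)

/-- Nearest-neighbour jumps cannot skip a site: at the first time the path is at least `z`, its left
limit is below `z` and within one of the current value, so that value is `z`. -/
theorem IsWalkPath.exists_eq {x z : ℤ} {y : ℝ≥0 → ℤ} (h : IsWalkPath x y) {t : ℝ≥0}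
    (hx : x ≤ z) (hz : z ≤ y t) : ∃ s ≤ t, y s = z := by
  obtain ⟨s, hst, hs, hmin⟩ := h.exists_first (fun k => z ≤ k) hz
  refine ⟨s, hst, le_antisymm ?_ hs⟩
  rcases eq_or_ne s 0 with rfl | h0
  · rw [h.start]; exact hx
  · obtain ⟨w, hw, hl⟩ := h.left_lim s
    have : (𝓝[<] s).NeBot := nhdsLT_neBot_of_exists_lt ⟨0, pos_iff_ne_zero.2 h0⟩
    obtain ⟨u, hu, hus⟩ := (hl.and self_mem_nhdsWithin).exists
    have := hmin u hus
    rw [hu] at this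
    rw [abs_le] at hw
    omega

/-! ### Hitting times of step paths -/

theorem hitTime_le {y : ℝ≥0 → ℤ} {z : ℤ} {t : ℝ≥0} (h : y t = z) : hitTime y z ≤ t :=
  iInf₂_le t h

theorem IsWalkPath.exists_hitTime {x z : ℤ} {y : ℝ≥0 → ℤ} (h : IsWalkPath x y)
    (hz : hitTime y z < ∞) : ∃ t : ℝ≥0, y t = z ∧ hitTime y z = t := by
  obtain ⟨t, ht⟩ : ∃ t, y t = z := by
    by_contra! hc
    simp [hitTime, hc] at hz
  obtain ⟨s, -, hs, hmin⟩ := h.exists_first (fun k => k = z) ht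
  refine ⟨s, hs, le_antisymm (hitTime_le hs) (le_iInf₂ fun u hu => ?_)⟩
  by_contra! hc
  exact hmin u (by exact_mod_cast hc) hu

theorem IsWalkPath.hitTime_mono {x z z' : ℤ} {y : ℝ≥0 → ℤ} (h : IsWalkPath x y) (hx : x ≤ z)
    (hz : z ≤ z') : hitTime y z ≤ hitTime y z' := by
  refine le_iInf₂ fun t ht => ?_
  obtain ⟨s, hs, hs'⟩ := h.exists_eq (t := t) hx (by omega)
  exact (hitTime_le hs').trans (by exact_mod_cast hs)

namespace WalkPath

theorem apply_zero (e : WalkPath) : e.1 0 = 0 := e.2.start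

/-- The path after time `u`, moved back to the origin. -/
def shift (u : ℝ≥0) (e : WalkPath) : WalkPath where
  val t := e.1 (u + t) - e.1 u
  property := by
    refine ⟨by simp, fun t => ?_, fun t => ?_⟩
    · have : Tendsto (fun v => u + v) (𝓝[≥] t) (𝓝[≥] (u + t)) :=
        tendsto_nhdsWithin_of_tendsto_nhds_of_eventually_within _
          ((continuous_const.add continuous_id).tendsto t |>.mono_left nhdsWithin_le_nhds)
          (eventually_nhdsWithin_of_forall fun v hv => add_le_add_right hv u)
      filter_upwards [this.eventually (e.2.right_cont (u + t))] with v hv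
      rw [hv]
    · obtain ⟨z, hz, h⟩ := e.2.left_lim (u + t)
      have : Tendsto (fun v => u + v) (𝓝[<] t) (𝓝[<] (u + t)) :=
        tendsto_nhdsWithin_of_tendsto_nhds_of_eventually_within _
          ((continuous_const.add continuous_id).tendsto t |>.mono_left nhdsWithin_le_nhds)
          (eventually_nhdsWithin_of_forall fun v hv => add_lt_add_right hv u)
      refine ⟨z - e.1 u, by simpa using hz, ?_⟩
      filter_upwards [this.eventually h] with v hv
      rw [hv]

@[simp] theorem shift_apply (u t : ℝ≥0) (e : WalkPath) :
    (shift u e).1 t = e.1 (u + t) - e.1 u := rfl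

theorem shift_zero (e : WalkPath) : shift 0 e = e := by
  ext t; simp [apply_zero]

/-- The path that follows `e` until time `u` and the increments of `g` afterwards. -/
noncomputable def concat (u : ℝ≥0) (e g : WalkPath) : WalkPath where
  val t := if t < u then e.1 t else e.1 u + g.1 (t - u)
  property := by
    refine ⟨?_, fun t => ?_, fun t => ?_⟩
    · split_ifs with h
      · exact e.apply_zero
      · rw [not_lt, nonpos_iff_eq_zero] at h
        subst h
        simp [apply_zero]
    · rcases lt_or_ge t u with h | h
      · filter_upwards [e.2.right_cont t, nhdsWithin_le_nhds (Iio_mem_nhds h)] with v hv hv'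
        rw [if_pos (Set.mem_Iio.1 hv'), if_pos h, hv]
      · have : Tendsto (fun v => v - u) (𝓝[≥] t) (𝓝[≥] (t - u)) :=
          tendsto_nhdsWithin_of_tendsto_nhds_of_eventually_within _
            ((continuous_id.sub continuous_const).tendsto t |>.mono_left nhdsWithin_le_nhds)
            (eventually_nhdsWithin_of_forall fun v hv => tsub_le_tsub_right hv u)
        filter_upwards [this.eventually (g.2.right_cont (t - u)), self_mem_nhdsWithin] with v hv hv'
        rw [if_neg (not_lt.2 (h.trans hv')), if_neg (not_lt.2 h), hv]
    · rcases le_or_gt t u with h | h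
      · obtain ⟨z, hz, hl⟩ := e.2.left_lim t
        refine ⟨z, ?_, ?_⟩
        · split_ifs with h'
          · exact hz
          · obtain rfl := le_antisymm h (not_lt.1 h')
            simpa [apply_zero] using hz
        · filter_upwards [hl, self_mem_nhdsWithin] with v hv hv'
          rw [if_pos (lt_of_lt_of_le hv' h), hv]
      · obtain ⟨z, hz, hl⟩ := g.2.left_lim (t - u)
        have : Tendsto (fun v => v - u) (𝓝[<] t) (𝓝[<] (t - u)) := by
          refine tendsto_nhdsWithin_of_tendsto_nhds_of_eventually_within _
            ((continuous_id.sub continuous_const).tendsto t |>.mono_left nhdsWithin_le_nhds) ?_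
          filter_upwards [self_mem_nhdsWithin, nhdsWithin_le_nhds (Ioi_mem_nhds h)] with v hv hv'
          exact tsub_lt_tsub_right_of_le (le_of_lt (Set.mem_Ioi.1 hv')) (Set.mem_Iio.1 hv)
        refine ⟨e.1 u + z, ?_, ?_⟩
        · rw [if_neg (not_lt.2 h.le)]
          simpa using hz
        · filter_upwards [this.eventually hl, nhdsWithin_le_nhds (Ioi_mem_nhds h)] with v hv hv'
          rw [if_neg (not_lt.2 (le_of_lt hv')), hv]

theorem concat_of_le {u t : ℝ≥0} (e g : WalkPath) (h : t ≤ u) : (concat u e g).1 t = e.1 t := by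
  rcases h.lt_or_eq with h | rfl
  · exact if_pos h
  · simp [concat, apply_zero]

theorem concat_of_ge {u t : ℝ≥0} (e g : WalkPath) (h : u ≤ t) :
    (concat u e g).1 t = e.1 u + g.1 (t - u) := if_neg (not_lt.2 h)

theorem measurable_apply (t : ℝ≥0) : Measurable fun e : WalkPath => e.1 t :=
  (measurable_pi_apply t).comp measurable_subtype_coe

/-- Joint measurability in time and path, which is needed to evaluate or shift a path at a random
time. Right-continuous paths are limits of their values at discretized times. -/
theorem measurable_eval : Measurable fun p : ℝ≥0 × WalkPath => p.2.1 p.1 := by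
  -- The grid point of mesh `1 / (n + 1)` strictly after `t`: it takes countably many values and
  -- tends to `t` from the right.
  let d (n : ℕ) (t : ℝ≥0) : ℝ≥0 := (⌊(n + 1 : ℝ≥0) * t⌋₊ + 1) / (n + 1)
  have hgt (n : ℕ) (t : ℝ≥0) : t < d n t := by
    rw [lt_div_iff₀ (by positivity), mul_comm]
    exact Nat.lt_floor_add_one _
  have hle (n : ℕ) (t : ℝ≥0) : d n t ≤ t + 1 / (n + 1) := by
    rw [show t + 1 / (n + 1 : ℝ≥0) = ((n + 1) * t + 1) / (n + 1) by field_simp]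
    exact div_le_div_of_nonneg_right (add_le_add_left (Nat.floor_le (by positivity)) 1)
      (by positivity)
  have hlim (t : ℝ≥0) : Tendsto (fun n => d n t) atTop (𝓝[≥] t) := by
    refine tendsto_nhdsWithin_of_tendsto_nhds_of_eventually_within _ ?_
      (Eventually.of_forall fun n => (hgt n t).le)
    refine tendsto_of_tendsto_of_tendsto_of_le_of_le tendsto_const_nhds ?_
      (fun n => (hgt n t).le) (fun n => hle n t)
    simpa using tendsto_const_nhds.add (tendsto_one_div_add_atTop_nhds_zero_nat (𝕜 := ℝ≥0))
  refine measurable_of_tendsto_metrizable (f := fun n (p : ℝ≥0 × WalkPath) => p.2.1 (d n p.1))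
    (fun n => ?_) (tendsto_pi_nhds.2 fun p => ?_)
  · have h1 : Measurable fun q : ℕ × WalkPath => q.2.1 (((q.1 : ℝ≥0) + 1) / (n + 1)) :=
      measurable_from_prod_countable_right fun k =>
        measurable_apply (((k : ℝ≥0) + 1) / (n + 1))
    exact h1.comp (((Nat.measurable_floor.comp (measurable_const.mul measurable_id)).comp
      measurable_fst).prodMk measurable_snd)
  · exact tendsto_nhds_of_eventually_eq ((hlim p.1).eventually (p.2.2.right_cont p.1))

theorem measurable_shift : Measurable fun p : ℝ≥0 × WalkPath => shift p.1 p.2 := by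
  refine Measurable.subtype_mk (measurable_pi_lambda _ fun t => ?_)
  exact (measurable_eval.comp ((measurable_fst.add_const t).prodMk measurable_snd)).sub
    measurable_eval

theorem measurable_concat (u : ℝ≥0) : Measurable fun p : WalkPath × WalkPath => concat u p.1 p.2 := by
  refine Measurable.subtype_mk (measurable_pi_lambda _ fun t => ?_)
  split_ifs with h
  · exact (measurable_apply t).comp measurable_fst
  · exact ((measurable_apply u).comp measurable_fst).add ((measurable_apply _).comp measurable_snd)

/-- A path stays at `z` for a while after reaching it, so dense times just after a visit to `z`
suffice to compute the infimum. -/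
theorem measurable_hitTime (x z : ℤ) :
    Measurable fun e : WalkPath => hitTime (fun t => x + e.1 t) z := by
  have h (e : WalkPath) : hitTime (fun t => x + e.1 t) z =
      ⨅ n : ℕ, if x + e.1 (TopologicalSpace.denseSeq ℝ≥0 n) = z then
        (TopologicalSpace.denseSeq ℝ≥0 n : ℝ≥0∞) else ∞ := by
    refine le_antisymm (le_iInf fun n => ?_) (le_iInf₂ fun t ht => le_of_forall_gt fun c hc => ?_)
    · split_ifs with h'
      · exact hitTime_le (y := fun t => x + e.1 t) h'
      · exact le_top
    · obtain ⟨b, hb, hb'⟩ := e.2.exists_gt t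
      have : (t : ℝ≥0∞) < min (b : ℝ≥0∞) c := lt_min (by exact_mod_cast hb) hc
      obtain ⟨c', h1, h2⟩ := ENNReal.lt_iff_exists_nnreal_btwn.1 this
      have h1' : t < c' := by exact_mod_cast h1
      obtain ⟨n, hn1, hn2⟩ := (TopologicalSpace.denseRange_denseSeq ℝ≥0).exists_mem_open
        isOpen_Ioo (Set.nonempty_Ioo.2 h1')
      have hlt : (TopologicalSpace.denseSeq ℝ≥0 n : ℝ≥0∞) < min (b : ℝ≥0∞) c :=
        lt_trans (by exact_mod_cast hn2) h2
      have hb2 := hb' _ hn1.le (by exact_mod_cast hlt.trans_le (min_le_left _ _))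
      refine (iInf_le _ n).trans_lt ?_
      rw [if_pos (by rw [hb2]; exact ht)]
      exact hlt.trans_le (min_le_right _ _)
  simp_rw [h]
  refine Measurable.iInf fun n => Measurable.ite ?_ measurable_const measurable_const
  exact (measurable_const.add (measurable_apply _)) (measurableSet_singleton z)

end WalkPath

/-! ### Product measures -/

/-- Replacing the coordinates in `A` of a family with law `∏ ρ i` by those of an independent family
with law `∏ ρ' i`. -/
theorem map_splice_infinitePi {ι : Type*} {X : Type*} [MeasurableSpace X] (ρ ρ' : ι → Measure X)
    [∀ i, IsProbabilityMeasure (ρ i)] [∀ i, IsProbabilityMeasure (ρ' i)] (A : Set ι)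
    [DecidablePred (· ∈ A)] :
    ((Measure.infinitePi ρ).prod (Measure.infinitePi ρ')).map
      (fun p i => if i ∈ A then p.2 i else p.1 i) =
    Measure.infinitePi fun i => if i ∈ A then ρ' i else ρ i := by
  have (i : ι) : IsProbabilityMeasure (if i ∈ A then ρ' i else ρ i) := by
    split_ifs <;> infer_instance
  have hm : Measurable fun (p : (ι → X) × (ι → X)) i => if i ∈ A then p.2 i else p.1 i := by
    refine measurable_pi_lambda _ fun i => ?_
    split_ifs <;> fun_prop
  refine Measure.eq_infinitePi _ fun s t ht => ?_
  rw [Measure.map_apply hm (.pi s.countable_toSet fun i _ => ht i)]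
  have : (fun (p : (ι → X) × (ι → X)) i => if i ∈ A then p.2 i else p.1 i) ⁻¹' (Set.pi s t) =
      (Set.pi (s.filter (· ∉ A) : Finset ι) t) ×ˢ (Set.pi (s.filter (· ∈ A) : Finset ι) t) := by
    ext p
    simp only [Set.mem_preimage, Set.mem_pi, Finset.mem_coe, Set.mem_prod, Finset.mem_filter]
    refine ⟨fun h => ⟨fun i hi => ?_, fun i hi => ?_⟩, fun h i hi => ?_⟩
    · simpa [hi.2] using h i hi.1
    · simpa [hi.2] using h i hi.1
    · split_ifs with hA
      · exact h.2 i ⟨hi, hA⟩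
      · exact h.1 i ⟨hi, hA⟩
  rw [this, Measure.prod_prod, Measure.infinitePi_pi _ fun i _ => ht i,
    Measure.infinitePi_pi _ fun i _ => ht i, mul_comm,
    ← Finset.prod_filter_mul_prod_filter_not s (· ∈ A)]
  congr 1
  · exact Finset.prod_congr rfl fun i hi => by rw [if_pos (Finset.mem_filter.1 hi).2]
  · exact Finset.prod_congr rfl fun i hi => by rw [if_neg (Finset.mem_filter.1 hi).2]

/-- Two independent families form a family of independent pairs. -/
theorem map_zip_infinitePi {ι : Type*} {X Z : Type*} [MeasurableSpace X] [MeasurableSpace Z]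
    (ρ : ι → Measure X) (ρ' : ι → Measure Z)
    [∀ i, IsProbabilityMeasure (ρ i)] [∀ i, IsProbabilityMeasure (ρ' i)] :
    ((Measure.infinitePi ρ).prod (Measure.infinitePi ρ')).map (fun p i => (p.1 i, p.2 i)) =
    Measure.infinitePi fun i => (ρ i).prod (ρ' i) := by
  have hm : Measurable fun (p : (ι → X) × (ι → Z)) i => (p.1 i, p.2 i) := by fun_prop
  refine Measure.eq_infinitePi _ fun s t ht => ?_
  rw [Measure.map_apply hm (.pi s.countable_toSet fun i _ => ht i)]
  have hr : Measurable (Prod.map (s.restrict (π := fun _ => X)) (s.restrict (π := fun _ => Z))) :=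
    (Finset.measurable_restrict s).prodMap (Finset.measurable_restrict s)
  have hB : MeasurableSet (Set.pi Set.univ fun i : s => t i) :=
    .univ_pi fun i => ht i
  have h1 : (fun (p : (ι → X) × (ι → Z)) i => (p.1 i, p.2 i)) ⁻¹' (Set.pi s t) =
      Prod.map (s.restrict (π := fun _ => X)) (s.restrict (π := fun _ => Z)) ⁻¹'
        ((MeasurableEquiv.arrowProdEquivProdArrow X Z s).symm ⁻¹'
          (Set.pi Set.univ fun i : s => t i)) := by
    ext p
    simp [Set.mem_pi, MeasurableEquiv.arrowProdEquivProdArrow, Equiv.arrowProdEquivProdArrow]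
  rw [h1, ← Measure.map_apply hr ((MeasurableEquiv.measurable _) hB),
    ← Measure.map_prod_map _ _ (Finset.measurable_restrict s) (Finset.measurable_restrict s),
    Measure.infinitePi_map_restrict, Measure.infinitePi_map_restrict]
  have h2 := (measurePreserving_arrowProdEquivProdArrow X Z s (fun i => ρ i) (fun i => ρ' i)).symm
  rw [h2.measure_preimage hB.nullMeasurableSet, Measure.pi_pi]
  exact Finset.prod_coe_sort s fun i => (ρ i).prod (ρ' i) (t i)

/-! ### The law of a walk -/

instance (t : ℝ≥0) : IsProbabilityMeasure (walkLaw t) :=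
  Measure.isProbabilityMeasure_map (measurable_of_countable _).aemeasurable

/-- The law of the simple symmetric random walk of rate `2` on the space of paths. -/
structure IsWalkLaw (W : Measure WalkPath) : Prop where
  isProbabilityMeasure : IsProbabilityMeasure W
  indep : HasIndepIncrements (fun t (e : WalkPath) => e.1 t) W
  law : ∀ s t, W.map (fun e : WalkPath => e.1 (s + t) - e.1 s) = walkLaw t

/-- The increments of a path along a sequence of times. -/
def increments (t : ℕ → ℝ≥0) (e : WalkPath) (n : ℕ) : ℤ := e.1 (t (n + 1)) - e.1 (t n)

theorem measurable_increments (t : ℕ → ℝ≥0) : Measurable (increments t) :=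
  measurable_pi_lambda _ fun _ =>
    (WalkPath.measurable_apply _).sub (WalkPath.measurable_apply _)

theorem IsWalkLaw.map_increments {W : Measure WalkPath} (hW : IsWalkLaw W) {t : ℕ → ℝ≥0}
    (ht : Monotone t) :
    W.map (increments t) = Measure.infinitePi fun n => walkLaw (t (n + 1) - t n) := by
  have := hW.isProbabilityMeasure
  have h := (hW.indep.nat ht).map_fun_eq_infinitePi_map fun n =>
    (WalkPath.measurable_apply _).sub (WalkPath.measurable_apply _)
  refine h.trans ?_
  congr 1
  ext1 n
  rw [← hW.law (t n) (t (n + 1) - t n), add_tsub_cancel_of_le (ht n.le_succ)]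
  rfl

/-- A finite set of times is contained in a monotone sequence that starts at `0`. -/
theorem exists_monotone_range (I : Finset ℝ≥0) :
    ∃ t : ℕ → ℝ≥0, Monotone t ∧ t 0 = 0 ∧ ∀ v ∈ I, ∃ n, t n = v := by
  classical
  set J := insert 0 I with hJ
  have hk : 0 < J.card := Finset.card_pos.2 ⟨0, Finset.mem_insert_self _ _⟩
  -- The increasing enumeration, constant at the largest element once the set is exhausted.
  let t (n : ℕ) : ℝ≥0 := J.orderEmbOfFin rfl ⟨min n (J.card - 1), by omega⟩
  have ht (v) (hv : v ∈ J) : ∃ n, t n = v := by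
    have : v ∈ Set.range (J.orderEmbOfFin rfl) := by
      rw [Finset.range_orderEmbOfFin]; exact hv
    obtain ⟨i, rfl⟩ := this
    refine ⟨i, ?_⟩
    simp only [t]
    congr 1
    ext
    exact min_eq_left (by have := i.2; omega)
  have hmono : Monotone t := fun m n h => (J.orderEmbOfFin rfl).monotone (by
    simp only [Fin.mk_le_mk]; omega)
  refine ⟨t, hmono, ?_, fun v hv => ht v (Finset.mem_insert_of_mem hv)⟩
  obtain ⟨n, hn⟩ := ht 0 (Finset.mem_insert_self _ _)
  exact le_antisymm (hn ▸ hmono (Nat.zero_le n)) (zero_le)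

/-- The law of a path is determined by the laws of its increments along sequences of times that
visit a given time `u`. -/
theorem ext_of_increments {W W' : Measure WalkPath} [IsProbabilityMeasure W]
    [IsProbabilityMeasure W'] (u : ℝ≥0)
    (h : ∀ t : ℕ → ℝ≥0, Monotone t → t 0 = 0 → (∃ m, t m = u) →
      W.map (increments t) = W'.map (increments t)) : W = W' := by
  classical
  have hval : W.map (Subtype.val : WalkPath → ℝ≥0 → ℤ) = W'.map Subtype.val := by
    have h1 (V : Measure WalkPath) (I : Finset ℝ≥0) :
        (V.map (Subtype.val : WalkPath → ℝ≥0 → ℤ)).map I.restrict =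
          V.map fun e : WalkPath => I.restrict e.1 :=
      Measure.map_map (Finset.measurable_restrict I) measurable_subtype_coe
    refine IsProjectiveLimit.unique (P := fun I : Finset ℝ≥0 =>
      W'.map fun e : WalkPath => I.restrict e.1) (fun I => ?_) (fun I => h1 W' I)
    rw [h1]
    obtain ⟨t, ht, h0, hI⟩ := exists_monotone_range (insert u I)
    choose! m hm using hI
    -- Values of the path are partial sums of its increments, because `t 0 = 0` and the path starts
    -- at `0`.
    let G (x : ℕ → ℤ) (v : I) : ℤ := ∑ n ∈ Finset.range (m v), x n
    have hG : Measurable G := by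
      refine measurable_pi_lambda _ fun v => Finset.measurable_sum _ fun n _ => ?_
      exact measurable_pi_apply n
    have hGi : (fun e : WalkPath => I.restrict (π := fun _ => ℤ) e.1) = G ∘ increments t := by
      ext e v
      simp only [Function.comp, G, increments]
      rw [Finset.sum_range_sub (fun n => e.1 (t n)), h0, e.apply_zero,
        hm _ (Finset.mem_insert_of_mem v.2), sub_zero]
      rfl
    change _ = W'.map fun e : WalkPath => I.restrict (π := fun _ => ℤ) e.1
    rw [hGi, ← Measure.map_map hG (measurable_increments t),
      ← Measure.map_map hG (measurable_increments t),
      h t ht h0 ⟨m u, hm u (Finset.mem_insert_self _ _)⟩]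
  ext s hs
  obtain ⟨s', hs', rfl⟩ := hs
  rw [← Measure.map_apply measurable_subtype_coe hs', hval,
    Measure.map_apply measurable_subtype_coe hs']

theorem IsWalkLaw.unique {W W' : Measure WalkPath} (hW : IsWalkLaw W) (hW' : IsWalkLaw W') :
    W = W' := by
  have := hW.isProbabilityMeasure
  have := hW'.isProbabilityMeasure
  exact ext_of_increments 0 fun t ht _ _ => by rw [hW.map_increments ht, hW'.map_increments ht]

theorem IsWalkLaw.shift {W : Measure WalkPath} (hW : IsWalkLaw W) (u : ℝ≥0) :
    MeasurePreserving (WalkPath.shift u) W W := by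
  have := hW.isProbabilityMeasure
  have hm : Measurable (WalkPath.shift u) :=
    WalkPath.measurable_shift.comp (measurable_const.prodMk measurable_id)
  refine ⟨hm, ?_⟩
  have := Measure.isProbabilityMeasure_map (μ := W) hm.aemeasurable
  refine ext_of_increments 0 fun t ht _ _ => ?_
  rw [Measure.map_map (measurable_increments t) hm]
  have : increments t ∘ WalkPath.shift u = increments fun n => u + t n := by
    ext e n; simp [increments]
  have ht' : Monotone fun n => u + t n := fun m n h => add_le_add_right (ht h) u
  rw [this, hW.map_increments ht, hW.map_increments ht']
  congr 1
  ext1 n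
  rw [add_tsub_add_eq_tsub_left]

/-- The simple Markov property of a single walk, as an identity of laws. Testing only along
sequences that visit `u` ensures that each increment lies entirely before or entirely after `u`, so
it comes from exactly one of the two independent paths. -/
theorem IsWalkLaw.concat {W : Measure WalkPath} (hW : IsWalkLaw W) (u : ℝ≥0) :
    MeasurePreserving (fun p : WalkPath × WalkPath => WalkPath.concat u p.1 p.2) (W.prod W) W := by
  classical
  have := hW.isProbabilityMeasure
  have hm := WalkPath.measurable_concat u
  refine ⟨hm, ?_⟩
  have := Measure.isProbabilityMeasure_map (μ := W.prod W) hm.aemeasurable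
  refine ext_of_increments u fun t ht h0 ⟨m, hmu⟩ => ?_
  rw [Measure.map_map (measurable_increments t) hm, hW.map_increments ht]
  -- Truncated subtraction makes the entries of `t n - u` before index `m` meaningless, but the
  -- splice discards them.
  have hs : increments t ∘ (fun p : WalkPath × WalkPath => WalkPath.concat u p.1 p.2) =
      (fun p n => if n ∈ Set.Ici m then p.2 n else p.1 n) ∘
        Prod.map (increments t) (increments fun n => t n - u) := by
    ext p n
    simp only [Function.comp, increments, Prod.map, Set.mem_Ici]
    split_ifs with h
    · have h1 : u ≤ t n := hmu ▸ ht h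
      rw [WalkPath.concat_of_ge _ _ h1, WalkPath.concat_of_ge _ _ (h1.trans (ht n.le_succ))]
      ring
    · have h1 : t (n + 1) ≤ u := hmu ▸ ht (by omega)
      rw [WalkPath.concat_of_le _ _ h1, WalkPath.concat_of_le _ _ ((ht n.le_succ).trans h1)]
  have ht' : Monotone fun n => t n - u := fun a b h => tsub_le_tsub_right (ht h) u
  have hms : Measurable fun (p : (ℕ → ℤ) × (ℕ → ℤ)) n =>
      if n ∈ Set.Ici m then p.2 n else p.1 n := by
    refine measurable_pi_lambda _ fun i => ?_
    split_ifs <;> fun_prop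
  rw [hs, ← Measure.map_map hms ((measurable_increments _).prodMap (measurable_increments _)),
    ← Measure.map_prod_map _ _ (measurable_increments _) (measurable_increments _),
    hW.map_increments ht, hW.map_increments ht', map_splice_infinitePi]
  congr 1
  ext1 n
  split_ifs with h
  · have h1 : u ≤ t n := hmu ▸ ht h
    congr 1
    rw [tsub_tsub_tsub_cancel_right h1]
  · rfl

/-! ### Families of independent walks -/

/-- The law of a family of independent walks. -/
noncomputable def familyLaw (W : Measure WalkPath) : Measure Family := Measure.infinitePi fun _ => W

theorem IsWalkLaw.familyLaw {W : Measure WalkPath} (hW : IsWalkLaw W) :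
    IsProbabilityMeasure (familyLaw W) := by
  have := hW.isProbabilityMeasure
  unfold Combustion.familyLaw
  infer_instance

theorem IsWalkLaw.splice_family {W : Measure WalkPath} (hW : IsWalkLaw W) (A : Set (ℤ × ℕ))
    [DecidablePred (· ∈ A)] :
    MeasurePreserving (fun (p : Family × Family) i => if i ∈ A then p.2 i else p.1 i)
      ((Combustion.familyLaw W).prod (Combustion.familyLaw W)) (Combustion.familyLaw W) := by
  have := hW.isProbabilityMeasure
  refine ⟨?_, ?_⟩
  · refine measurable_pi_lambda _ fun i => ?_
    split_ifs <;> fun_prop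
  · unfold Combustion.familyLaw
    rw [map_splice_infinitePi]
    simp

/-- The shift is deterministic here; a random shift is obtained later by using this on the fibres of
a skew product. -/
theorem IsWalkLaw.shift_family {W : Measure WalkPath} (hW : IsWalkLaw W) (u : ℝ≥0)
    (A : Set (ℤ × ℕ)) [DecidablePred (· ∈ A)] :
    MeasurePreserving (fun (y : Family) i => if i ∈ A then WalkPath.shift u (y i) else y i)
      (Combustion.familyLaw W) (Combustion.familyLaw W) := by
  have := hW.isProbabilityMeasure
  have hm (i : ℤ × ℕ) : Measurable
      fun e : WalkPath => if i ∈ A then WalkPath.shift u e else e := by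
    split_ifs
    · exact (hW.shift u).measurable
    · exact measurable_id
  refine ⟨measurable_pi_lambda _ fun i => (hm i).comp (measurable_pi_apply i), ?_⟩
  unfold Combustion.familyLaw
  rw [Measure.infinitePi_map_pi _ hm]
  congr 1
  ext1 i
  split_ifs
  · exact (hW.shift u).map_eq
  · exact Measure.map_id

/-- All paths of a family are continued at time `u` by those of another family. -/
noncomputable def concatFamily (u : ℝ≥0) (p : Family × Family) : Family :=
  fun i => WalkPath.concat u (p.1 i) (p.2 i)

theorem IsWalkLaw.concat_family {W : Measure WalkPath} (hW : IsWalkLaw W) (u : ℝ≥0) :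
    MeasurePreserving (concatFamily u)
      ((Combustion.familyLaw W).prod (Combustion.familyLaw W)) (Combustion.familyLaw W) := by
  have := hW.isProbabilityMeasure
  have hm := (hW.concat u).measurable
  have hz : Measurable fun (p : Family × Family) i => (p.1 i, p.2 i) := by fun_prop
  have hc : Measurable fun (q : ℤ × ℕ → WalkPath × WalkPath) i =>
      WalkPath.concat u (q i).1 (q i).2 :=
    measurable_pi_lambda _ fun i => hm.comp (measurable_pi_apply i)
  refine ⟨hc.comp hz, ?_⟩
  change Measure.map ((fun (q : ℤ × ℕ → WalkPath × WalkPath) i =>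
      WalkPath.concat u (q i).1 (q i).2) ∘ fun (p : Family × Family) i => (p.1 i, p.2 i)) _ = _
  rw [← Measure.map_map hc hz]
  unfold Combustion.familyLaw
  rw [map_zip_infinitePi, Measure.infinitePi_map_pi _ fun _ => hm]
  congr 1
  ext1 i
  exact (hW.concat u).map_eq

/-- Distinct labels select distinct independent walks. Surjectivity is not needed, so a relabelling
may leave labels unused. -/
theorem IsWalkLaw.relabel {W : Measure WalkPath} (hW : IsWalkLaw W) {g : ℤ × ℕ → ℤ × ℕ}
    (hg : Function.Injective g) :
    MeasurePreserving (fun (y : Family) i => y (g i))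
      (Combustion.familyLaw W) (Combustion.familyLaw W) := by
  have := hW.isProbabilityMeasure
  exact ⟨by fun_prop, Measure.map_infinitePi_infinitePi_of_inj hg⟩

/-! ### Exponential moments and hitting times -/

/-- The exponent of the exponential moments of the walk. -/
noncomputable def expRate (m : ℝ) : ℝ := Real.exp m + Real.exp (-m) - 2

theorem expRate_pos {m : ℝ} (hm : 0 < m) : 0 < expRate m := by
  have h1 : Real.exp m * Real.exp (-m) = 1 := by rw [← Real.exp_add]; simp
  have h2 : 1 < Real.exp m := Real.one_lt_exp_iff.2 hm
  have h3 := Real.exp_pos (-m)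
  unfold expRate
  nlinarith [sq_nonneg (Real.exp m - 1), mul_pos h3 (pow_pos (sub_pos.2 h2) 2)]

theorem lintegral_exp_poissonMeasure (t : ℝ≥0) (m : ℝ) :
    ∫⁻ n : ℕ, ENNReal.ofReal (Real.exp (m * n)) ∂poissonMeasure t =
      ENNReal.ofReal (Real.exp (t * (Real.exp m - 1))) := by
  have hs : HasSum (fun n : ℕ => Real.exp (m * n) * (Real.exp (-t) * t ^ n / n.factorial))
      (Real.exp (t * (Real.exp m - 1))) := by
    have h0 : HasSum (fun n : ℕ => (t * Real.exp m) ^ n / n.factorial)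
        (Real.exp (t * Real.exp m)) := by
      rw [Real.exp_eq_exp_ℝ]
      exact NormedSpace.expSeries_div_hasSum_exp _
    have h := h0.mul_left (Real.exp (-t))
    rw [← Real.exp_add] at h
    have e1 : (t : ℝ) * (Real.exp m - 1) = -t + t * Real.exp m := by ring
    rw [e1]
    refine h.congr_fun fun n => ?_
    rw [mul_pow, ← Real.exp_nat_mul, mul_comm m]
    ring
  rw [lintegral_countable', ← hs.tsum_eq, ENNReal.ofReal_tsum_of_nonneg
    (fun n => by positivity) hs.summable]
  refine tsum_congr fun n => ?_
  rw [poissonMeasure_singleton, ENNReal.ofReal_mul (Real.exp_pos _).le]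

theorem lintegral_exp_walkLaw (t : ℝ≥0) (m : ℝ) :
    ∫⁻ k : ℤ, ENNReal.ofReal (Real.exp (m * k)) ∂walkLaw t =
      ENNReal.ofReal (Real.exp (t * expRate m)) := by
  rw [walkLaw, lintegral_map (measurable_of_countable _) (measurable_of_countable _)]
  have h (p : ℕ × ℕ) : ENNReal.ofReal (Real.exp (m * (((p.1 : ℤ) - (p.2 : ℤ) : ℤ) : ℝ))) =
      ENNReal.ofReal (Real.exp (m * p.1)) * ENNReal.ofReal (Real.exp (-m * p.2)) := by
    rw [← ENNReal.ofReal_mul (Real.exp_pos _).le, ← Real.exp_add]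
    push_cast
    ring_nf
  simp_rw [h]
  rw [lintegral_prod_mul (f := fun n : ℕ => ENNReal.ofReal (Real.exp (m * n)))
    (g := fun n : ℕ => ENNReal.ofReal (Real.exp (-m * n)))
    (measurable_of_countable _).aemeasurable (measurable_of_countable _).aemeasurable, lintegral_exp_poissonMeasure,
    lintegral_exp_poissonMeasure, ← ENNReal.ofReal_mul (Real.exp_pos _).le, ← Real.exp_add]
  unfold expRate
  ring_nf

theorem IsWalkLaw.lintegral_exp {W : Measure WalkPath} (hW : IsWalkLaw W) (t : ℝ≥0) (m : ℝ) :
    ∫⁻ e, ENNReal.ofReal (Real.exp (m * e.1 t)) ∂W =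
      ENNReal.ofReal (Real.exp (t * expRate m)) := by
  have h : W.map (fun e : WalkPath => e.1 t) = walkLaw t := by
    rw [← hW.law 0 t]
    simp [WalkPath.apply_zero]
  rw [← lintegral_exp_walkLaw, ← h,
    lintegral_map (measurable_of_countable _) (WalkPath.measurable_apply t)]

/-- A maximal inequality by induction on the number of steps: condition on the first step of length
`h`, apply the bound to the remaining `n` steps with target `k - e h`, and integrate, which costs
the factor `exp(h * expRate m)`. For `k ≤ 0` the bound is at least one. -/
theorem IsWalkLaw.grid_le {W : Measure WalkPath} (hW : IsWalkLaw W) {m : ℝ} (hm : 0 < m)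
    (h : ℝ≥0) (n : ℕ) (k : ℤ) :
    W {e | ∃ j : ℕ, j ≤ n ∧ k ≤ e.1 (j * h)} ≤
      ENNReal.ofReal (Real.exp (n * h * expRate m - m * k)) := by
  have := hW.isProbabilityMeasure
  have hc := expRate_pos hm
  have hneg (n : ℕ) (k : ℤ) (hk : k ≤ 0) : W {e | ∃ j : ℕ, j ≤ n ∧ k ≤ e.1 (j * h)} ≤
      ENNReal.ofReal (Real.exp (n * h * expRate m - m * k)) := by
    refine prob_le_one.trans ?_
    rw [ENNReal.one_le_ofReal, Real.one_le_exp_iff]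
    have : (k : ℝ) ≤ 0 := by exact_mod_cast hk
    have : 0 ≤ (n : ℝ) * h * expRate m := by positivity
    nlinarith
  have hmeas (n : ℕ) (k : ℤ) : MeasurableSet {e : WalkPath | ∃ j : ℕ, j ≤ n ∧ k ≤ e.1 (j * h)} := by
    have : {e : WalkPath | ∃ j : ℕ, j ≤ n ∧ k ≤ e.1 (j * h)} =
        ⋃ j : ℕ, ⋃ _ : j ≤ n, (fun e : WalkPath => e.1 (j * h)) ⁻¹' Set.Ici k := by
      ext e; simp
    rw [this]
    exact .iUnion fun j => .iUnion fun _ => WalkPath.measurable_apply _ (measurableSet_Ici)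
  induction n generalizing k with
  | zero =>
    rcases le_or_gt k 0 with hk | hk
    · exact hneg 0 k hk
    · have : {e : WalkPath | ∃ j : ℕ, j ≤ 0 ∧ k ≤ e.1 (j * h)} = ∅ := by
        ext e
        simp [WalkPath.apply_zero, hk]
      rw [this, measure_empty]
      exact zero_le
  | succ n ih =>
    rcases le_or_gt k 0 with hk | hk
    · exact hneg _ k hk
    · rw [← (hW.concat h).measure_preimage (hmeas _ _).nullMeasurableSet,
        Measure.prod_apply ((hW.concat h).measurable (hmeas _ _))]
      calc _ ≤ ∫⁻ e, ENNReal.ofReal (Real.exp (n * h * expRate m - m * k)) *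
            ENNReal.ofReal (Real.exp (m * e.1 h)) ∂W := by
            refine lintegral_mono fun e => ?_
            refine (measure_mono (t := {g : WalkPath | ∃ j : ℕ, j ≤ n ∧ k - e.1 h ≤ g.1 (j * h)})
              ?_).trans ((ih (k - e.1 h)).trans_eq ?_)
            · rintro g ⟨j, hj, hjk⟩
              rcases j with _ | j
              · rw [Nat.cast_zero, zero_mul, WalkPath.apply_zero] at hjk
                omega
              · refine ⟨j, by omega, ?_⟩
                have h1 : ((j + 1 : ℕ) : ℝ≥0) * h = h + j * h := by push_cast; ring
                rw [WalkPath.concat_of_ge _ _ (by rw [h1]; exact le_self_add), h1,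
                  add_tsub_cancel_left] at hjk
                simp only at hjk
                omega
            · rw [← ENNReal.ofReal_mul (Real.exp_pos _).le, ← Real.exp_add]
              push_cast
              ring_nf
        _ = _ := by
            have hme : Measurable fun e : WalkPath => ENNReal.ofReal (Real.exp (m * e.1 h)) :=
              (measurable_of_countable fun k : ℤ => ENNReal.ofReal (Real.exp (m * k))).comp
                (WalkPath.measurable_apply h)
            rw [lintegral_const_mul _ hme,
              hW.lintegral_exp, ← ENNReal.ofReal_mul (Real.exp_pos _).le, ← Real.exp_add]
            push_cast
            ring_nf

theorem hitTime_add (x z : ℤ) (e : ℝ≥0 → ℤ) :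
    hitTime (fun t => x + e t) z = hitTime e (z - x) := by
  simp only [hitTime, eq_sub_iff_add_eq']

theorem WalkPath.measurable_hitTime' (z : ℤ) : Measurable fun e : WalkPath => hitTime e.1 z := by
  simpa using WalkPath.measurable_hitTime 0 z

/-- Exponential bound for the probability of hitting `k` before time `t`. -/
theorem IsWalkLaw.hitTime_le {W : Measure WalkPath} (hW : IsWalkLaw W) {m : ℝ} (hm : 0 < m)
    (t : ℝ≥0) (k : ℤ) :
    W {e | hitTime e.1 k ≤ t} ≤ ENNReal.ofReal (Real.exp (t * expRate m - m * k)) := by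
  -- Dyadic grids are nested, and a path that reaches `k` before `t` remains there long enough to be
  -- seen on a fine grid.
  set A : ℕ → Set WalkPath := fun n => {e | ∃ j : ℕ, j ≤ 2 ^ n ∧ k ≤ e.1 (j * (t / 2 ^ n))}
  have hA : Monotone A := by
    refine monotone_nat_of_le_succ fun n e => ?_
    rintro ⟨j, hj, hk⟩
    refine ⟨2 * j, by rw [pow_succ]; omega, ?_⟩
    convert hk using 2
    rw [pow_succ]
    push_cast
    field_simp
  have hsub : {e : WalkPath | hitTime e.1 k ≤ t} ⊆ ⋃ n, A n := by
    intro e he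
    obtain ⟨s, hs, hs'⟩ := e.2.exists_hitTime (lt_of_le_of_lt he ENNReal.coe_lt_top)
    have hst : s ≤ t := by
      rw [Set.mem_ofPred_eq, hs'] at he
      exact_mod_cast he
    rw [Set.mem_iUnion]
    rcases hst.eq_or_lt with rfl | hst
    -- A visit exactly at time `t` needs no room to the right: `t` is itself the last point of every
    -- grid.
    · exact ⟨0, 1, by simp, by simp [hs]⟩
    · obtain ⟨b, hb, hc⟩ := e.2.exists_gt s
      have ht : 0 < t := hst.bot_lt
      obtain ⟨n, hn⟩ := exists_pow_lt_of_lt_one (show 0 < (b - s) / t from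
        div_pos (tsub_pos_of_lt hb) ht) (show (2⁻¹ : ℝ≥0) < 1 by
          rw [← NNReal.coe_lt_coe]; push_cast; norm_num)
      have hd : t / 2 ^ n < b - s := by
        rw [lt_div_iff₀ ht, inv_pow] at hn
        rwa [div_eq_inv_mul]
      have hd0 : 0 < t / 2 ^ n := by positivity
      refine ⟨n, ⌈s / (t / 2 ^ n)⌉₊, ?_, ?_⟩
      · refine Nat.ceil_le.2 ?_
        push_cast
        rw [div_le_iff₀ hd0]
        calc s ≤ t := hst.le
          _ = 2 ^ n * (t / 2 ^ n) := by field_simp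
      · rw [hc, hs]
        · exact (div_le_iff₀ hd0).1 (Nat.le_ceil _)
        · have := Nat.ceil_lt_add_one (zero_le (a := s / (t / 2 ^ n)))
          calc _ < (s / (t / 2 ^ n) + 1) * (t / 2 ^ n) := by gcongr
            _ = s + t / 2 ^ n := by field_simp
            _ < b := by rwa [← lt_tsub_iff_left]
  refine (measure_mono hsub).trans ?_
  rw [hA.measure_iUnion]
  refine iSup_le fun n => (hW.grid_le hm (t / 2 ^ n) (2 ^ n) k).trans_eq ?_
  congr 3
  push_cast
  field_simp

/-- An upper bound for `e^{θ y (t)}`, `t ≤ N`, with a finite expectation. -/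
noncomputable def pathWeight (θ : ℝ) (N : ℕ) (e : WalkPath) : ℝ≥0∞ :=
  1 + ∑' k : ℕ, {e : WalkPath | hitTime e.1 (k + 1) ≤ N}.indicator
    (fun _ => ENNReal.ofReal (Real.exp (θ * (k + 1)))) e

theorem measurable_pathWeight (θ : ℝ) (N : ℕ) : Measurable (pathWeight θ N) := by
  have h (k : ℕ) : Measurable ({e : WalkPath | hitTime e.1 (k + 1) ≤ N}.indicator
      fun _ => ENNReal.ofReal (Real.exp (θ * (k + 1)))) :=
    measurable_const.indicator ((WalkPath.measurable_hitTime' _) measurableSet_Iic)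
  exact measurable_const.add (Measurable.tsum h)

theorem exp_le_pathWeight {θ : ℝ} (hθ : 0 < θ) {N : ℕ} {t : ℝ≥0} (ht : t ≤ N) (e : WalkPath) :
    ENNReal.ofReal (Real.exp (θ * e.1 t)) ≤ pathWeight θ N e := by
  rcases le_or_gt (e.1 t) 0 with h | h
  · refine le_trans ?_ le_self_add
    rw [ENNReal.ofReal_le_one, Real.exp_le_one_iff]
    have : (e.1 t : ℝ) ≤ 0 := by exact_mod_cast h
    exact mul_nonpos_of_nonneg_of_nonpos hθ.le this
  · obtain ⟨k, hk⟩ : ∃ k : ℕ, e.1 t = k + 1 := ⟨(e.1 t - 1).toNat, by omega⟩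
    refine le_trans ?_ le_add_self
    refine le_trans (le_of_eq ?_) (ENNReal.le_tsum k)
    rw [Set.indicator_of_mem, hk]
    · push_cast; rfl
    · exact (Combustion.hitTime_le hk).trans (by exact_mod_cast ht)

theorem one_le_pathWeight (θ : ℝ) (N : ℕ) (e : WalkPath) : 1 ≤ pathWeight θ N e := le_self_add

/-- With exponent `2 * θ` in the hitting bound, `exp(θ(k+1)) P(hit k+1 before N)` is at most a
constant times `exp(-θ(k+1))`, a geometric series. -/
theorem IsWalkLaw.lintegral_pathWeight {W : Measure WalkPath} (hW : IsWalkLaw W) {θ : ℝ}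
    (hθ : 0 < θ) (N : ℕ) : ∫⁻ e, pathWeight θ N e ∂W < ∞ := by
  have := hW.isProbabilityMeasure
  have hA (k : ℕ) : MeasurableSet {e : WalkPath | hitTime e.1 (k + 1) ≤ N} :=
    (WalkPath.measurable_hitTime' _) measurableSet_Iic
  unfold pathWeight
  rw [lintegral_add_left measurable_const, lintegral_tsum fun k =>
    (measurable_const.indicator (hA k)).aemeasurable]
  simp only [lintegral_const, measure_univ, mul_one]
  refine ENNReal.add_lt_top.2 ⟨ENNReal.one_lt_top, ?_⟩
  have hb (k : ℕ) : ∫⁻ e, {e : WalkPath | hitTime e.1 (k + 1) ≤ N}.indicator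
      (fun _ => ENNReal.ofReal (Real.exp (θ * (k + 1)))) e ∂W ≤
      ENNReal.ofReal (Real.exp (N * expRate (2 * θ)) * Real.exp (-θ) ^ (k + 1)) := by
    rw [lintegral_indicator_const (hA k)]
    refine (mul_le_mul_right (hW.hitTime_le (m := 2 * θ) (by positivity) N (k + 1)) _).trans_eq ?_
    rw [← ENNReal.ofReal_mul (Real.exp_pos _).le, ← Real.exp_add, ← Real.exp_nat_mul,
      ← Real.exp_add]
    push_cast
    ring_nf
  refine (ENNReal.tsum_le_tsum hb).trans_lt ?_
  rw [← ENNReal.ofReal_tsum_of_nonneg (fun k => by positivity)]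
  · exact ENNReal.ofReal_lt_top
  · refine Summable.mul_left _ ((summable_nat_add_iff 1).2 ?_)
    exact summable_geometric_of_lt_one (Real.exp_pos _).le (Real.exp_lt_one_iff.2 (by linarith))

/-! ### Laplace transforms of hitting times -/

/-- The function `e^{-c t}`, extended by `0` to `t = ∞`. -/
noncomputable def discount (c : ℝ) (t : ℝ≥0∞) : ℝ≥0∞ :=
  if t = ∞ then 0 else ENNReal.ofReal (Real.exp (-c * t.toReal))

theorem discount_add (c : ℝ) (s t : ℝ≥0∞) : discount c (s + t) = discount c s * discount c t := by
  unfold discount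
  by_cases hs : s = ∞
  · simp [hs]
  by_cases ht : t = ∞
  · simp [ht]
  rw [if_neg (ENNReal.add_ne_top.2 ⟨hs, ht⟩), if_neg hs, if_neg ht,
    ← ENNReal.ofReal_mul (Real.exp_pos _).le, ← Real.exp_add, ENNReal.toReal_add hs ht, mul_add]

theorem discount_antitone {c : ℝ} (hc : 0 ≤ c) : Antitone (discount c) := by
  intro s t h
  unfold discount
  by_cases ht : t = ∞
  · simp [ht]
  have hs : s ≠ ∞ := ne_top_of_le_ne_top ht h
  rw [if_neg hs, if_neg ht]
  refine ENNReal.ofReal_le_ofReal (Real.exp_le_exp.2 ?_)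
  have := ENNReal.toReal_mono ht h
  nlinarith

theorem discount_coe_pos (c : ℝ) (t : ℝ≥0) : 0 < discount c t := by
  unfold discount
  rw [if_neg ENNReal.coe_ne_top, ENNReal.ofReal_pos]
  exact Real.exp_pos _

theorem measurable_discount (c : ℝ) : Measurable (discount c) := by
  refine Measurable.ite (measurableSet_singleton _) measurable_const ?_
  exact (Real.measurable_exp.comp (ENNReal.measurable_toReal.const_mul _)).ennreal_ofReal

/-- A constant in the bound for Laplace transforms of hitting times. -/
noncomputable def laplaceConst : ℝ := ∑' j : ℕ, Real.exp (1 - j)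

theorem summable_laplaceConst : Summable fun j : ℕ => Real.exp (1 - j) := by
  have : (fun j : ℕ => Real.exp (1 - j)) = fun j : ℕ => Real.exp 1 * Real.exp (-1) ^ j := by
    ext j
    rw [← Real.exp_nat_mul, ← Real.exp_add]
    ring_nf
  rw [this]
  exact (summable_geometric_of_lt_one (Real.exp_pos _).le (Real.exp_lt_one_iff.2 (by norm_num))).mul_left _

theorem laplaceConst_nonneg : 0 ≤ laplaceConst := tsum_nonneg fun _ => (Real.exp_pos _).le

/-- Slice time into intervals of length `1 / c`. On the `j`-th slice the discount is at most
`exp(-2j)`, while `k` is hit by its end with probability at most `exp(j + 1 - mk)`. The discount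
rate is twice `c` so that the product `exp(1 - j) exp(-mk)` is summable in `j`. -/
theorem IsWalkLaw.lintegral_discount {W : Measure WalkPath} (hW : IsWalkLaw W) {m : ℝ}
    (hm : 0 < m) (k : ℤ) :
    ∫⁻ e, discount (2 * expRate m) (hitTime e.1 k) ∂W ≤
      ENNReal.ofReal (laplaceConst * Real.exp (-m * k)) := by
  have hc := expRate_pos hm
  set c := expRate m with hcdef
  let T (j : ℕ) : ℝ≥0 := ⟨(j + 1) / c, by positivity⟩
  let A (j : ℕ) : Set WalkPath := {e | hitTime e.1 k ≤ T j}
  have hA (j : ℕ) : MeasurableSet (A j) := (WalkPath.measurable_hitTime' _) measurableSet_Iic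
  have hle (e : WalkPath) : discount (2 * c) (hitTime e.1 k) ≤
      ∑' j : ℕ, (A j).indicator (fun _ => ENNReal.ofReal (Real.exp (-2 * j))) e := by
    by_cases hi : hitTime e.1 k = ∞
    · simp [hi, discount]
    · set h := (hitTime e.1 k).toReal with hh
      have h0 : 0 ≤ h := ENNReal.toReal_nonneg
      have h1 := Nat.floor_le (mul_nonneg h0 hc.le)
      have h2 := Nat.lt_floor_add_one (h * c)
      refine le_trans ?_ (ENNReal.le_tsum ⌊h * c⌋₊)
      rw [Set.indicator_of_mem]
      · rw [discount, if_neg hi]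
        refine ENNReal.ofReal_le_ofReal (Real.exp_le_exp.2 ?_)
        linarith
      · change hitTime e.1 k ≤ T _
        rw [← ENNReal.ofReal_toReal hi, ENNReal.ofReal, ENNReal.coe_le_coe]
        rw [Real.toNNReal_le_iff_le_coe]
        change h ≤ (⌊h * c⌋₊ + 1) / c
        rw [le_div_iff₀ hc]
        exact h2.le
  refine (lintegral_mono hle).trans ?_
  rw [lintegral_tsum fun j => (measurable_const.indicator (hA j)).aemeasurable, laplaceConst,
    ← tsum_mul_right, ENNReal.ofReal_tsum_of_nonneg (fun _ => by positivity)
      (summable_laplaceConst.mul_right _)]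
  refine ENNReal.tsum_le_tsum fun j => ?_
  rw [lintegral_indicator_const (hA j)]
  refine (mul_le_mul_right (hW.hitTime_le hm (T j) k) _).trans_eq ?_
  rw [← ENNReal.ofReal_mul (Real.exp_pos _).le, ← Real.exp_add, ← Real.exp_add]
  congr 2
  change -2 * (j : ℝ) + ((j + 1) / c * c - m * k) = _
  field_simp
  ring

namespace State

/-! ### Topology and measurability of the state space -/

variable {θ : ℝ}

theorem dist_def (s t : State θ) :
    dist s t = |(s.front : ℝ) - (t.front : ℝ)| + ∑' x : ℤ, distTerm s t x := rfl

theorem distTerm_le_dist (s t : State θ) (x : ℤ) : distTerm s t x ≤ dist s t :=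
  ((summable_distTerm s t).le_tsum x fun y _ => distTerm_nonneg s t y).trans
    (le_add_of_nonneg_left (abs_nonneg _))

theorem ofReal_dist (s t : State θ) : ENNReal.ofReal (dist s t) =
    ENNReal.ofReal |(s.front : ℝ) - (t.front : ℝ)| + ∑' x : ℤ, ENNReal.ofReal (distTerm s t x) := by
  rw [dist_def, ENNReal.ofReal_add (abs_nonneg _) (tsum_nonneg (distTerm_nonneg s t)),
    ENNReal.ofReal_tsum_of_nonneg (distTerm_nonneg s t) (summable_distTerm s t)]

/-- States with finitely many particles. -/
noncomputable def ofFinsupp (θ : ℝ) (p : ℤ × (ℤ →₀ ℕ)) : State θ where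
  front := p.1
  occ x := if x ≤ p.1 then p.2 x else 0
  occ_eq_zero x hx := if_neg (not_le.2 hx)
  summable_occ := by
    refine summable_of_ne_finset_zero (s := p.2.support) fun x hx => ?_
    rw [Finsupp.notMem_support_iff.1 hx]
    simp

theorem denseRange_ofFinsupp : DenseRange (ofFinsupp θ) := by
  classical
  intro s
  rw [Metric.mem_closure_range_iff]
  intro ε hε
  obtain ⟨A, hA⟩ := ((tendsto_order.1 (tendsto_tsum_compl_atTop_zero
    fun x : ℤ => Real.exp (θ * (x : ℝ)) * (s.occ (x + s.front) : ℝ))).2 ε hε).exists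
  refine ⟨(s.front, Finsupp.onFinset (A.image (· + s.front))
    (fun x => if x - s.front ∈ A then s.occ x else 0) fun x hx => ?_), ?_⟩
  · simp only [ne_eq, ite_eq_right_iff, Classical.not_imp] at hx
    exact Finset.mem_image.2 ⟨_, hx.1, by ring⟩
  · refine lt_of_eq_of_lt ?_ hA
    rw [dist_def]
    simp only [ofFinsupp, sub_self, abs_zero, zero_add]
    refine Eq.trans ?_ (tsum_subtype {x | x ∉ A}
      (fun x : ℤ => Real.exp (θ * (x : ℝ)) * (s.occ (x + s.front) : ℝ))).symm
    refine tsum_congr fun x => ?_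
    simp only [distTerm, Finsupp.onFinset_apply, add_sub_cancel_right]
    by_cases hx : x ∈ A
    · rw [Set.indicator_of_notMem (by simpa using hx)]
      by_cases h0 : x + s.front ≤ s.front
      · simp [hx, h0]
      · simp [h0, s.occ_eq_zero _ (not_le.1 h0)]
    · rw [Set.indicator_of_mem (by simpa using hx)]
      simp [hx]

instance : TopologicalSpace.SeparableSpace (State θ) :=
  .of_denseRange _ denseRange_ofFinsupp

instance : SecondCountableTopology (State θ) := UniformSpace.secondCountable_of_separable _

theorem continuous_front : Continuous (front : State θ → ℤ) := by
  refine Metric.continuous_iff.2 fun s ε hε => ⟨ε, hε, fun t ht => lt_of_le_of_lt ?_ ht⟩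
  rw [dist_def, Int.dist_eq]
  exact le_add_of_nonneg_right (tsum_nonneg (distTerm_nonneg _ _))

/-- Open sets are countable unions of balls by separability, and the distance to a fixed state is a
countable sum of functions of the coordinates. -/
theorem measurable_of_coordinates {α : Type*} [MeasurableSpace α] {f : α → State θ}
    (hf : Measurable fun a => (f a).front) (hocc : ∀ x, Measurable fun a => (f a).occ x) :
    Measurable f := by
  have hd (s : State θ) : Measurable fun a => ENNReal.ofReal (dist (f a) s) := by
    have ht (x : ℤ) : Measurable fun a => ENNReal.ofReal (distTerm (f a) s x) := by
      have hx : Measurable fun a => (f a).occ (x + (f a).front) := by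
        have h1 : Measurable fun p : ℤ × α => (f p.2).occ (x + p.1) :=
          measurable_from_prod_countable_right fun k => hocc (x + k)
        exact h1.comp (hf.prodMk measurable_id)
      exact (measurable_of_countable fun k : ℕ => ENNReal.ofReal
        (Real.exp (θ * (x : ℝ)) * |(k : ℝ) - (s.occ (x + s.front) : ℝ)|)).comp hx
    simp_rw [ofReal_dist]
    exact (measurable_of_countable fun k : ℤ =>
        ENNReal.ofReal |(k : ℝ) - (s.front : ℝ)|).comp hf |>.add (Measurable.tsum ht)
  refine measurable_of_isOpen fun U hU => ?_
  obtain ⟨D, hDc, hD⟩ := TopologicalSpace.exists_countable_dense (State θ)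
  have : f ⁻¹' U = ⋃ d ∈ D, ⋃ q : ℚ, ⋃ _ : Metric.ball d (q : ℝ) ⊆ U,
      {a | ENNReal.ofReal (dist (f a) d) < ENNReal.ofReal q} := by
    ext a
    simp only [Set.mem_preimage, Set.mem_iUnion, exists_prop]
    constructor
    · intro ha
      obtain ⟨ε, hε, hb⟩ := Metric.isOpen_iff.1 hU _ ha
      obtain ⟨d, hdD, hd⟩ := Metric.mem_closure_iff.1 (hD.closure_eq ▸ Set.mem_univ (f a)) (ε / 2)
        (half_pos hε)
      obtain ⟨q, hq1, hq2⟩ := exists_rat_btwn hd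
      refine ⟨d, hdD, q, fun b hb' => hb ?_, ?_⟩
      · rw [Metric.mem_ball] at hb' ⊢
        linarith [dist_triangle_right b (f a) d]
      · exact (ENNReal.ofReal_lt_ofReal_iff (dist_nonneg.trans_lt hq1)).2 hq1
    · rintro ⟨d, -, q, hq, ha⟩
      exact hq (Metric.mem_ball.2 (ENNReal.ofReal_lt_ofReal_iff'.1 ha).1)
  rw [this]
  exact .biUnion hDc fun d _ => .iUnion fun q => .iUnion fun _ =>
    measurableSet_lt (hd d) measurable_const

/-- The state with `k` more particles at distance `n` from the front. -/
noncomputable def addParticles (s : State θ) (n k : ℕ) : State θ where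
  front := s.front
  occ x := s.occ x + if x = s.front - n then k else 0
  occ_eq_zero x hx := by
    rw [s.occ_eq_zero x hx, if_neg (by omega)]
  summable_occ := by
    have h : Summable fun x : ℤ => Real.exp (θ * ((x - s.front : ℤ) : ℝ)) *
        (if x = s.front - n then (k : ℝ) else 0) := by
      refine (hasSum_ite_eq (s.front - (n : ℤ))
        (Real.exp (θ * ((s.front - n - s.front : ℤ) : ℝ)) * (k : ℝ))).summable.congr fun x => ?_
      by_cases h : x = s.front - n
      · rw [if_pos h, if_pos h, h]
      · rw [if_neg h, if_neg h, mul_zero]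
    refine (s.summable_occ.add h).congr fun x => ?_
    rw [Nat.cast_add, mul_add]
    split_ifs <;> simp

theorem distTerm_addParticles (s : State θ) (n k : ℕ) (x : ℤ) :
    distTerm s (s.addParticles n k) x = if x = -n then Real.exp (-θ * n) * k else 0 := by
  unfold distTerm addParticles
  dsimp only
  by_cases h : x = -n
  · subst h
    rw [if_pos rfl, if_pos (by ring)]
    push_cast
    rw [show (s.occ (-(n : ℤ) + s.front) : ℝ) - (s.occ (-(n : ℤ) + s.front) + k) = -k by ring,
      abs_neg, Nat.abs_cast]
    ring_nf
  · rw [if_neg h, if_neg (by omega)]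
    simp

theorem dist_addParticles (s : State θ) (n k : ℕ) :
    dist s (s.addParticles n k) = Real.exp (-θ * n) * k := by
  rw [dist_def]
  simp_rw [distTerm_addParticles]
  rw [tsum_ite_eq]
  simp [addParticles]

theorem le_dist_addParticles (s : State θ) {n n' : ℕ} (h : n ≠ n') (k k' : ℕ) :
    Real.exp (-θ * n) * k ≤ dist (s.addParticles n k) (s.addParticles n' k') := by
  refine le_trans (le_of_eq ?_) (distTerm_le_dist _ _ (-n))
  unfold distTerm addParticles
  simp only
  rw [if_pos (by ring), if_neg (by omega)]
  push_cast
  rw [add_zero, add_sub_cancel_left, Nat.abs_cast]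
  ring_nf

/-- No point of the state space has a compact neighbourhood. -/
theorem not_isCompact_of_mem_nhds (hθ : 0 < θ) {s : State θ} {K : Set (State θ)} (hK : IsCompact K) :
    K ∉ 𝓝 s := by
  intro hs
  obtain ⟨ε, hε, hb⟩ := Metric.mem_nhds_iff.1 hs
  have hpow (n : ℕ) : Real.exp (-θ * n) = Real.exp (-θ) ^ n := by
    rw [← Real.exp_nat_mul]; ring_nf
  obtain ⟨N, hN⟩ := exists_pow_lt_of_lt_one (show 0 < ε / 2 by positivity)
    (Real.exp_lt_one_iff.2 (neg_neg_of_pos hθ))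
  -- So many particles at distance `n` that their mass `exp(-θ n) * k n` is at least `ε / 2`, but
  -- below `ε` for `n ≥ N`. The resulting states lie in the ball and are `ε / 2`-separated.
  let k (n : ℕ) : ℕ := ⌈ε / 2 / Real.exp (-θ * n)⌉₊
  have hk1 (n : ℕ) : ε / 2 ≤ Real.exp (-θ * n) * k n := by
    rw [← div_le_iff₀' (Real.exp_pos _)]
    exact Nat.le_ceil _
  have hk2 (n : ℕ) (hn : N ≤ n) : Real.exp (-θ * n) * k n < ε := by
    have h1 : (k n : ℝ) < ε / 2 / Real.exp (-θ * n) + 1 := Nat.ceil_lt_add_one (by positivity)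
    have h2 : Real.exp (-θ * n) < ε / 2 := by
      rw [hpow]
      refine lt_of_le_of_lt (pow_le_pow_of_le_one (Real.exp_pos _).le ?_ hn) hN
      exact Real.exp_le_one_iff.2 (by linarith)
    calc _ < Real.exp (-θ * n) * (ε / 2 / Real.exp (-θ * n) + 1) := by gcongr
      _ = ε / 2 + Real.exp (-θ * n) := by field_simp
      _ < ε := by linarith
  have hmem (n : ℕ) : s.addParticles (N + n) (k (N + n)) ∈ K := by
    refine hb ?_
    rw [Metric.mem_ball', dist_addParticles]
    exact hk2 _ (by omega)
  obtain ⟨l, -, φ, hφ, hl⟩ := hK.tendsto_subseq hmem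
  have h0 : Tendsto (fun j => dist (s.addParticles (N + φ j) (k (N + φ j)))
      (s.addParticles (N + φ (j + 1)) (k (N + φ (j + 1))))) atTop (𝓝 0) := by
    have := hl.dist (hl.comp (tendsto_add_atTop_nat 1))
    simpa using this
  obtain ⟨j, hj⟩ := ((tendsto_order.1 h0).2 (ε / 2) (by positivity)).exists
  have hne : N + φ j ≠ N + φ (j + 1) := by
    have := hφ (Nat.lt_add_one j)
    omega
  have := le_dist_addParticles s hne (k (N + φ j)) (k (N + φ (j + 1)))
  linarith [hk1 (N + φ j)]

/-- If `f s ≠ 0`, the compact set outside which `|f| < |f s| / 2` would be a neighbourhood of `s`.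
-/
theorem eq_zero_of_tendsto_cocompact (hθ : 0 < θ) {f : State θ →ᵇ ℝ}
    (hf : Tendsto f (cocompact (State θ)) (𝓝 0)) : f = 0 := by
  ext s
  by_contra hs
  have hs' : 0 < |f s| := abs_pos.2 hs
  have h1 : ∀ᶠ t in cocompact (State θ), |f t| < |f s| / 2 := by
    have := hf.abs
    rw [abs_zero] at this
    exact this.eventually_lt_const (by positivity)
  obtain ⟨K, hK, hKs⟩ := mem_cocompact.1 h1
  refine not_isCompact_of_mem_nhds hθ hK (s := s) ?_
  have h2 : ∀ᶠ t in 𝓝 s, |f s| / 2 < |f t| :=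
    (f.continuous.abs.tendsto s).eventually_const_lt (by linarith)
  filter_upwards [h2] with t ht
  by_contra hc
  exact absurd (hKs hc) (not_lt.2 ht.le)

end State

/-! ### Front times -/

/-- The walks driven by a fixed family of paths. -/
abbrev paths (y : Family) : ℤ → ℕ → ℝ≥0 → ℤ := fun x i t => walks x i t y

section FrontTime

variable {a : ℕ} {Y : ℤ → ℕ → ℝ≥0 → ℤ} {y y' : Family} {r : ℤ} {η η' : ℤ → ℕ}

theorem frontTime_zero : frontTime a Y r η 0 = 0 := by rw [frontTime]

theorem birthTime_of_le {x : ℤ} (hx : x ≤ r) : birthTime a Y r η x = 0 := by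
  rw [birthTime, Int.toNat_of_nonpos (by omega), frontTime_zero]

theorem birthTime_add (n : ℕ) : birthTime a Y r η (r + n) = frontTime a Y r η n := by
  rw [birthTime, add_sub_cancel_left, Int.toNat_natCast]

theorem supply_of_le {x : ℤ} (hx : x ≤ r) : supply a r η x = η x := if_pos hx

theorem supply_of_lt {x : ℤ} (hx : r < x) : supply a r η x = a := if_neg (not_le.2 hx)

theorem frontTime_succ (n : ℕ) : frontTime a Y r η (n + 1) =
    ⨅ (x : ℤ) (_ : x ≤ r + n) (i : ℕ) (_ : i < supply a r η x),
      birthTime a Y r η x + hitTime (Y x i) (r + n + 1) := by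
  rw [frontTime]
  rfl

theorem frontTime_succ_le {n : ℕ} {x : ℤ} {i : ℕ} (hx : x ≤ r + n) (hi : i < supply a r η x) :
    frontTime a Y r η (n + 1) ≤ birthTime a Y r η x + hitTime (Y x i) (r + n + 1) := by
  rw [frontTime_succ]
  exact iInf₂_le_of_le x hx (iInf₂_le i hi)

theorem le_frontTime_succ {n : ℕ} {c : ℝ≥0∞} (h : ∀ x ≤ r + (n : ℤ), ∀ i < supply a r η x,
    c ≤ birthTime a Y r η x + hitTime (Y x i) (r + n + 1)) : c ≤ frontTime a Y r η (n + 1) := by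
  rw [frontTime_succ]
  exact le_iInf₂ fun x hx => le_iInf₂ fun i hi => h x hx i hi

theorem frontTime_mono : Monotone (frontTime a (paths y) r η) := by
  refine monotone_nat_of_le_succ fun n => ?_
  rcases n with _ | n
  · rw [frontTime_zero]; exact zero_le
  · refine le_frontTime_succ fun x hx i hi => ?_
    rcases hx.lt_or_eq with h | h
    · have h1 : x ≤ r + n := by push_cast at h; omega
      refine (frontTime_succ_le h1 hi).trans (add_le_add_right ?_ _)
      exact (isWalkPath_walks y x i).hitTime_mono (by omega) (by push_cast; omega)
    -- A particle from the newest site `r + n + 1` only starts moving at `τ_{n+1}`.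
    · rw [h, birthTime_add]
      exact le_self_add

/-- Comparison of two configurations: if the particles that are in `η` but not in `η'` stay to the
left of `r + 1` until time `c`, then the front for `η'` is ahead of that for `η` until time `c`. -/
theorem min_frontTime_le {c : ℝ≥0∞} (h : ∀ x ≤ r, ∀ i < η x, i < η' x ∨
    c ≤ hitTime (fun t => walks x i t y) (r + 1)) (n : ℕ) :
    min (frontTime a (paths y) r η' n) c ≤ frontTime a (paths y) r η n := by
  induction n using Nat.strong_induction_on with
  | _ n ih =>
  rcases n with _ | n
  · simp [frontTime_zero]
  · refine le_frontTime_succ fun x hx i hi => ?_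
    have key (hi' : i < supply a r η' x) : min (frontTime a (paths y) r η' (n + 1)) c ≤
        birthTime a (paths y) r η x + hitTime (paths y x i) (r + n + 1) := by
      have h1 := ih (x - r).toNat (by omega)
      refine (min_le_min_right _ (frontTime_succ_le hx hi')).trans ?_
      refine le_trans ?_ (add_le_add_left h1 _)
      rw [min_add]
      exact min_le_min le_rfl le_self_add
    rcases le_or_gt x r with hxr | hxr
    · rw [supply_of_le hxr] at hi
      rcases h x hxr i hi with h1 | h1
      · exact key (by rwa [supply_of_le hxr])
      · refine (min_le_right _ _).trans (h1.trans (le_trans ?_ le_add_self))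
        exact (isWalkPath_walks y x i).hitTime_mono (by omega) (by omega)
    · rw [supply_of_lt hxr] at hi
      exact key (by rwa [supply_of_lt hxr])

theorem frontTime_antitone (h : ∀ x, η x ≤ η' x) (n : ℕ) :
    frontTime a (paths y) r η' n ≤ frontTime a (paths y) r η n := by
  have := min_frontTime_le (a := a) (y := y) (r := r) (c := ∞) (η := η) (η' := η')
    (fun x _ i hi => Or.inl (hi.trans_le (h x))) n
  simpa using this

/-- Used twice: to compare a state with its truncations, and to couple two nearby states. -/
theorem min_frontTime_eq {c : ℝ≥0∞}
    (h : ∀ x ≤ r, ∀ i < η x, i < η' x ∨ c ≤ hitTime (fun t => walks x i t y) (r + 1))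
    (h' : ∀ x ≤ r, ∀ i < η' x, i < η x ∨ c ≤ hitTime (fun t => walks x i t y) (r + 1)) (n : ℕ) :
    min (frontTime a (paths y) r η n) c = min (frontTime a (paths y) r η' n) c :=
  le_antisymm (le_min (min_frontTime_le h' n) (min_le_right _ _))
    (le_min (min_frontTime_le h n) (min_le_right _ _))

/-- The time `τ_n` does not depend on the walks that originate at `r + n` or to the right of it. -/
theorem frontTime_congr (n : ℕ) (h : ∀ p : ℤ × ℕ, p.1 < r + n → y p = y' p) :
    frontTime a (paths y) r η n = frontTime a (paths y') r η n := by
  induction n using Nat.strong_induction_on with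
  | _ n ih =>
  rcases n with _ | n
  · simp [frontTime_zero]
  · rw [frontTime_succ, frontTime_succ]
    refine iInf_congr fun x => iInf_congr fun hx => iInf_congr fun i => iInf_congr fun hi => ?_
    congr 1
    · refine ih (x - r).toNat (by omega) fun p hp => h p ?_
      push_cast
      omega
    · have := h (x, i) (by push_cast; omega)
      change hitTime (fun t => x + (y (x, i)).1 t) _ = hitTime (fun t => x + (y' (x, i)).1 t) _
      rw [this]

theorem frontTime_succ_le_of_le {n : ℕ} {x : ℤ} {i : ℕ} {t : ℝ≥0} (hx : x ≤ r + n)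
    (hi : i < supply a r η x) (hb : birthTime a (paths y) r η x ≤ t)
    (hp : r + n + 1 ≤ paths y x i (t - (birthTime a (paths y) r η x).toNNReal)) :
    frontTime a (paths y) r η (n + 1) ≤ t := by
  obtain ⟨v, hv, hv'⟩ := (isWalkPath_walks y x i).exists_eq (by omega) hp
  refine (frontTime_succ_le hx hi).trans ?_
  refine (add_le_add_right (hitTime_le hv') _).trans ?_
  have hne := ne_top_of_le_ne_top ENNReal.coe_ne_top hb
  have hb' : (birthTime a (paths y) r η x).toNNReal ≤ t := by
    rwa [← ENNReal.coe_le_coe, ENNReal.coe_toNNReal hne]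
  calc birthTime a (paths y) r η x + v
      = ((birthTime a (paths y) r η x).toNNReal + v : ℝ≥0) := by
        rw [ENNReal.coe_add, ENNReal.coe_toNNReal hne]
    _ ≤ ((birthTime a (paths y) r η x).toNNReal + (t - (birthTime a (paths y) r η x).toNNReal) :
          ℝ≥0) := by gcongr
    _ = t := by rw [add_tsub_cancel_of_le hb']

end FrontTime

/-! ### Weights of sets of particles -/

section Weight

variable {θ : ℝ}

/-- The sum over a set of labels of upper bounds for `e^{θ (y (t) - r)}`, `t ≤ N`. -/
noncomputable def labelWeight (θ : ℝ) (N : ℕ) (r : ℤ) (A : Set (ℤ × ℕ)) (y : Family) : ℝ≥0∞ :=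
  ∑' p : ℤ × ℕ, A.indicator (fun p => ENNReal.ofReal (Real.exp (θ * ((p.1 : ℝ) - r))) *
    pathWeight θ N (y p)) p

theorem exp_walk_le (hθ : 0 < θ) {N : ℕ} (r : ℤ) (p : ℤ × ℕ) (y : Family) {t : ℝ≥0} (ht : t ≤ N) :
    ENNReal.ofReal (Real.exp (θ * ((walks p.1 p.2 t y : ℝ) - r))) ≤
      ENNReal.ofReal (Real.exp (θ * ((p.1 : ℝ) - r))) * pathWeight θ N (y p) := by
  refine le_trans (le_of_eq ?_) (mul_le_mul_right (exp_le_pathWeight hθ ht (y p)) _)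
  rw [← ENNReal.ofReal_mul (Real.exp_pos _).le, ← Real.exp_add, walks]
  push_cast
  ring_nf

theorem exp_walk_le_labelWeight (hθ : 0 < θ) {N : ℕ} (r : ℤ) {A : Set (ℤ × ℕ)} {p : ℤ × ℕ}
    (hp : p ∈ A) (y : Family) {t : ℝ≥0} (ht : t ≤ N) :
    ENNReal.ofReal (Real.exp (θ * ((walks p.1 p.2 t y : ℝ) - r))) ≤ labelWeight θ N r A y := by
  refine le_trans ((exp_walk_le hθ r p y ht).trans_eq ?_) (ENNReal.le_tsum p)
  rw [Set.indicator_of_mem hp]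

/-- A particle at or to the right of `r` at some time up to `N` would alone contribute at least one
to the weight. -/
theorem walk_le_of_labelWeight_lt_one (hθ : 0 < θ) {N : ℕ} {r : ℤ} {A : Set (ℤ × ℕ)} {y : Family}
    (h : labelWeight θ N r A y < 1) {p : ℤ × ℕ} (hp : p ∈ A) {t : ℝ≥0} (ht : t ≤ N) :
    walks p.1 p.2 t y < r := by
  have := (exp_walk_le_labelWeight hθ r hp y ht).trans_lt h
  rw [ENNReal.ofReal_lt_one, Real.exp_lt_one_iff] at this
  have h2 : (walks p.1 p.2 t y : ℝ) - r < 0 := by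
    by_contra! hc
    exact absurd this (not_lt.2 (mul_nonneg hθ.le hc))
  exact_mod_cast sub_neg.1 h2

/-- Every particle that reaches `z` or beyond by time `N` contributes at least the fixed amount
`exp(θ(z - r))` to a finite sum. -/
theorem finite_of_labelWeight_ne_top (hθ : 0 < θ) {N : ℕ} {r : ℤ} {A : Set (ℤ × ℕ)} {y : Family}
    (h : labelWeight θ N r A y ≠ ∞) (z : ℤ) :
    {p | p ∈ A ∧ ∃ t : ℝ≥0, t ≤ N ∧ z ≤ walks p.1 p.2 t y}.Finite := by
  refine (ENNReal.finite_const_le_of_tsum_ne_top h (ε := ENNReal.ofReal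
    (Real.exp (θ * ((z : ℝ) - r)))) (ENNReal.ofReal_pos.2 (Real.exp_pos _)).ne').subset ?_
  rintro p ⟨hp, t, ht, hz⟩
  rw [Set.mem_ofPred_eq, Set.indicator_of_mem hp]
  refine le_trans (ENNReal.ofReal_le_ofReal (Real.exp_le_exp.2 ?_)) (exp_walk_le hθ r p y ht)
  have : (z : ℝ) ≤ walks p.1 p.2 t y := by exact_mod_cast hz
  gcongr

/-- Sums over sites of particle numbers are at most sums over particles. -/
theorem tsum_mul_ncard_le (g : ℤ → ℝ≥0∞) (A : Set (ℤ × ℕ)) (pos : ℤ × ℕ → ℤ) :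
    ∑' x, g x * ({p | p ∈ A ∧ pos p = x}.ncard : ℝ≥0∞) ≤ ∑' p, A.indicator (fun p => g (pos p)) p := by
  classical
  have h1 (x : ℤ) : g x * ({p | p ∈ A ∧ pos p = x}.ncard : ℝ≥0∞) ≤
      ∑' p, A.indicator (fun p => if pos p = x then g x else 0) p := by
    have h2 : ({p | p ∈ A ∧ pos p = x}.ncard : ℝ≥0∞) ≤
        ∑' p, {p | p ∈ A ∧ pos p = x}.indicator (fun _ => (1 : ℝ≥0∞)) p := by
      rcases Set.finite_or_infinite {p | p ∈ A ∧ pos p = x} with hf | hf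
      · rw [← tsum_subtype, ENNReal.tsum_set_one, ← hf.cast_ncard_eq]
        simp
      -- `ncard` is `0` on infinite sets, which is harmless for an upper bound on it.
      · rw [hf.ncard]; simp
    refine (mul_le_mul_right h2 _).trans_eq ?_
    rw [← ENNReal.tsum_mul_left]
    refine tsum_congr fun p => ?_
    by_cases hA : p ∈ A <;> by_cases hp : pos p = x <;> simp [Set.indicator, hA, hp]
  refine (ENNReal.tsum_le_tsum h1).trans_eq ?_
  rw [ENNReal.tsum_comm]
  refine tsum_congr fun p => ?_
  by_cases hA : p ∈ A
  · simp only [Set.indicator_of_mem hA]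
    rw [tsum_eq_single (pos p) fun x hx => if_neg hx.symm, if_pos rfl]
  · simp [Set.indicator_of_notMem hA]

end Weight

/-! ### Good families of paths -/

section Good

variable {θ : ℝ} {a : ℕ} {s : State θ} {y : Family}

/-- The labels of the particles of a state. -/
def State.labels (s : State θ) : Set (ℤ × ℕ) := {p | p.2 < s.occ p.1}

theorem State.le_front_of_mem_labels {p : ℤ × ℕ} (hp : p ∈ s.labels) : p.1 ≤ s.front := by
  by_contra! h
  have : p.2 < s.occ p.1 := hp
  rw [s.occ_eq_zero _ h] at this
  omega

/-- The families of paths for which the process started from `s` is well behaved. -/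
structure IsGood (a : ℕ) (s : State θ) (y : Family) : Prop where
  weight : ∀ N, labelWeight θ N s.front s.labels y ≠ ∞
  tendsto : Tendsto (frontTime a (paths y) s.front s.occ) atTop (𝓝 ∞)

/-- The infimum runs over infinitely many particles, but only finitely many of them can reach the
new site before a time `N > τ_{n+1}`: finitely many initial ones by the weight, and at most `a` per
newly visited site. Hence it is a minimum. -/
theorem exists_frontTime_eq (hθ : 0 < θ) (hw : ∀ N, labelWeight θ N s.front s.labels y ≠ ∞) {n : ℕ}
    (h : frontTime a (paths y) s.front s.occ (n + 1) < ∞) :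
    ∃ x ≤ s.front + n, ∃ i < supply a s.front s.occ x,
      birthTime a (paths y) s.front s.occ x + hitTime (paths y x i) (s.front + n + 1) =
        frontTime a (paths y) s.front s.occ (n + 1) := by
  obtain ⟨N, hN⟩ := ENNReal.exists_nat_gt h.ne
  let v (p : ℤ × ℕ) : ℝ≥0∞ := birthTime a (paths y) s.front s.occ p.1 +
    hitTime (paths y p.1 p.2) (s.front + n + 1)
  let S : Set (ℤ × ℕ) := {p | p.1 ≤ s.front + n ∧ p.2 < supply a s.front s.occ p.1 ∧ v p < N}
  have hfin : S.Finite := by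
    refine ((finite_of_labelWeight_ne_top hθ (hw N) (s.front + n + 1)).union
      ((Finset.Ioc s.front (s.front + n)) ×ˢ Finset.range a).finite_toSet).subset ?_
    rintro p ⟨h1, h2, h3⟩
    rcases le_or_gt p.1 s.front with hp | hp
    · left
      rw [supply_of_le hp] at h2
      have h4 : hitTime (paths y p.1 p.2) (s.front + n + 1) < N := le_add_self.trans_lt h3
      obtain ⟨t, ht, ht'⟩ := (isWalkPath_walks y p.1 p.2).exists_hitTime
        (h4.trans (ENNReal.natCast_lt_top N))
      refine ⟨h2, t, ?_, ht.ge⟩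
      rw [ht'] at h4
      exact_mod_cast h4.le
    · right
      rw [supply_of_lt hp] at h2
      simp only [Finset.coe_product, Set.mem_prod, Finset.mem_coe, Finset.mem_Ioc, Finset.mem_range]
      exact ⟨⟨hp, h1⟩, h2⟩
  have hne : S.Nonempty := by
    by_contra hS
    refine absurd hN (not_lt.2 (le_frontTime_succ fun x hx i hi => ?_))
    by_contra! hc
    exact hS ⟨(x, i), hx, hi, hc⟩
  obtain ⟨p, hp, hmin⟩ := Set.exists_min_image S v hfin hne
  refine ⟨p.1, hp.1, p.2, hp.2.1, le_antisymm (le_frontTime_succ fun x hx i hi => ?_)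
    (frontTime_succ_le hp.1 hp.2.1)⟩
  rcases lt_or_ge (v (x, i)) N with hc | hc
  · exact hmin (x, i) ⟨hx, hi, hc⟩
  · exact hp.2.2.le.trans hc

/-- The particles that move at time `t`. -/
def alive (a : ℕ) (s : State θ) (y : Family) (t : ℝ≥0) : Set (ℤ × ℕ) :=
  {p | p.2 < supply a s.front s.occ p.1 ∧ birthTime a (paths y) s.front s.occ p.1 ≤ t}

/-- The position at time `t` of a particle that moves. -/
noncomputable def position (a : ℕ) (s : State θ) (y : Family) (t : ℝ≥0) (p : ℤ × ℕ) : ℤ :=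
  paths y p.1 p.2 (t - (birthTime a (paths y) s.front s.occ p.1).toNNReal)

theorem occAt_eq (t : ℝ≥0) (z : ℤ) : occAt a (paths y) s.front s.occ t z =
    {p | p ∈ alive a s y t ∧ position a s y t p = z}.ncard := by
  simp only [occAt, alive, position, Set.mem_ofPred_eq, and_assoc]

/-- Together with `frontTime_le_of_position` this describes `τ_{n+1}` through positions at a common
time instead of individual clocks; comparisons of two systems use this form. -/
theorem exists_position_eq (hθ : 0 < θ) (hw : ∀ N, labelWeight θ N s.front s.labels y ≠ ∞) {n : ℕ}
    {t : ℝ≥0} (h : frontTime a (paths y) s.front s.occ (n + 1) = t) :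
    ∃ p ∈ alive a s y t, p.1 ≤ s.front + n ∧ position a s y t p = s.front + n + 1 := by
  obtain ⟨x, hx, i, hi, hxi⟩ := exists_frontTime_eq hθ hw (h ▸ ENNReal.coe_lt_top)
  rw [h] at hxi
  have hb : birthTime a (paths y) s.front s.occ x ≤ t := hxi ▸ le_self_add
  have hh : hitTime (paths y x i) (s.front + n + 1) ≤ t := hxi ▸ le_add_self
  obtain ⟨v, hv, hv'⟩ := (isWalkPath_walks y x i).exists_hitTime (hh.trans_lt ENNReal.coe_lt_top)
  refine ⟨(x, i), ⟨hi, hb⟩, hx, ?_⟩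
  have hne := ne_top_of_le_ne_top ENNReal.coe_ne_top hb
  have hv2 : t - (birthTime a (paths y) s.front s.occ x).toNNReal = v := by
    change _ + hitTime (fun t => walks x i t y) _ = _ at hxi
    rw [hv', ← ENNReal.coe_toNNReal hne, ← ENNReal.coe_add, ENNReal.coe_inj] at hxi
    rw [← hxi, add_tsub_cancel_left]
  rw [position, hv2]
  exact hv

theorem frontTime_le_of_position {n : ℕ} {t : ℝ≥0} {p : ℤ × ℕ} (hp : p ∈ alive a s y t)
    (hx : p.1 ≤ s.front + n) (h : s.front + n + 1 ≤ position a s y t p) :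
    frontTime a (paths y) s.front s.occ (n + 1) ≤ t :=
  frontTime_succ_le_of_le hx hp.1 hp.2 h

/-! ### The front and the particles at a fixed time -/

theorem IsGood.exists_index (h : IsGood a s y) (t : ℝ≥0) :
    ∃ k : ℕ, frontTime a (paths y) s.front s.occ k ≤ t ∧
      t < frontTime a (paths y) s.front s.occ (k + 1) := by
  classical
  have hex : ∃ n, (t : ℝ≥0∞) < frontTime a (paths y) s.front s.occ n :=
    (h.tendsto.eventually_const_lt ENNReal.coe_lt_top).exists
  have h1 := Nat.find_spec hex
  have h0 : Nat.find hex ≠ 0 := by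
    intro h0
    rw [h0, frontTime_zero] at h1
    exact not_lt_zero h1
  refine ⟨Nat.find hex - 1, not_lt.1 (Nat.find_min hex (by omega)), ?_⟩
  rwa [Nat.sub_add_cancel (by omega)]

theorem frontTime_le_iff {t : ℝ≥0} {k n : ℕ} (h1 : frontTime a (paths y) s.front s.occ k ≤ t)
    (h2 : t < frontTime a (paths y) s.front s.occ (k + 1)) :
    frontTime a (paths y) s.front s.occ n ≤ t ↔ n ≤ k := by
  refine ⟨fun h => ?_, fun h => (frontTime_mono h).trans h1⟩
  by_contra! hc
  exact absurd ((frontTime_mono (Nat.succ_le_of_lt hc)).trans h) (not_le.2 h2)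

theorem frontAt_eq {t : ℝ≥0} {k : ℕ} (h1 : frontTime a (paths y) s.front s.occ k ≤ t)
    (h2 : t < frontTime a (paths y) s.front s.occ (k + 1)) :
    frontAt a (paths y) s.front s.occ t = s.front + k := by
  have : {n : ℕ | frontTime a (paths y) s.front s.occ n ≤ t} = Set.Iic k := by
    ext n
    exact frontTime_le_iff h1 h2
  rw [frontAt, this, csSup_Iic]

theorem front_le_frontAt (a : ℕ) (s : State θ) (y : Family) (t : ℝ≥0) :
    s.front ≤ frontAt a (paths y) s.front s.occ t := by
  unfold frontAt
  omega

theorem IsGood.le_frontAt (h : IsGood a s y) {t : ℝ≥0} {p : ℤ × ℕ} (hp : p ∈ alive a s y t) :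
    p.1 ≤ frontAt a (paths y) s.front s.occ t := by
  obtain ⟨k, h1, h2⟩ := h.exists_index t
  rw [frontAt_eq h1 h2]
  have := (frontTime_le_iff h1 h2).1 hp.2
  omega

theorem IsGood.birthTime_le_iff (h : IsGood a s y) {t : ℝ≥0} {x : ℤ} :
    birthTime a (paths y) s.front s.occ x ≤ t ↔ x ≤ frontAt a (paths y) s.front s.occ t := by
  obtain ⟨k, h1, h2⟩ := h.exists_index t
  rw [frontAt_eq h1 h2, birthTime, frontTime_le_iff h1 h2]
  omega

theorem IsGood.position_le (h : IsGood a s y) {t : ℝ≥0} {p : ℤ × ℕ} (hp : p ∈ alive a s y t) :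
    position a s y t p ≤ frontAt a (paths y) s.front s.occ t := by
  have hx := h.le_frontAt hp
  obtain ⟨k, h1, h2⟩ := h.exists_index t
  rw [frontAt_eq h1 h2] at hx ⊢
  by_contra! hc
  exact absurd (frontTime_le_of_position hp hx (by omega)) (not_le.2 h2)

theorem position_of_mem_labels {t : ℝ≥0} {p : ℤ × ℕ} (hp : p ∈ s.labels) :
    position a s y t p = walks p.1 p.2 t y := by
  rw [position, birthTime_of_le (s.le_front_of_mem_labels hp)]
  simp

theorem labels_subset_alive (a : ℕ) (s : State θ) (y : Family) (t : ℝ≥0) :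
    s.labels ⊆ alive a s y t := by
  intro p hp
  have hx := s.le_front_of_mem_labels hp
  refine ⟨by rw [supply_of_le hx]; exact hp, ?_⟩
  rw [birthTime_of_le hx]
  exact zero_le

theorem mem_labels_of_mem_alive {t : ℝ≥0} {p : ℤ × ℕ} (hp : p ∈ alive a s y t)
    (hx : p.1 ≤ s.front) : p ∈ s.labels := by
  have := hp.1
  rwa [supply_of_le hx] at this

/-- Initial particles are controlled by the label weight; those woken later number at most `a` per
site of the finite interval from the initial front to the current one. -/
theorem IsGood.tsum_position_ne_top (hθ : 0 < θ) (h : IsGood a s y) (t : ℝ≥0) (r : ℤ) :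
    ∑' p, (alive a s y t).indicator (fun p => ENNReal.ofReal
      (Real.exp (θ * ((position a s y t p : ℝ) - r)))) p ≠ ∞ := by
  obtain ⟨N, hN⟩ := exists_nat_ge t
  set f := frontAt a (paths y) s.front s.occ t
  let B : Finset (ℤ × ℕ) := Finset.Ioc s.front f ×ˢ Finset.range a
  let F (p : ℤ × ℕ) := ENNReal.ofReal (Real.exp (θ * ((position a s y t p : ℝ) - r)))
  let c := ENNReal.ofReal (Real.exp (θ * ((s.front : ℝ) - r)))
  have hle (p : ℤ × ℕ) : (alive a s y t).indicator F p ≤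
      c * s.labels.indicator (fun p => ENNReal.ofReal (Real.exp (θ * ((p.1 : ℝ) - s.front))) *
        pathWeight θ N (y p)) p + (B : Set (ℤ × ℕ)).indicator F p := by
    by_cases hp : p ∈ alive a s y t
    · rw [Set.indicator_of_mem hp]
      rcases le_or_gt p.1 s.front with hx | hx
      · have hl := mem_labels_of_mem_alive hp hx
        refine le_trans ?_ le_self_add
        rw [Set.indicator_of_mem hl]
        refine le_trans (le_of_eq ?_) (mul_le_mul_right (exp_walk_le hθ s.front p y hN) _)
        rw [← ENNReal.ofReal_mul (Real.exp_pos _).le, ← Real.exp_add]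
        simp only [F, position_of_mem_labels hl]
        ring_nf
      · have hB : p ∈ (B : Set (ℤ × ℕ)) := by
          have h1 := hp.1
          rw [supply_of_lt hx] at h1
          simp only [B, Finset.coe_product, Set.mem_prod, Finset.mem_coe, Finset.mem_Ioc,
            Finset.mem_range]
          exact ⟨⟨hx, h.le_frontAt hp⟩, h1⟩
        rw [Set.indicator_of_mem hB]
        exact le_add_self
    · rw [Set.indicator_of_notMem hp]
      exact zero_le
  refine ne_top_of_le_ne_top ?_ (ENNReal.tsum_le_tsum hle)
  rw [ENNReal.tsum_add, ENNReal.tsum_mul_left]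
  refine ENNReal.add_ne_top.2 ⟨ENNReal.mul_ne_top ENNReal.ofReal_ne_top (h.weight N), ?_⟩
  rw [← sum_eq_tsum_indicator]
  exact ENNReal.sum_ne_top.2 fun p _ => ENNReal.ofReal_ne_top

theorem IsGood.finite_position (hθ : 0 < θ) (h : IsGood a s y) (t : ℝ≥0) (z : ℤ) :
    {p | p ∈ alive a s y t ∧ position a s y t p = z}.Finite := by
  refine (ENNReal.finite_const_le_of_tsum_ne_top (h.tsum_position_ne_top hθ t 0)
    (ε := ENNReal.ofReal (Real.exp (θ * z))) (ENNReal.ofReal_pos.2 (Real.exp_pos _)).ne').subset ?_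
  rintro p ⟨hp, hz⟩
  rw [Set.mem_ofPred_eq, Set.indicator_of_mem hp, hz]
  simp

/-- The state at time `t` of the process started from `s`. -/
noncomputable def IsGood.state (hθ : 0 < θ) (h : IsGood a s y) (t : ℝ≥0) : State θ where
  front := frontAt a (paths y) s.front s.occ t
  occ := occAt a (paths y) s.front s.occ t
  occ_eq_zero x hx := by
    rw [occAt_eq, Set.ncard_eq_zero (h.finite_position hθ t x)]
    ext p
    simp only [Set.mem_ofPred_eq, Set.mem_empty_iff_false, iff_false, not_and]
    intro hp hpx
    have := h.position_le hp
    omega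
  summable_occ := by
    set f := frontAt a (paths y) s.front s.occ t
    have h1 := tsum_mul_ncard_le (fun x : ℤ => ENNReal.ofReal (Real.exp (θ * ((x : ℝ) - f))))
      (alive a s y t) (position a s y t)
    have h2 := ne_top_of_le_ne_top (h.tsum_position_ne_top hθ t f) h1
    have h3 := ENNReal.summable_toReal h2
    refine h3.congr fun x => ?_
    rw [ENNReal.toReal_mul, ENNReal.toReal_ofReal (Real.exp_pos _).le, ENNReal.toReal_natCast,
      occAt_eq]
    push_cast
    rfl

/-- Two times that agree after capping at `c` cannot be distinguished at any time before `c`. -/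
theorem le_coe_iff_of_min_eq {u v c : ℝ≥0∞} (h : min u c = min v c) {t : ℝ≥0}
    (ht : t < c) : (u ≤ t ↔ v ≤ t) ∧ (u ≤ t → u = v) := by
  constructor
  · constructor
    · intro hu
      rw [min_eq_left (hu.trans ht.le)] at h
      rcases min_le_iff.1 (h.symm.le.trans hu) with h1 | h1
      · exact h1
      · exact absurd h1 (not_le.2 ht)
    · intro hv
      rw [min_eq_left (hv.trans ht.le)] at h
      rcases min_le_iff.1 (h.le.trans hv) with h1 | h1
      · exact h1
      · exact absurd h1 (not_le.2 ht)
  · intro hu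
    rw [min_eq_left (hu.trans ht.le)] at h
    rcases min_choice v c with h1 | h1
    · rw [h, h1]
    · rw [h1] at h
      exact absurd (h ▸ hu) (not_le.2 ht)

theorem truncate_le (r : ℤ) (η : ℤ → ℕ) (l : ℕ) (x : ℤ) : truncate r η l x ≤ η x := by
  unfold truncate
  split_ifs <;> simp

/-- Only finitely many initial particles enter a given half-line before `N`, and a long truncation
keeps them all. With the half-line from `s.front + 1` this makes all front times agree up to `N`;
with the half-line from `x` it makes the occupation numbers at `x` agree. -/
theorem IsGood.convergesTo (hθ : 0 < θ) (h : IsGood a s y) (t : ℝ≥0) :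
    ConvergesTo a (paths y) s t (h.state hθ t) := by
  obtain ⟨N, hN⟩ := exists_nat_gt t
  have hN' : (t : ℝ≥0∞) < N := by exact_mod_cast hN
  have hev (z : ℤ) : ∀ᶠ l : ℕ in atTop, ∀ p ∈ s.labels,
      (∃ v : ℝ≥0, v ≤ N ∧ z ≤ walks p.1 p.2 v y) → p.2 < truncate s.front s.occ l p.1 := by
    have hf := finite_of_labelWeight_ne_top hθ (h.weight N) z
    have : ∀ᶠ l : ℕ in atTop, ∀ p ∈ {p | p ∈ s.labels ∧ ∃ v : ℝ≥0, v ≤ N ∧ z ≤ walks p.1 p.2 v y},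
        p.2 < truncate s.front s.occ l p.1 := by
      rw [eventually_all_finite hf]
      rintro p ⟨hp, -⟩
      filter_upwards [eventually_gt_atTop (s.front - p.1).toNat] with l hl
      rw [truncate, if_neg (by omega)]
      exact hp
    exact this.mono fun l hl p hp hv => hl p ⟨hp, hv⟩
  have hcmp : ∀ᶠ l : ℕ in atTop, ∀ n,
      min (frontTime a (paths y) s.front (truncate s.front s.occ l) n) (N : ℝ≥0∞) =
      min (frontTime a (paths y) s.front s.occ n) N := by
    filter_upwards [hev (s.front + 1)] with l hl
    refine min_frontTime_eq (fun x _ i hi => Or.inl (hi.trans_le (truncate_le _ _ _ _)))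
      fun x _ i hi => ?_
    by_cases hc : (N : ℝ≥0∞) ≤ hitTime (fun t => walks x i t y) (s.front + 1)
    · exact Or.inr hc
    · left
      rw [not_le] at hc
      obtain ⟨v, hv, hv'⟩ := (isWalkPath_walks y x i).exists_hitTime
        (hc.trans (ENNReal.natCast_lt_top N))
      rw [hv'] at hc
      exact hl (x, i) hi ⟨v, by exact_mod_cast hc.le, hv.ge⟩
  refine ⟨tendsto_nhds_of_eventually_eq ?_, fun x => tendsto_nhds_of_eventually_eq ?_⟩
  · filter_upwards [hcmp] with l hl
    change frontAt _ _ _ _ _ = frontAt _ _ _ _ _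
    simp only [frontAt]
    congr 4
    ext n
    exact (le_coe_iff_of_min_eq (hl n) hN').1
  · filter_upwards [hcmp, hev x] with l hl hx
    change occAt _ _ _ _ _ _ = occAt _ _ _ _ _ _
    simp only [occAt]
    congr 1
    ext p
    simp only [Set.mem_ofPred_eq]
    have hb := le_coe_iff_of_min_eq (hl (p.1 - s.front).toNat) hN'
    rw [← birthTime, ← birthTime] at hb
    constructor
    · rintro ⟨h1, h2, h3⟩
      refine ⟨h1.trans_le ?_, hb.1.1 h2, ?_⟩
      · unfold supply
        split_ifs
        · exact truncate_le _ _ _ _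
        · exact le_rfl
      · rw [← hb.2 h2]; exact h3
    · rintro ⟨h1, h2, h3⟩
      have h2' := hb.1.2 h2
      refine ⟨?_, h2', by rw [hb.2 h2']; exact h3⟩
      rcases le_or_gt p.1 s.front with hp | hp
      · rw [supply_of_le hp] at h1 ⊢
        refine hx p h1 ⟨t, hN.le, ?_⟩
        rw [birthTime_of_le hp] at h3
        simpa using h3.ge
      · rwa [supply_of_lt hp] at h1 ⊢

/-! ### The process on the space of families of paths -/

theorem ConvergesTo.unique {Y : ℤ → ℕ → ℝ≥0 → ℤ} {t : ℝ≥0} {s₁ s₂ : State θ}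
    (h₁ : ConvergesTo a Y s t s₁) (h₂ : ConvergesTo a Y s t s₂) : s₁ = s₂ :=
  State.ext (tendsto_nhds_unique h₁.1 h₂.1) (funext fun x => tendsto_nhds_unique (h₁.2 x) (h₂.2 x))

/-- The process driven by a family of paths. -/
noncomputable def dyn (a : ℕ) (s : State θ) (t : ℝ≥0) (y : Family) : State θ :=
  process a walks s t y

theorem dyn_of_convergesTo {t : ℝ≥0} {s' : State θ} (h : ConvergesTo a (paths y) s t s') :
    dyn a s t y = s' := by
  have hex : ∃ s' : State θ, ConvergesTo a (paths y) s t s' := ⟨s', h⟩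
  have : dyn a s t y = hex.choose := dif_pos hex
  rw [this]
  exact hex.choose_spec.unique h

theorem dyn_of_not {t : ℝ≥0} (h : ¬ ∃ s' : State θ, ConvergesTo a (paths y) s t s') :
    dyn a s t y = s := dif_neg h

theorem IsGood.dyn_eq (hθ : 0 < θ) (h : IsGood a s y) (t : ℝ≥0) : dyn a s t y = h.state hθ t :=
  dyn_of_convergesTo (h.convergesTo hθ t)

theorem IsGood.dyn_front (hθ : 0 < θ) (h : IsGood a s y) (t : ℝ≥0) :
    (dyn a s t y).front = frontAt a (paths y) s.front s.occ t := by
  rw [h.dyn_eq hθ]; rfl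

theorem IsGood.dyn_occ (hθ : 0 < θ) (h : IsGood a s y) (t : ℝ≥0) (x : ℤ) :
    (dyn a s t y).occ x = {p | p ∈ alive a s y t ∧ position a s y t p = x}.ncard := by
  rw [h.dyn_eq hθ, ← occAt_eq]; rfl

theorem IsGood.tendsto_truncate (h : IsGood a s y) (l : ℕ) :
    Tendsto (frontTime a (paths y) s.front (truncate s.front s.occ l)) atTop (𝓝 ∞) :=
  tendsto_nhds_top_mono h.tendsto
    (Eventually.of_forall fun n => frontTime_antitone (truncate_le s.front s.occ l) n)

end Good

/-! ### Measurability -/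

section Measurability

variable {α : Type*} [MeasurableSpace α]

/-- A positive supremum is an attained maximum, which is a countable condition on membership. The
value `0`, which also stands for empty and unbounded sets, is treated as the complement. -/
theorem measurable_sSup_nat {S : α → Set ℕ} (hS : ∀ n, MeasurableSet {b | n ∈ S b}) :
    Measurable fun b => sSup (S b) := by
  have hsucc (k : ℕ) : MeasurableSet {b | sSup (S b) = k + 1} := by
    have : {b | sSup (S b) = k + 1} =
        {b | k + 1 ∈ S b} ∩ ⋂ m : ℕ, ⋂ _ : k + 1 < m, {b | m ∈ S b}ᶜ := by
      ext b
      simp only [Set.mem_ofPred_eq, Set.mem_inter_iff, Set.mem_iInter, Set.mem_compl_iff]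
      constructor
      · intro h
        have hbd : BddAbove (S b) := by
          by_contra hc
          rw [Nat.sSup_of_not_bddAbove hc] at h
          omega
        have hne : (S b).Nonempty := by
          by_contra hc
          rw [Set.not_nonempty_iff_eq_empty.1 hc] at h
          simp at h
        refine ⟨h ▸ Nat.sSup_mem hne hbd, fun m hm hmS => ?_⟩
        have := le_csSup hbd hmS
        omega
      · rintro ⟨h1, h2⟩
        have : IsGreatest (S b) (k + 1) := ⟨h1, fun m hm => by
          by_contra! hc
          exact h2 m hc hm⟩
        exact this.csSup_eq
    rw [this]
    exact (hS _).inter (.iInter fun m => .iInter fun _ => (hS m).compl)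
  refine measurable_to_countable' fun k => ?_
  rcases k with _ | k
  · have : (fun b => sSup (S b)) ⁻¹' {0} = (⋃ k : ℕ, {b | sSup (S b) = k + 1})ᶜ := by
      ext b
      simp only [Set.mem_preimage, Set.mem_singleton_iff, Set.mem_compl_iff, Set.mem_iUnion,
        Set.mem_ofPred_eq, not_exists]
      exact ⟨fun h k => by omega, fun h => by
        by_contra hc
        exact h (sSup (S b) - 1) (by omega)⟩
    rw [this]
    exact (MeasurableSet.iUnion hsucc).compl
  · exact hsucc k

/-- There are countably many finite subsets of `ι`, so positive cardinalities are countable unions.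
The value `0` also covers infinite sets and is handled by complement. -/
theorem measurable_ncard {ι : Type*} [Countable ι] {S : α → Set ι}
    (hS : ∀ i, MeasurableSet {b | i ∈ S b}) : Measurable fun b => (S b).ncard := by
  have heq (T : Finset ι) : MeasurableSet {b | S b = T} := by
    have : {b | S b = T} = ⋂ i, {b | i ∈ S b ↔ i ∈ T} := by
      ext b
      simp [Set.ext_iff]
    rw [this]
    refine .iInter fun i => ?_
    by_cases hi : i ∈ T
    · simpa [hi] using hS i
    · have : {b | i ∈ S b ↔ i ∈ T} = {b | i ∈ S b}ᶜ := by
        ext b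
        simp [hi]
      rw [this]
      exact (hS i).compl
  have hsucc (k : ℕ) : MeasurableSet {b | (S b).ncard = k + 1} := by
    have : {b | (S b).ncard = k + 1} = ⋃ T : Finset ι, ⋃ _ : T.card = k + 1, {b | S b = T} := by
      ext b
      simp only [Set.mem_ofPred_eq, Set.mem_iUnion, exists_prop]
      constructor
      · intro h
        have hf : (S b).Finite := Set.finite_of_ncard_ne_zero (by omega)
        exact ⟨hf.toFinset, by rw [← Set.ncard_eq_toFinset_card _ hf, h], by simp⟩
      · rintro ⟨T, hT, hb⟩
        rw [hb, Set.ncard_coe_finset, hT]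
    rw [this]
    exact .iUnion fun T => .iUnion fun _ => heq T
  refine measurable_to_countable' fun k => ?_
  rcases k with _ | k
  · have : (fun b => (S b).ncard) ⁻¹' {0} = (⋃ k : ℕ, {b | (S b).ncard = k + 1})ᶜ := by
      ext b
      simp only [Set.mem_preimage, Set.mem_singleton_iff, Set.mem_compl_iff, Set.mem_iUnion,
        Set.mem_ofPred_eq, not_exists]
      exact ⟨fun h k => by omega, fun h => by
        by_contra hc
        exact h ((S b).ncard - 1) (by omega)⟩
    rw [this]
    exact (MeasurableSet.iUnion hsucc).compl
  · exact hsucc k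

theorem measurableSet_tendsto_discrete {β : Type*} [MeasurableSpace β] [TopologicalSpace β]
    [DiscreteTopology β] [MeasurableSingletonClass β] {g : ℕ → α → β} (hg : ∀ l, Measurable (g l))
    (k : β) : MeasurableSet {b | Tendsto (fun l => g l b) atTop (𝓝 k)} := by
  have : {b | Tendsto (fun l => g l b) atTop (𝓝 k)} =
      ⋃ L : ℕ, ⋂ l : ℕ, ⋂ _ : L ≤ l, g l ⁻¹' {k} := by
    ext b
    simp [nhds_discrete, tendsto_pure, eventually_atTop]
  rw [this]
  exact .iUnion fun L => .iInter fun l => .iInter fun _ => hg l (measurableSet_singleton k)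

variable (a : ℕ) (r : ℤ) (η : ℤ → ℕ)

theorem measurable_frontTime (n : ℕ) :
    Measurable fun y : Family => frontTime a (paths y) r η n := by
  induction n using Nat.strong_induction_on with
  | _ n ih =>
  rcases n with _ | n
  · simp only [frontTime_zero]
    exact measurable_const
  · simp only [frontTime_succ, birthTime]
    refine .iInf fun x => .iInf fun hx => .iInf fun i => .iInf fun _ => ?_
    exact (ih (x - r).toNat (by omega)).add
      ((WalkPath.measurable_hitTime x _).comp (measurable_pi_apply (x, i)))

theorem measurable_birthTime (x : ℤ) :
    Measurable fun y : Family => birthTime a (paths y) r η x := measurable_frontTime a r η _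

theorem measurable_frontAt (t : ℝ≥0) :
    Measurable fun y : Family => frontAt a (paths y) r η t := by
  have h := measurable_sSup_nat (S := fun y : Family => {n | frontTime a (paths y) r η n ≤ t})
    fun n => measurable_frontTime a r η n measurableSet_Iic
  exact (measurable_of_countable fun k : ℕ => r + (k : ℤ)).comp h

theorem measurable_occAt (t : ℝ≥0) (z : ℤ) :
    Measurable fun y : Family => occAt a (paths y) r η t z := by
  refine measurable_ncard fun p => ?_
  refine MeasurableSet.inter (s₁ := {_y : Family | p.2 < supply a r η p.1})
    (MeasurableSet.const _) (MeasurableSet.inter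
    (s₁ := {y : Family | birthTime a (paths y) r η p.1 ≤ t})
    (measurable_birthTime a r η p.1 measurableSet_Iic) ?_)
  have h : Measurable fun y : Family =>
      p.1 + (y p).1 (t - (birthTime a (paths y) r η p.1).toNNReal) := by
    refine measurable_const.add (WalkPath.measurable_eval.comp (Measurable.prodMk ?_
      (measurable_pi_apply p)))
    exact measurable_const.sub (measurable_birthTime a r η p.1).ennreal_toNNReal
  exact h (measurableSet_singleton z)

variable {θ : ℝ}

/-- The definition distinguishes whether a limit state exists, and it has to be shown that this is a
measurable event. On it the coordinates are limits of measurable discrete quantities; off it the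
process is constant. -/
theorem measurable_dyn (s : State θ) (t : ℝ≥0) : Measurable (dyn a s t) := by
  let fr (l : ℕ) (y : Family) := frontAt a (paths y) s.front (truncate s.front s.occ l) t
  let oc (x : ℤ) (l : ℕ) (y : Family) := occAt a (paths y) s.front (truncate s.front s.occ l) t x
  have hfr (k : ℤ) : MeasurableSet {y | Tendsto (fun l => fr l y) atTop (𝓝 k)} :=
    measurableSet_tendsto_discrete (fun l => measurable_frontAt a _ _ t) k
  have hoc (x : ℤ) (m : ℕ) : MeasurableSet {y | Tendsto (fun l => oc x l y) atTop (𝓝 m)} :=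
    measurableSet_tendsto_discrete (fun l => measurable_occAt a _ _ t x) m
  -- The set of limits has at most one element, so its supremum is a measurable choice of the limit.
  let L (x : ℤ) (y : Family) : ℕ := sSup {m | Tendsto (fun l => oc x l y) atTop (𝓝 m)}
  have hL (x : ℤ) : Measurable (L x) := measurable_sSup_nat (hoc x)
  have hLeq {x : ℤ} {y : Family} {m : ℕ} (h : Tendsto (fun l => oc x l y) atTop (𝓝 m)) :
      L x y = m := by
    have : {m | Tendsto (fun l => oc x l y) atTop (𝓝 m)} = {m} := by
      ext k
      exact ⟨fun hk => tendsto_nhds_unique hk h, fun hk => by rw [Set.mem_singleton_iff.1 hk]; exact h⟩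
    simp only [L, this, csSup_singleton]
  let S (k : ℤ) (y : Family) : ℝ≥0∞ :=
    ∑' x : ℤ, ENNReal.ofReal (Real.exp (θ * ((x - k : ℤ) : ℝ)) * (L x y : ℝ))
  have hS (k : ℤ) : Measurable (S k) := by
    refine Measurable.tsum fun x => ?_
    exact (measurable_of_countable fun m : ℕ =>
      ENNReal.ofReal (Real.exp (θ * ((x - k : ℤ) : ℝ)) * (m : ℝ))).comp (hL x)
  -- The event that the limit exists as a state with front `k`: all coordinates converge, they
  -- vanish beyond `k`, and the weighted sum is finite.
  let G (k : ℤ) : Set Family := {y | Tendsto (fun l => fr l y) atTop (𝓝 k)} ∩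
    (⋂ x : ℤ, ⋃ m : ℕ, {y | Tendsto (fun l => oc x l y) atTop (𝓝 m)}) ∩
    (⋂ x : ℤ, ⋂ _ : k < x, {y | Tendsto (fun l => oc x l y) atTop (𝓝 0)}) ∩ S k ⁻¹' {∞}ᶜ
  have hG (k : ℤ) : MeasurableSet (G k) :=
    (((hfr k).inter (.iInter fun x => .iUnion fun m => hoc x m)).inter
      (.iInter fun x => .iInter fun _ => hoc x 0)).inter
      (hS k (measurableSet_singleton _).compl)
  have hGiff (k : ℤ) (y : Family) : y ∈ G k ↔
      ∃ s' : State θ, ConvergesTo a (paths y) s t s' ∧ s'.front = k := by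
    constructor
    · rintro ⟨⟨⟨h1, h2⟩, h3⟩, h4⟩
      simp only [Set.mem_iInter, Set.mem_iUnion] at h2 h3
      have h2' (x : ℤ) : Tendsto (fun l => oc x l y) atTop (𝓝 (L x y)) := by
        obtain ⟨m, hm⟩ := h2 x
        rw [hLeq hm]; exact hm
      refine ⟨⟨k, fun x => L x y, fun x hx => hLeq (h3 x hx), ?_⟩, ⟨h1, h2'⟩, rfl⟩
      have := ENNReal.summable_toReal h4
      refine this.congr fun x => ENNReal.toReal_ofReal (by positivity)
    · rintro ⟨s', ⟨h1, h2⟩, rfl⟩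
      refine ⟨⟨⟨h1, Set.mem_iInter.2 fun x => Set.mem_iUnion.2 ⟨_, h2 x⟩⟩,
        Set.mem_iInter.2 fun x => Set.mem_iInter.2 fun hx => ?_⟩, ?_⟩
      · rw [Set.mem_ofPred_eq, ← s'.occ_eq_zero x hx]
        exact h2 x
      · have : S s'.front y = ∑' x : ℤ, ENNReal.ofReal
            (Real.exp (θ * ((x - s'.front : ℤ) : ℝ)) * (s'.occ x : ℝ)) :=
          tsum_congr fun x => by rw [hLeq (h2 x)]
        rw [Set.mem_preimage, this, ← ENNReal.ofReal_tsum_of_nonneg (fun x => by positivity)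
          s'.summable_occ]
        exact ENNReal.ofReal_ne_top
  have hGu : MeasurableSet (⋃ k, G k) := .iUnion hG
  have hnot {y : Family} (h : y ∉ ⋃ k, G k) : dyn a s t y = s := by
    refine dyn_of_not ?_
    rintro ⟨s', hs'⟩
    exact h (Set.mem_iUnion.2 ⟨_, (hGiff _ y).2 ⟨s', hs', rfl⟩⟩)
  have hdyn {y : Family} (h : y ∈ ⋃ k, G k) : ConvergesTo a (paths y) s t (dyn a s t y) := by
    obtain ⟨k, hk⟩ := Set.mem_iUnion.1 h
    obtain ⟨s', hs', -⟩ := (hGiff k y).1 hk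
    rwa [dyn_of_convergesTo hs']
  refine State.measurable_of_coordinates (measurable_to_countable' fun k => ?_)
    fun x => measurable_to_countable' fun m => ?_
  · have : (fun y => (dyn a s t y).front) ⁻¹' {k} =
        ((⋃ k, G k) ∩ {y | Tendsto (fun l => fr l y) atTop (𝓝 k)}) ∪
        ((⋃ k, G k)ᶜ ∩ {_y | s.front = k}) := by
      ext y
      by_cases h : y ∈ ⋃ k, G k
      · have h1 := (hdyn h).1
        simp only [Set.mem_preimage, Set.mem_singleton_iff, Set.mem_union, Set.mem_inter_iff, h,
          Set.mem_compl_iff, Set.mem_ofPred_eq, true_and, not_true_eq_false, false_and, or_false]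
        exact ⟨fun hk => hk ▸ h1, fun hk => tendsto_nhds_unique h1 hk⟩
      · simp only [Set.mem_preimage, Set.mem_singleton_iff, Set.mem_union, Set.mem_inter_iff, h,
          Set.mem_compl_iff, Set.mem_ofPred_eq, not_false_eq_true, true_and, false_and, false_or,
          hnot h]
    rw [this]
    exact (hGu.inter (hfr k)).union (hGu.compl.inter (.const _))
  · have : (fun y => (dyn a s t y).occ x) ⁻¹' {m} =
        ((⋃ k, G k) ∩ {y | Tendsto (fun l => oc x l y) atTop (𝓝 m)}) ∪
        ((⋃ k, G k)ᶜ ∩ {_y | s.occ x = m}) := by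
      ext y
      by_cases h : y ∈ ⋃ k, G k
      · have h1 := (hdyn h).2 x
        simp only [Set.mem_preimage, Set.mem_singleton_iff, Set.mem_union, Set.mem_inter_iff, h,
          Set.mem_compl_iff, Set.mem_ofPred_eq, true_and, not_true_eq_false, false_and, or_false]
        exact ⟨fun hk => hk ▸ h1, fun hk => tendsto_nhds_unique h1 hk⟩
      · simp only [Set.mem_preimage, Set.mem_singleton_iff, Set.mem_union, Set.mem_inter_iff, h,
          Set.mem_compl_iff, Set.mem_ofPred_eq, not_false_eq_true, true_and, false_and, false_or,
          hnot h]
    rw [this]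
    exact (hGu.inter (hoc x m)).union (hGu.compl.inter (.const _))

end Measurability

/-! ### Almost all families of paths are good -/

section AlmostSure

variable {θ : ℝ} {W : Measure WalkPath}

/-- The weight of a set of labels at time `0`. -/
noncomputable def initialWeight (θ : ℝ) (r : ℤ) (A : Set (ℤ × ℕ)) : ℝ≥0∞ :=
  ∑' p : ℤ × ℕ, A.indicator (fun p => ENNReal.ofReal (Real.exp (θ * ((p.1 : ℝ) - r)))) p

theorem initialWeight_eq (r : ℤ) {A : Set (ℤ × ℕ)} {c : ℤ → ℕ}
    (hc : ∀ x, {i : ℕ | (x, i) ∈ A}.encard = c x) :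
    initialWeight θ r A = ∑' x : ℤ, ENNReal.ofReal (Real.exp (θ * ((x : ℝ) - r)) * c x) := by
  rw [initialWeight, ENNReal.tsum_prod']
  refine tsum_congr fun x => ?_
  have : (fun i : ℕ => A.indicator (fun p : ℤ × ℕ =>
      ENNReal.ofReal (Real.exp (θ * ((p.1 : ℝ) - r)))) (x, i)) =
      {i : ℕ | (x, i) ∈ A}.indicator fun _ => ENNReal.ofReal (Real.exp (θ * ((x : ℝ) - r))) := by
    ext i
    by_cases h : (x, i) ∈ A <;> simp [Set.indicator, h]
  rw [this, ← tsum_subtype, ENNReal.tsum_set_const, hc, ENNReal.ofReal_mul (Real.exp_pos _).le,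
    mul_comm]
  simp

theorem initialWeight_labels (s : State θ) : initialWeight θ s.front s.labels < ∞ := by
  rw [initialWeight_eq (c := s.occ) _ fun x => ?_]
  · have := s.summable_occ
    push_cast at this
    rw [← ENNReal.ofReal_tsum_of_nonneg (fun x => by positivity) this]
    exact ENNReal.ofReal_lt_top
  · change (Set.Iio (s.occ x)).encard = _
    rw [← Finset.coe_Iio, Set.encard_coe_eq_coe_finsetCard, Nat.card_Iio]

theorem measurable_labelWeight (N : ℕ) (r : ℤ) (A : Set (ℤ × ℕ)) :
    Measurable (labelWeight θ N r A) := by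
  have h (p : ℤ × ℕ) : Measurable fun y : Family =>
      A.indicator (fun p => ENNReal.ofReal (Real.exp (θ * ((p.1 : ℝ) - r))) *
        pathWeight θ N (y p)) p := by
    by_cases hp : p ∈ A
    · simp only [Set.indicator_of_mem hp]
      exact ((measurable_pathWeight θ N).comp (measurable_pi_apply p)).const_mul _
    · simp only [Set.indicator_of_notMem hp]
      exact measurable_const
  exact Measurable.tsum h

/-! ### Expectations under the product law -/

theorem IsWalkLaw.map_eval (hW : IsWalkLaw W) (p : ℤ × ℕ) :
    MeasurePreserving (fun y : Family => y p) (Combustion.familyLaw W) W := by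
  have := hW.isProbabilityMeasure
  exact measurePreserving_eval_infinitePi (fun _ => W) p

theorem IsWalkLaw.lintegral_labelWeight (hW : IsWalkLaw W) (N : ℕ) (r : ℤ) (A : Set (ℤ × ℕ)) :
    ∫⁻ y, labelWeight θ N r A y ∂(Combustion.familyLaw W) =
      (∫⁻ e, pathWeight θ N e ∂W) * initialWeight θ r A := by
  have h (p : ℤ × ℕ) : Measurable fun y : Family =>
      A.indicator (fun p => ENNReal.ofReal (Real.exp (θ * ((p.1 : ℝ) - r))) *
        pathWeight θ N (y p)) p := by
    by_cases hp : p ∈ A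
    · simp only [Set.indicator_of_mem hp]
      exact ((measurable_pathWeight θ N).comp (measurable_pi_apply p)).const_mul _
    · simp only [Set.indicator_of_notMem hp]
      exact measurable_const
  unfold labelWeight initialWeight
  rw [lintegral_tsum fun p => (h p).aemeasurable, ← ENNReal.tsum_mul_left]
  refine tsum_congr fun p => ?_
  by_cases hp : p ∈ A
  · simp only [Set.indicator_of_mem hp]
    have hmp : Measurable fun y : Family => pathWeight θ N (y p) :=
      (measurable_pathWeight θ N).comp (measurable_pi_apply p)
    rw [lintegral_const_mul _ hmp,
      (hW.map_eval p).lintegral_comp (measurable_pathWeight θ N), mul_comm]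
  · simp only [Set.indicator_of_notMem hp, lintegral_zero, mul_zero]

theorem IsWalkLaw.ae_weight (hW : IsWalkLaw W) (hθ : 0 < θ) (s : State θ) :
    ∀ᵐ y ∂(Combustion.familyLaw W), ∀ N, labelWeight θ N s.front s.labels y ≠ ∞ := by
  rw [ae_all_iff]
  intro N
  refine (ae_lt_top (measurable_labelWeight N s.front s.labels) ?_).mono fun y hy => hy.ne
  rw [hW.lintegral_labelWeight]
  exact ENNReal.mul_ne_top (hW.lintegral_pathWeight hθ N).ne (initialWeight_labels s).ne

/-- Birth times are independent of the walks that are born. -/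
theorem IsWalkLaw.lintegral_birthTime_mul (hW : IsWalkLaw W) (a : ℕ) (r : ℤ) (η : ℤ → ℕ)
    (p : ℤ × ℕ) {f : ℝ≥0∞ → ℝ≥0∞} (hf : Measurable f) {g : WalkPath → ℝ≥0∞} (hg : Measurable g) :
    ∫⁻ y, f (birthTime a (paths y) r η p.1) * g (y p) ∂(Combustion.familyLaw W) =
      (∫⁻ y, f (birthTime a (paths y) r η p.1) ∂(Combustion.familyLaw W)) * ∫⁻ e, g e ∂W := by
  classical
  have := hW.familyLaw
  have hb := measurable_birthTime a r η p.1
  have hm : Measurable fun y : Family => f (birthTime a (paths y) r η p.1) * g (y p) :=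
    (hf.comp hb).mul (hg.comp (measurable_pi_apply p))
  -- Resampling the walk `p` from an independent copy does not change the law, and the birth time at
  -- the site of `p` does not see this walk; the integral therefore factorizes.
  rw [← (hW.splice_family {p}).lintegral_comp hm]
  have hcongr (q : Family × Family) : birthTime a
      (paths fun i => if i ∈ ({p} : Set (ℤ × ℕ)) then q.2 i else q.1 i) r η p.1 =
      birthTime a (paths q.1) r η p.1 := by
    rcases le_or_gt p.1 r with hp | hp
    · rw [birthTime_of_le hp, birthTime_of_le hp]
    · refine frontTime_congr _ fun i hi => if_neg fun h => ?_
      rw [Set.mem_singleton_iff.1 h] at hi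
      omega
  simp only [hcongr]
  simp only [Set.mem_singleton_iff, if_true]
  rw [lintegral_prod_mul (f := fun y => f (birthTime a (paths y) r η p.1)) 
    (g := fun y : Family => g (y p)) (hf.comp hb).aemeasurable (hg.comp (measurable_pi_apply p)).aemeasurable,
    (hW.map_eval p).lintegral_comp hg]

theorem one_add_mul_sum_pow (b : ℝ≥0∞) (n : ℕ) :
    1 + b * ∑ i ∈ Finset.range n, (1 + b) ^ i = (1 + b) ^ n := by
  induction n with
  | zero => simp
  | succ n ih =>
    rw [Finset.sum_range_succ, mul_add, ← add_assoc, ih]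
    ring

/-- Exponential bound for the Laplace transforms of the times `τ_n`. -/
theorem IsWalkLaw.lintegral_discount_frontTime (hW : IsWalkLaw W) (hθ : 0 < θ) (a : ℕ)
    (s : State θ) {m : ℝ} (hm : θ ≤ m) (n : ℕ) :
    ∫⁻ y, discount (2 * expRate m) (frontTime a (paths y) s.front s.occ (n + 1))
        ∂(Combustion.familyLaw W) ≤
      initialWeight θ s.front s.labels * ENNReal.ofReal laplaceConst *
        ENNReal.ofReal (Real.exp (-m)) ^ (n + 1) * (1 + a * ENNReal.ofReal laplaceConst) ^ n := by
  have hm0 : 0 < m := hθ.trans_le hm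
  set K := ENNReal.ofReal laplaceConst
  set q := ENNReal.ofReal (Real.exp (-m)) with hq
  set Z := initialWeight θ s.front s.labels
  set c := 2 * expRate m
  have hKq (k : ℕ) : ∫⁻ e, discount c (hitTime e.1 k) ∂W ≤ K * q ^ k := by
    refine (hW.lintegral_discount hm0 k).trans_eq ?_
    rw [ENNReal.ofReal_mul laplaceConst_nonneg, hq, ← ENNReal.ofReal_pow (Real.exp_pos _).le,
      ← Real.exp_nat_mul, Int.cast_natCast, mul_comm (-m)]
  induction n using Nat.strong_induction_on with
  | _ n ih =>
  let T (p : ℤ × ℕ) (y : Family) : ℝ≥0∞ := discount c (birthTime a (paths y) s.front s.occ p.1) *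
    discount c (hitTime (y p).1 (s.front + n + 1 - p.1))
  have hT (p : ℤ × ℕ) : Measurable (T p) :=
    ((measurable_discount c).comp (measurable_birthTime a _ _ p.1)).mul
      ((measurable_discount c).comp ((WalkPath.measurable_hitTime' _).comp (measurable_pi_apply p)))
  -- Labels of the particles woken at the `n` sites after the initial front.
  let B : Finset (ℤ × ℕ) := (Finset.range n ×ˢ Finset.range a).map
    ⟨fun j => (s.front + 1 + (j.1 : ℤ), j.2), fun j j' h => by
      simp only [Prod.mk.injEq] at h
      exact Prod.ext (by omega) h.2⟩
  have hTint (p : ℤ × ℕ) (k : ℕ) (hk : s.front + n + 1 - p.1 = k) :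
      ∫⁻ y, T p y ∂(Combustion.familyLaw W) ≤
      (∫⁻ y, discount c (birthTime a (paths y) s.front s.occ p.1) ∂(Combustion.familyLaw W)) *
        (K * q ^ k) := by
    rw [hW.lintegral_birthTime_mul a s.front s.occ p (measurable_discount c)
      (g := fun e => discount c (hitTime e.1 (s.front + n + 1 - p.1)))
      ((measurable_discount c).comp (WalkPath.measurable_hitTime' _)), hk]
    exact mul_le_mul_right (hKq k) _
  -- The particle that attains `τ_{n+1}` contributes exactly the discount of `τ_{n+1}`, so the sum
  -- over all candidates is an upper bound.
  have hpt : ∀ᵐ y ∂(Combustion.familyLaw W),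
      discount c (frontTime a (paths y) s.front s.occ (n + 1)) ≤
      ∑' p, s.labels.indicator (fun p => T p y) p + ∑ p ∈ B, T p y := by
    filter_upwards [hW.ae_weight hθ s] with y hy
    by_cases hi : frontTime a (paths y) s.front s.occ (n + 1) = ∞
    · rw [hi, discount, if_pos rfl]
      exact zero_le
    · obtain ⟨x, hx, i, hxi, h⟩ := exists_frontTime_eq hθ hy (Ne.lt_top hi)
      have hTx : discount c (frontTime a (paths y) s.front s.occ (n + 1)) = T (x, i) y := by
        rw [← h, discount_add]
        change _ * discount c (hitTime (fun t => x + (y (x, i)).1 t) _) = _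
        rw [hitTime_add]
      rw [hTx]
      rcases le_or_gt x s.front with hxs | hxs
      · refine le_trans ?_ le_self_add
        rw [supply_of_le hxs] at hxi
        refine le_trans (le_of_eq ?_) (ENNReal.le_tsum (x, i))
        rw [Set.indicator_of_mem (show (x, i) ∈ s.labels from hxi)]
      · refine le_trans ?_ le_add_self
        rw [supply_of_lt hxs] at hxi
        refine Finset.single_le_sum (f := fun p => T p y) (fun _ _ => zero_le) ?_
        refine Finset.mem_map.2 ⟨((x - s.front - 1).toNat, i), ?_, Prod.ext ?_ rfl⟩
        · exact Finset.mem_product.2 ⟨Finset.mem_range.2 (by dsimp only; omega),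
            Finset.mem_range.2 hxi⟩
        · change s.front + 1 + (((x - s.front - 1).toNat : ℕ) : ℤ) = x
          omega
  have hind (p : ℤ × ℕ) : Measurable fun y => s.labels.indicator (fun p => T p y) p := by
    by_cases hp : p ∈ s.labels
    · simp only [Set.indicator_of_mem hp]; exact hT p
    · simp only [Set.indicator_of_notMem hp]; exact measurable_const
  refine (lintegral_mono_ae hpt).trans ?_
  rw [lintegral_add_left (Measurable.tsum hind), lintegral_tsum fun p => (hind p).aemeasurable,
    lintegral_finsetSum _ fun p _ => hT p]
  have h1 : ∑' p, ∫⁻ y, s.labels.indicator (fun p => T p y) p ∂(Combustion.familyLaw W) ≤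
      Z * (K * q ^ (n + 1)) := by
    simp only [Z, initialWeight]
    rw [← ENNReal.tsum_mul_right]
    refine ENNReal.tsum_le_tsum fun p => ?_
    by_cases hp : p ∈ s.labels
    · simp only [Set.indicator_of_mem hp]
      have hx := s.le_front_of_mem_labels hp
      obtain ⟨k, hk⟩ : ∃ k : ℕ, s.front - p.1 = k := ⟨(s.front - p.1).toNat, by omega⟩
      refine (hTint p (k + (n + 1)) (by push_cast; omega)).trans ?_
      have h0 : ∫⁻ y, discount c (birthTime a (paths y) s.front s.occ p.1)
          ∂(Combustion.familyLaw W) ≤ 1 := by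
        have := hW.familyLaw
        simp only [birthTime_of_le hx]
        simp [discount]
      -- This is where `θ ≤ m` is needed: the cost of the distance to the front is absorbed by the
      -- initial weight.
      have hqk : q ^ k ≤ ENNReal.ofReal (Real.exp (θ * ((p.1 : ℝ) - s.front))) := by
        rw [hq, ← ENNReal.ofReal_pow (Real.exp_pos _).le, ← Real.exp_nat_mul]
        refine ENNReal.ofReal_le_ofReal (Real.exp_le_exp.2 ?_)
        have : (s.front : ℝ) - p.1 = k := by exact_mod_cast hk
        rw [show (p.1 : ℝ) - s.front = -k by linarith]
        have hk0 : (0 : ℝ) ≤ k := Nat.cast_nonneg k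
        nlinarith
      calc _ ≤ 1 * (K * q ^ (k + (n + 1))) := by gcongr
        _ = q ^ k * (K * q ^ (n + 1)) := by ring
        _ ≤ _ := by gcongr
    · simp [Set.indicator_of_notMem hp]
  -- Inserting the inductive bound, each woken particle gives the same power `q ^ (n + 1)`; the
  -- geometric sum of the remaining factors is evaluated by `one_add_mul_sum_pow`.
  have h2 : ∑ p ∈ B, ∫⁻ y, T p y ∂(Combustion.familyLaw W) ≤
      Z * (K * q ^ (n + 1)) * (a * K * ∑ i ∈ Finset.range n, (1 + a * K) ^ i) := by
    rw [Finset.sum_map, Finset.sum_product, Finset.mul_sum, Finset.mul_sum]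
    refine Finset.sum_le_sum fun j hj => ?_
    have hj' := Finset.mem_range.1 hj
    have hj2 (i : ℕ) : ∫⁻ y, T (s.front + 1 + (j : ℤ), i) y ∂(Combustion.familyLaw W) ≤
        Z * K * q ^ (j + 1) * (1 + a * K) ^ j * (K * q ^ (n - j)) := by
      refine (hTint _ (n - j) (by push_cast [Nat.cast_sub hj'.le]; omega)).trans ?_
      refine mul_le_mul_left ?_ _
      have hb (y : Family) : birthTime a (paths y) s.front s.occ (s.front + 1 + (j : ℤ)) =
          frontTime a (paths y) s.front s.occ (j + 1) := by
        rw [← birthTime_add]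
        push_cast
        ring_nf
      simp only [hb]
      exact ih j hj'
    refine (Finset.sum_le_sum fun i _ => hj2 i).trans_eq ?_
    rw [Finset.sum_const, Finset.card_range, nsmul_eq_mul]
    have : q ^ (n + 1) = q ^ (j + 1) * q ^ (n - j) := by
      rw [← pow_add]; congr 1; omega
    rw [this]
    ring
  calc _ ≤ Z * (K * q ^ (n + 1)) +
        Z * (K * q ^ (n + 1)) * (a * K * ∑ i ∈ Finset.range n, (1 + a * K) ^ i) := add_le_add h1 h2
    _ = Z * (K * q ^ (n + 1)) * (1 + a * K * ∑ i ∈ Finset.range n, (1 + a * K) ^ i) := by ring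
    _ = _ := by rw [one_add_mul_sum_pow]; ring

/-- The discounts of the `τ_n` have a summable expectation and thus tend to `0` almost surely, which
is impossible if the increasing sequence `τ_n` has a finite limit. -/
theorem IsWalkLaw.ae_tendsto_frontTime (hW : IsWalkLaw W) (hθ : 0 < θ) (a : ℕ) (s : State θ) :
    ∀ᵐ y ∂(Combustion.familyLaw W),
      Tendsto (frontTime a (paths y) s.front s.occ) atTop (𝓝 ∞) := by
  set K := laplaceConst with hK
  have hK0 : 0 ≤ K := laplaceConst_nonneg
  have hK1 : 0 < 1 + a * K := by positivity
  -- Large enough for `exp(-m) (1 + aK) < 1`, and at least `θ` as the Laplace bound requires.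
  set m := max θ (Real.log (1 + a * K) + 1) with hm
  have hm0 : 0 < m := hθ.trans_le (le_max_left _ _)
  have hc : 0 ≤ 2 * expRate m := by have := expRate_pos hm0; positivity
  have hlt : Real.exp (-m) * (1 + a * K) < 1 := by
    have h1 : 1 + a * K < Real.exp m := by
      rw [← Real.log_lt_iff_lt_exp hK1]
      exact (lt_add_one _).trans_le (le_max_right _ _)
    rw [Real.exp_neg, inv_mul_lt_iff₀ (Real.exp_pos _)]
    simpa using h1
  set ρ : ℝ≥0∞ := ENNReal.ofReal (Real.exp (-m)) * (1 + a * ENNReal.ofReal K) with hρ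
  have hρ1 : ρ < 1 := by
    have : ρ = ENNReal.ofReal (Real.exp (-m) * (1 + a * K)) := by
      rw [hρ, ENNReal.ofReal_mul (Real.exp_pos _).le, ENNReal.ofReal_add zero_le_one (by positivity),
        ENNReal.ofReal_mul (Nat.cast_nonneg a)]
      simp
    rw [this, ENNReal.ofReal_lt_one]
    exact hlt
  have hmeas (n : ℕ) : Measurable fun y : Family =>
      discount (2 * expRate m) (frontTime a (paths y) s.front s.occ (n + 1)) :=
    (measurable_discount _).comp (measurable_frontTime a _ _ _)
  have hsum : ∫⁻ y, ∑' n, discount (2 * expRate m) (frontTime a (paths y) s.front s.occ (n + 1))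
      ∂(Combustion.familyLaw W) ≠ ∞ := by
    rw [lintegral_tsum fun n => (hmeas n).aemeasurable]
    have hle (n : ℕ) := hW.lintegral_discount_frontTime hθ a s (le_max_left θ
      (Real.log (1 + a * K) + 1)) n
    refine ne_top_of_le_ne_top ?_ (ENNReal.tsum_le_tsum hle)
    have : (fun n : ℕ => initialWeight θ s.front s.labels * ENNReal.ofReal laplaceConst *
        ENNReal.ofReal (Real.exp (-m)) ^ (n + 1) * (1 + a * ENNReal.ofReal laplaceConst) ^ n) =
        fun n => (initialWeight θ s.front s.labels * ENNReal.ofReal K *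
          ENNReal.ofReal (Real.exp (-m))) * ρ ^ n := by
      ext n
      rw [hρ, mul_pow]
      ring
    rw [this, ENNReal.tsum_mul_left, ENNReal.tsum_geometric]
    refine ENNReal.mul_ne_top (ENNReal.mul_ne_top (ENNReal.mul_ne_top
      (initialWeight_labels s).ne ENNReal.ofReal_ne_top) ENNReal.ofReal_ne_top) ?_
    exact ENNReal.inv_ne_top.2 (tsub_pos_of_lt hρ1).ne'
  filter_upwards [ae_lt_top (Measurable.tsum hmeas) hsum] with y hy
  have h0 := ENNReal.tendsto_atTop_zero_of_tsum_ne_top hy.ne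
  have hmono := frontTime_mono (a := a) (y := y) (r := s.front) (η := s.occ)
  have hlim := tendsto_atTop_iSup hmono
  by_cases hi : ⨆ n, frontTime a (paths y) s.front s.occ n = ∞
  · rwa [hi] at hlim
  · exfalso
    obtain ⟨M, hM⟩ : ∃ M : ℝ≥0, (M : ℝ≥0∞) = ⨆ n, frontTime a (paths y) s.front s.occ n :=
      ⟨_, ENNReal.coe_toNNReal hi⟩
    have hpos := discount_coe_pos (2 * expRate m) M
    obtain ⟨n, hn⟩ := (h0.eventually_lt_const hpos).exists
    refine absurd hn (not_lt.2 (discount_antitone hc ?_))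
    rw [hM]
    exact le_iSup (frontTime a (paths y) s.front s.occ) (n + 1)

theorem IsWalkLaw.ae_isGood (hW : IsWalkLaw W) (hθ : 0 < θ) (a : ℕ) (s : State θ) :
    ∀ᵐ y ∂(Combustion.familyLaw W), IsGood a s y := by
  filter_upwards [hW.ae_weight hθ s, hW.ae_tendsto_frontTime hθ a s] with y h1 h2
  exact ⟨h1, h2⟩

end AlmostSure

/-! ### Walks in ambient time -/

section OwnTime

variable {θ : ℝ} {a : ℕ} {W : Measure WalkPath}

/-- Each of the paths that originate at `r + n + 1` is replaced by its increments after the time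
`τ_{n+1}`. -/
noncomputable def delayStep (a : ℕ) (r : ℤ) (η : ℤ → ℕ) (n : ℕ) (y : Family) : Family :=
  fun p => if p.1 = r + n + 1 then
    WalkPath.shift (frontTime a (paths y) r η (n + 1)).toNNReal (y p) else y p

/-- The time `τ_{n+1}` depends only on walks from sites left of `r + n + 1`, so it is independent of
the walks it shifts; given its value the shift is deterministic and preserves their law. -/
theorem IsWalkLaw.delayStep (hW : IsWalkLaw W) (a : ℕ) (r : ℤ) (η : ℤ → ℕ) (n : ℕ) :
    MeasurePreserving (Combustion.delayStep a r η n) (Combustion.familyLaw W)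
      (Combustion.familyLaw W) := by
  classical
  have := hW.familyLaw
  set A : Set (ℤ × ℕ) := {p | p.1 = r + n + 1} with hA
  have hτ := (measurable_frontTime a r η (n + 1)).ennreal_toNNReal
  have hm : Measurable (Combustion.delayStep a r η n) := by
    refine measurable_pi_lambda _ fun p => ?_
    unfold Combustion.delayStep
    by_cases hp : p.1 = r + n + 1
    · simp only [if_pos hp]
      exact WalkPath.measurable_shift.comp (hτ.prodMk (measurable_pi_apply p))
    · simp only [if_neg hp]
      exact measurable_pi_apply p
  let U (q : Family × Family) : Family := fun i => if i ∈ A then q.2 i else q.1 i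
  have hU : MeasurePreserving U _ _ := hW.splice_family A
  let g (y w : Family) : Family := fun i => if i ∈ A then
    WalkPath.shift (frontTime a (paths y) r η (n + 1)).toNNReal (w i) else w i
  have hg : Measurable (Function.uncurry g) := by
    refine measurable_pi_lambda _ fun p => ?_
    by_cases hp : p ∈ A
    · simp only [g, Function.uncurry, if_pos hp]
      exact WalkPath.measurable_shift.comp ((hτ.comp measurable_fst).prodMk
        ((measurable_pi_apply p).comp measurable_snd))
    · simp only [g, Function.uncurry, if_neg hp]
      exact (measurable_pi_apply p).comp measurable_snd
  have hS := (MeasurePreserving.id (Combustion.familyLaw W)).skew_product hg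
    (ae_of_all _ fun y => (hW.shift_family
      (frontTime a (paths y) r η (n + 1)).toNNReal A).map_eq)
  refine ⟨hm, ?_⟩
  -- `U` takes the walks at `r + n + 1` from an independent copy. This conjugates the delay into a
  -- skew product, whose base determines the shift of the fibre.
  have hcomp : Combustion.delayStep a r η n ∘ U = U ∘ fun q => (id q.1, g q.1 q.2) := by
    ext1 q
    have hτq : frontTime a (paths (U q)) r η (n + 1) = frontTime a (paths q.1) r η (n + 1) := by
      refine frontTime_congr _ fun p hp => if_neg fun h => ?_
      have : p.1 = r + n + 1 := h
      push_cast at hp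
      omega
    funext p
    simp only [Function.comp, Combustion.delayStep, hτq]
    by_cases hp : p ∈ A
    · rw [if_pos (show p.1 = r + n + 1 from hp)]
      simp only [U, g, if_pos hp]
    · rw [if_neg (show ¬ p.1 = r + n + 1 from hp)]
      simp only [U, g, if_neg hp, id]
  rw [← hU.map_eq, Measure.map_map hm hU.measurable, hcomp, (hU.comp hS).map_eq, hU.map_eq]

/-- The first `n` delays. -/
noncomputable def delayed (a : ℕ) (r : ℤ) (η : ℤ → ℕ) : ℕ → Family → Family
  | 0 => id
  | n + 1 => fun z => delayStep a r η n (delayed a r η n z)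

theorem delayed_succ_apply (r : ℤ) (η : ℤ → ℕ) (n : ℕ) (z : Family) (p : ℤ × ℕ) :
    delayed a r η (n + 1) z p = if p.1 = r + n + 1 then
      WalkPath.shift (frontTime a (paths (delayed a r η n z)) r η (n + 1)).toNNReal
        (delayed a r η n z p) else delayed a r η n z p := rfl

theorem IsWalkLaw.delayed (hW : IsWalkLaw W) (a : ℕ) (r : ℤ) (η : ℤ → ℕ) (n : ℕ) :
    MeasurePreserving (Combustion.delayed a r η n) (Combustion.familyLaw W)
      (Combustion.familyLaw W) := by
  induction n with
  | zero => exact MeasurePreserving.id _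
  | succ n ih => exact (hW.delayStep a r η n).comp ih

/-- The paths of the particles in their own time, when `z` are the paths in ambient time: the path
of a particle consists of the increments of the path in `z` after the birth of the particle. -/
noncomputable def ownTime (a : ℕ) (r : ℤ) (η : ℤ → ℕ) (z : Family) : Family :=
  fun p => delayed a r η (p.1 - r).toNat z p

/-- Step `n` changes only the site `r + n + 1`, so each site is changed at most once and is final
afterwards. -/
theorem delayed_of_le (r : ℤ) (η : ℤ → ℕ) (z : Family) {n : ℕ} {p : ℤ × ℕ}
    (h : p.1 ≤ r + n) : delayed a r η n z p = ownTime a r η z p := by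
  induction n with
  | zero => rw [ownTime, Int.toNat_of_nonpos (by simpa using h)]
  | succ n ih =>
    rcases h.lt_or_eq with h1 | h1
    · rw [← ih (by push_cast at h1; omega), delayed_succ_apply, if_neg]
      intro hp
      push_cast at h1
      omega
    · rw [ownTime, h1, add_sub_cancel_left, Int.toNat_natCast]

theorem delayed_of_gt (r : ℤ) (η : ℤ → ℕ) (z : Family) {n : ℕ} {p : ℤ × ℕ}
    (h : r + n < p.1) : delayed a r η n z p = z p := by
  induction n with
  | zero => rfl
  | succ n ih =>
    push_cast at h
    rw [delayed_succ_apply, if_neg, ih (by omega)]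
    intro hp
    omega

/-- The delays are consistent: the birth time computed when a site is treated is that of the final
family, because it depends only on sites that are already final. -/
theorem ownTime_apply (r : ℤ) (η : ℤ → ℕ) (z : Family) (p : ℤ × ℕ) : ownTime a r η z p =
    WalkPath.shift (birthTime a (paths (ownTime a r η z)) r η p.1).toNNReal (z p) := by
  rcases le_or_gt p.1 r with h | h
  · rw [birthTime_of_le h, ownTime, Int.toNat_of_nonpos (by omega), ENNReal.toNNReal_zero,
      WalkPath.shift_zero]
    rfl
  · obtain ⟨n, hn⟩ : ∃ n : ℕ, p.1 = r + (n + 1 : ℕ) := ⟨(p.1 - r - 1).toNat, by push_cast; omega⟩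
    rw [hn, birthTime_add, ownTime, hn, add_sub_cancel_left, Int.toNat_natCast, delayed_succ_apply,
      if_pos (by rw [hn]; push_cast; ring),
      delayed_of_gt r η z (by rw [hn]; push_cast; omega)]
    congr 2
    exact frontTime_congr _ fun i hi => delayed_of_le r η z (by push_cast at hi; omega)

/-- A cylinder set involves finitely many sites, and these are final after finitely many
measure-preserving delays. -/
theorem IsWalkLaw.ownTime (hW : IsWalkLaw W) (a : ℕ) (r : ℤ) (η : ℤ → ℕ) :
    MeasurePreserving (Combustion.ownTime a r η) (Combustion.familyLaw W)
      (Combustion.familyLaw W) := by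
  have := hW.isProbabilityMeasure
  have hm : Measurable (Combustion.ownTime a r η) := measurable_pi_lambda _ fun p =>
    (measurable_pi_apply p).comp (hW.delayed a r η (p.1 - r).toNat).measurable
  refine ⟨hm, Measure.eq_infinitePi _ fun S t ht => ?_⟩
  have hbox : MeasurableSet (Set.pi (S : Set (ℤ × ℕ)) t) := .pi S.countable_toSet fun i _ => ht i
  obtain ⟨n, hn⟩ : ∃ n : ℕ, ∀ p ∈ S, p.1 ≤ r + n := by
    refine ⟨S.sup fun p => (p.1 - r).toNat, fun p hp => ?_⟩
    have := Finset.le_sup (f := fun p : ℤ × ℕ => (p.1 - r).toNat) hp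
    omega
  have hpre : Combustion.ownTime a r η ⁻¹' (Set.pi S t) =
      Combustion.delayed a r η n ⁻¹' (Set.pi S t) := by
    ext z
    simp only [Set.mem_preimage, Set.mem_pi, Finset.mem_coe]
    exact forall₂_congr fun p hp => by rw [delayed_of_le r η z (hn p hp)]
  rw [Measure.map_apply hm hbox, hpre,
    (hW.delayed a r η n).measure_preimage hbox.nullMeasurableSet, Combustion.familyLaw,
    Measure.infinitePi_pi _ fun i _ => ht i]

/-- The paths in own time for the process started from `s`. -/
noncomputable abbrev ambient (a : ℕ) (s : State θ) (z : Family) : Family :=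
  ownTime a s.front s.occ z

/-- At time `t` every moving particle reads its ambient path at the same time `t`, so the family can
be cut at one deterministic time. -/
theorem position_ambient {s : State θ} {z : Family} {t : ℝ≥0} {p : ℤ × ℕ}
    (h : birthTime a (paths (ambient a s z)) s.front s.occ p.1 ≤ t) :
    position a s (ambient a s z) t p = p.1 + (z p).1 t -
      (z p).1 (birthTime a (paths (ambient a s z)) s.front s.occ p.1).toNNReal := by
  have hne := ne_top_of_le_ne_top ENNReal.coe_ne_top h
  have hb : (birthTime a (paths (ambient a s z)) s.front s.occ p.1).toNNReal ≤ t := by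
    rwa [← ENNReal.coe_le_coe, ENNReal.coe_toNNReal hne]
  rw [position]
  change p.1 + (ownTime a s.front s.occ z p).1 _ = _
  rw [ownTime_apply, WalkPath.shift_apply, add_tsub_cancel_of_le hb]
  ring

section Agree

variable {s : State θ} {z z' : Family} {u : ℝ≥0}

theorem position_agree (h : ∀ p : ℤ × ℕ, ∀ v ≤ u, (z p).1 v = (z' p).1 v) {t : ℝ≥0} (ht : t ≤ u)
    {p : ℤ × ℕ} (hb : birthTime a (paths (ambient a s z)) s.front s.occ p.1 ≤ t)
    (hbb : birthTime a (paths (ambient a s z')) s.front s.occ p.1 =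
      birthTime a (paths (ambient a s z)) s.front s.occ p.1) :
    position a s (ambient a s z') t p = position a s (ambient a s z) t p := by
  have hne := ne_top_of_le_ne_top ENNReal.coe_ne_top hb
  have hb' : (birthTime a (paths (ambient a s z)) s.front s.occ p.1).toNNReal ≤ t := by
    rwa [← ENNReal.coe_le_coe, ENNReal.coe_toNNReal hne]
  rw [position_ambient (hbb ▸ hb), position_ambient hb, hbb, h p t ht, h p _ (hb'.trans ht)]

theorem frontTime_le_of_agree (hθ : 0 < θ) (h : ∀ p : ℤ × ℕ, ∀ v ≤ u, (z p).1 v = (z' p).1 v)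
    (hz : IsGood a s (ambient a s z)) {n : ℕ}
    (ih : ∀ m ≤ n, frontTime a (paths (ambient a s z)) s.front s.occ m ≤ u →
      frontTime a (paths (ambient a s z')) s.front s.occ m =
        frontTime a (paths (ambient a s z)) s.front s.occ m)
    (hn : frontTime a (paths (ambient a s z)) s.front s.occ (n + 1) ≤ u) :
    frontTime a (paths (ambient a s z')) s.front s.occ (n + 1) ≤
      frontTime a (paths (ambient a s z)) s.front s.occ (n + 1) := by
  obtain ⟨t, ht⟩ : ∃ t : ℝ≥0, frontTime a (paths (ambient a s z)) s.front s.occ (n + 1) = t :=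
    ⟨_, (ENNReal.coe_toNNReal (ne_top_of_le_ne_top ENNReal.coe_ne_top hn)).symm⟩
  obtain ⟨p, hp, hpx, hpos⟩ := exists_position_eq hθ hz.weight ht
  rw [ht] at hn ⊢
  have htu : t ≤ u := by exact_mod_cast hn
  have hb : birthTime a (paths (ambient a s z')) s.front s.occ p.1 =
      birthTime a (paths (ambient a s z)) s.front s.occ p.1 :=
    ih (p.1 - s.front).toNat (by omega) (hp.2.trans hn)
  refine frontTime_le_of_position (p := p) ⟨hp.1, hb ▸ hp.2⟩ hpx ?_
  rw [position_agree h htu hp.2 hb, hpos]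

/-- Whichever system reaches the site by time `u`, the particle responsible is at the same position
in the other one. The disjunction in the hypothesis keeps the induction symmetric. -/
theorem frontTime_agree (hθ : 0 < θ) (h : ∀ p : ℤ × ℕ, ∀ v ≤ u, (z p).1 v = (z' p).1 v)
    (hz : IsGood a s (ambient a s z)) (hz' : IsGood a s (ambient a s z')) (n : ℕ)
    (hn : frontTime a (paths (ambient a s z)) s.front s.occ n ≤ u ∨
      frontTime a (paths (ambient a s z')) s.front s.occ n ≤ u) :
    frontTime a (paths (ambient a s z')) s.front s.occ n =
      frontTime a (paths (ambient a s z)) s.front s.occ n := by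
  induction n using Nat.strong_induction_on with
  | _ n ih =>
  rcases n with _ | n
  · rw [frontTime_zero, frontTime_zero]
  · have h' : ∀ p : ℤ × ℕ, ∀ v ≤ u, (z' p).1 v = (z p).1 v := fun p v hv => (h p v hv).symm
    have h1 := frontTime_le_of_agree hθ h hz (n := n) fun m hm hmu => ih m (by omega) (Or.inl hmu)
    have h2 := frontTime_le_of_agree hθ h' hz' (n := n)
      fun m hm hmu => (ih m (by omega) (Or.inr hmu)).symm
    rcases hn with hn | hn
    · exact le_antisymm (h1 hn) (h2 ((h1 hn).trans hn))
    · exact le_antisymm (h1 ((h2 hn).trans hn)) (h2 hn)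

theorem birthTime_agree (hθ : 0 < θ) (h : ∀ p : ℤ × ℕ, ∀ v ≤ u, (z p).1 v = (z' p).1 v)
    (hz : IsGood a s (ambient a s z)) (hz' : IsGood a s (ambient a s z')) {x : ℤ}
    (hx : birthTime a (paths (ambient a s z)) s.front s.occ x ≤ u ∨
      birthTime a (paths (ambient a s z')) s.front s.occ x ≤ u) :
    birthTime a (paths (ambient a s z')) s.front s.occ x =
      birthTime a (paths (ambient a s z)) s.front s.occ x :=
  frontTime_agree hθ h hz hz' _ hx

/-- The process until time `u` is a function of the paths until time `u`. -/
theorem dyn_agree (hθ : 0 < θ) (h : ∀ p : ℤ × ℕ, ∀ v ≤ u, (z p).1 v = (z' p).1 v)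
    (hz : IsGood a s (ambient a s z)) (hz' : IsGood a s (ambient a s z')) {t : ℝ≥0} (ht : t ≤ u) :
    dyn a s t (ambient a s z') = dyn a s t (ambient a s z) := by
  have htu : (t : ℝ≥0∞) ≤ u := by exact_mod_cast ht
  refine State.ext ?_ (funext fun x => ?_)
  · rw [hz.dyn_front hθ, hz'.dyn_front hθ]
    obtain ⟨k, h1, h2⟩ := hz.exists_index t
    have h3 := frontTime_agree hθ h hz hz' k (Or.inl (h1.trans htu))
    rw [frontAt_eq h1 h2, frontAt_eq (h3 ▸ h1)]
    by_contra! hc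
    rw [frontTime_agree hθ h hz hz' (k + 1) (Or.inr (hc.trans htu))] at hc
    exact absurd hc (not_le.2 h2)
  · rw [hz.dyn_occ hθ, hz'.dyn_occ hθ]
    congr 1
    ext p
    constructor
    · rintro ⟨⟨h1, h2⟩, h3⟩
      have hb := birthTime_agree hθ h hz hz' (Or.inr (h2.trans htu))
      have h2' := hb ▸ h2
      exact ⟨⟨h1, h2'⟩, by rw [← h3, position_agree h ht h2' hb]⟩
    · rintro ⟨⟨h1, h2⟩, h3⟩
      have hb := birthTime_agree hθ h hz hz' (Or.inl (h2.trans htu))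
      exact ⟨⟨h1, hb ▸ h2⟩, by rw [← h3, position_agree h ht h2 hb]⟩

end Agree

end OwnTime

/-! ### The flow property -/

section Flow

variable {θ : ℝ} {a : ℕ}

theorem exists_enumeration {β : Type*} [Inhabited β] {S : Set β} (hS : S.Finite) :
    ∃ f : ℕ → β, (∀ i < S.ncard, f i ∈ S) ∧
      (∀ i < S.ncard, ∀ j < S.ncard, f i = f j → i = j) ∧ ∀ b ∈ S, ∃ i < S.ncard, f i = b := by
  classical
  have hcard : hS.toFinset.card = S.ncard := (Set.ncard_eq_toFinset_card S hS).symm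
  let e := hS.toFinset.equivFinOfCardEq hcard
  refine ⟨fun i => if h : i < S.ncard then (e.symm ⟨i, h⟩ : β) else default, fun i hi => ?_,
    fun i hi j hj hij => ?_, fun b hb => ?_⟩
  · simp only [hi, dif_pos]
    exact hS.mem_toFinset.1 (e.symm ⟨i, hi⟩).2
  · simp only [hi, hj, dif_pos] at hij
    simpa using e.symm.injective (Subtype.ext hij)
  · refine ⟨e ⟨b, hS.mem_toFinset.2 hb⟩, (e ⟨b, hS.mem_toFinset.2 hb⟩).2, ?_⟩
    simp

/-- The particles at time `u` can be labelled as the particles of the state at time `u`. -/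
theorem IsGood.exists_relabelling (hθ : 0 < θ) {s : State θ} {y : Family} (h : IsGood a s y)
    (u : ℝ≥0) : ∃ g : ℤ × ℕ → ℤ × ℕ, Function.Injective g ∧
      (∀ q ∈ (dyn a s u y).labels, g q ∈ alive a s y u ∧ position a s y u (g q) = q.1) ∧
      (∀ p ∈ alive a s y u, ∃ q ∈ (dyn a s u y).labels, g q = p) ∧
      ∀ q : ℤ × ℕ, (dyn a s u y).front < q.1 → q.2 < a → g q = q := by
  classical
  set s₁ := dyn a s u y with hs₁
  have hfront : s₁.front = frontAt a (paths y) s.front s.occ u := h.dyn_front hθ u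
  choose f hf1 hf2 hf3 using fun z => exists_enumeration (h.finite_position hθ u z)
  have hocc (z : ℤ) : s₁.occ z = {p | p ∈ alive a s y u ∧ position a s y u p = z}.ncard :=
    h.dyn_occ hθ u z
  simp only [← hocc] at hf1 hf2 hf3
  -- Particles present at `u` are enumerated site by site, and particles still to be woken keep
  -- their labels. All other labels go injectively to indices at `s.front` beyond its supply, which
  -- no particle carries.
  let g (q : ℤ × ℕ) : ℤ × ℕ := if q.2 < s₁.occ q.1 then f q.1 q.2 else
    if s₁.front < q.1 ∧ q.2 < a then q else
      (s.front, supply a s.front s.occ s.front + Encodable.encode q)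
  have hsr : s.front ≤ s₁.front := hfront ▸ front_le_frontAt a s y u
  have hle (q : ℤ × ℕ) (hq : q.2 < s₁.occ q.1) : (f q.1 q.2).1 ≤ s₁.front :=
    hfront ▸ h.le_frontAt (hf1 q.1 q.2 hq).1
  have hex (q q' : ℤ × ℕ) (hq : q.2 < s₁.occ q.1) :
      f q.1 q.2 ≠ (s.front, supply a s.front s.occ s.front + Encodable.encode q') := by
    intro he
    have h1 := (hf1 q.1 q.2 hq).1.1
    rw [he] at h1
    simp only at h1
    omega
  refine ⟨g, fun q q' hg => ?_, fun q hq => ?_, fun p hp => ?_, fun q hq hqa => ?_⟩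
  · simp only [g] at hg
    split_ifs at hg with h1 h2 h3 h4 h5 h6 h7 h8
    · have e1 : q.1 = q'.1 := by
        rw [← (hf1 q.1 q.2 h1).2, ← (hf1 q'.1 q'.2 h2).2, hg]
      refine Prod.ext e1 (hf2 q.1 _ h1 _ (e1 ▸ h2) ?_)
      rw [hg, e1]
    · have := hle q h1
      rw [hg] at this
      omega
    · exact absurd hg (hex q q' h1)
    · have := hle q' h5
      rw [← hg] at this
      omega
    · exact hg
    · have : q.1 = s.front := congrArg Prod.fst hg
      omega
    · exact absurd hg.symm (hex q' q ‹_›)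
    · have : s.front = q'.1 := congrArg Prod.fst hg
      omega
    · have := congrArg Prod.snd hg
      simp only [Nat.add_left_cancel_iff] at this
      exact Encodable.encode_injective this
  · have hq' : q.2 < s₁.occ q.1 := hq
    simp only [g, if_pos hq']
    exact hf1 q.1 q.2 hq'
  · obtain ⟨i, hi, hip⟩ := hf3 (position a s y u p) p ⟨hp, rfl⟩
    refine ⟨(position a s y u p, i), hi, ?_⟩
    simp only [g, if_pos hi]
    exact hip
  · have h0 : ¬ q.2 < s₁.occ q.1 := by
      rw [s₁.occ_eq_zero _ hq]; omega
    simp only [g, if_neg h0, if_pos (And.intro hq hqa)]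

/-- Two processes related by a relabelling at time `u`. -/
structure IsRestart (a : ℕ) (s s₁ : State θ) (z w : Family) (u : ℝ≥0) (g : ℤ × ℕ → ℤ × ℕ) :
    Prop where
  good : IsGood a s (ambient a s (concatFamily u (z, w)))
  good' : IsGood a s₁ (ambient a s₁ fun i => w (g i))
  state_eq : s₁ = dyn a s u (ambient a s (concatFamily u (z, w)))
  mem_alive : ∀ q ∈ s₁.labels, g q ∈ alive a s (ambient a s (concatFamily u (z, w))) u
  position_eq : ∀ q ∈ s₁.labels,
    position a s (ambient a s (concatFamily u (z, w))) u (g q) = q.1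
  surj : ∀ p ∈ alive a s (ambient a s (concatFamily u (z, w))) u, ∃ q ∈ s₁.labels, g q = p
  fix : ∀ q : ℤ × ℕ, s₁.front < q.1 → q.2 < a → g q = q

namespace IsRestart

variable {s s₁ : State θ} {z w : Family} {u : ℝ≥0} {g : ℤ × ℕ → ℤ × ℕ}

theorem front_eq (hθ : 0 < θ) (h : IsRestart a s s₁ z w u g) :
    s₁.front = frontAt a (paths (ambient a s (concatFamily u (z, w)))) s.front s.occ u := by
  rw [h.state_eq, h.good.dyn_front hθ]

theorem front_le (hθ : 0 < θ) (h : IsRestart a s s₁ z w u g) : s.front ≤ s₁.front :=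
  h.front_eq hθ ▸ front_le_frontAt a s _ u

theorem birthTime_le_iff (hθ : 0 < θ) (h : IsRestart a s s₁ z w u g) {x : ℤ} :
    birthTime a (paths (ambient a s (concatFamily u (z, w)))) s.front s.occ x ≤ u ↔
      x ≤ s₁.front := by
  rw [h.front_eq hθ]
  exact h.good.birthTime_le_iff

theorem position_of_alive {p : ℤ × ℕ}
    (hp : p ∈ alive a s (ambient a s (concatFamily u (z, w))) u) {t : ℝ≥0} :
    position a s (ambient a s (concatFamily u (z, w))) (u + t) p =
      position a s (ambient a s (concatFamily u (z, w))) u p + (w p).1 t := by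
  have hb := hp.2
  have hb' : birthTime a (paths (ambient a s (concatFamily u (z, w)))) s.front s.occ p.1 ≤
      (u + t : ℝ≥0) := hb.trans (by exact_mod_cast le_self_add)
  rw [position_ambient hb, position_ambient hb']
  have h1 : (concatFamily u (z, w) p).1 (u + t) = (concatFamily u (z, w) p).1 u + (w p).1 t := by
    simp only [concatFamily]
    rw [WalkPath.concat_of_ge _ _ le_self_add, add_tsub_cancel_left, WalkPath.concat_of_le _ _ le_rfl]
  rw [h1]
  ring

theorem position_of_labels {q : ℤ × ℕ} (hq : q ∈ s₁.labels)
    {t : ℝ≥0} : position a s₁ (ambient a s₁ fun i => w (g i)) t q = q.1 + (w (g q)).1 t := by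
  have hx := birthTime_of_le (a := a) (Y := paths (ambient a s₁ fun i => w (g i))) (η := s₁.occ)
    (s₁.le_front_of_mem_labels hq)
  rw [position_ambient (by rw [hx]; exact zero_le), hx]
  simp [WalkPath.apply_zero]

theorem position_of_gt (h : IsRestart a s s₁ z w u g) {q : ℤ × ℕ}
    (hq : s₁.front < q.1) (hqa : q.2 < a) {t : ℝ≥0}
    (hb : birthTime a (paths (ambient a s₁ fun i => w (g i))) s₁.front s₁.occ q.1 ≤ t)
    (hbb : birthTime a (paths (ambient a s (concatFamily u (z, w)))) s.front s.occ q.1 =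
      u + birthTime a (paths (ambient a s₁ fun i => w (g i))) s₁.front s₁.occ q.1) :
    position a s (ambient a s (concatFamily u (z, w))) (u + t) q =
      position a s₁ (ambient a s₁ fun i => w (g i)) t q := by
  set b := birthTime a (paths (ambient a s₁ fun i => w (g i))) s₁.front s₁.occ q.1
  have hne : b ≠ ∞ := ne_top_of_le_ne_top ENNReal.coe_ne_top hb
  rw [position_ambient hb, position_ambient (by rw [hbb]; push_cast; gcongr), hbb,
    ENNReal.toNNReal_add ENNReal.coe_ne_top hne, ENNReal.toNNReal_coe, h.fix q hq hqa]
  simp only [concatFamily]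
  rw [WalkPath.concat_of_ge _ _ le_self_add, WalkPath.concat_of_ge _ _ le_self_add,
    add_tsub_cancel_left, add_tsub_cancel_left]
  ring

/-- The identity of birth times is a hypothesis since this is used within the induction that proves
it; the last bound keeps the corresponding site within the range already treated. -/
theorem alive_of_alive (hθ : 0 < θ) (h : IsRestart a s s₁ z w u g) {t : ℝ≥0} {q : ℤ × ℕ}
    (hbb : s₁.front < q.1 →
      birthTime a (paths (ambient a s (concatFamily u (z, w)))) s.front s.occ q.1 =
      u + birthTime a (paths (ambient a s₁ fun i => w (g i))) s₁.front s₁.occ q.1)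
    (hq : q ∈ alive a s₁ (ambient a s₁ fun i => w (g i)) t) :
    g q ∈ alive a s (ambient a s (concatFamily u (z, w))) (u + t) ∧
      position a s (ambient a s (concatFamily u (z, w))) (u + t) (g q) =
        position a s₁ (ambient a s₁ fun i => w (g i)) t q ∧ (g q).1 ≤ max s₁.front q.1 := by
  rcases le_or_gt q.1 s₁.front with hx | hx
  · have hl := mem_labels_of_mem_alive hq hx
    have hp := h.mem_alive q hl
    refine ⟨⟨hp.1, hp.2.trans (by exact_mod_cast le_self_add)⟩, ?_, ?_⟩
    · rw [position_of_alive hp, position_of_labels hl, h.position_eq q hl]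
    · exact ((h.birthTime_le_iff hθ).1 hp.2).trans (le_max_left _ _)
  · have hqa := hq.1
    rw [supply_of_lt hx] at hqa
    have hbb' := hbb hx
    have hfix := h.fix q hx hqa
    refine ⟨⟨?_, ?_⟩, ?_, ?_⟩
    · rw [hfix, supply_of_lt ((h.front_le hθ).trans_lt hx)]
      exact hqa
    · rw [hfix, hbb', ENNReal.coe_add]
      exact add_le_add_right hq.2 _
    · rw [← h.position_of_gt hx hqa hq.2 hbb', hfix]
    · rw [hfix]
      exact le_max_right _ _

theorem exists_alive (hθ : 0 < θ) (h : IsRestart a s s₁ z w u g) {t : ℝ≥0} {p : ℤ × ℕ}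
    (hbb : s₁.front < p.1 →
      birthTime a (paths (ambient a s (concatFamily u (z, w)))) s.front s.occ p.1 =
      u + birthTime a (paths (ambient a s₁ fun i => w (g i))) s₁.front s₁.occ p.1)
    (hp : p ∈ alive a s (ambient a s (concatFamily u (z, w))) (u + t)) :
    ∃ q ∈ alive a s₁ (ambient a s₁ fun i => w (g i)) t, g q = p ∧ q.1 ≤ max s₁.front p.1 ∧
      (s₁.front < q.1 → q = p) := by
  rcases le_or_gt p.1 s₁.front with hx | hx
  · obtain ⟨q, hq, rfl⟩ := h.surj p ⟨hp.1, (h.birthTime_le_iff hθ).2 hx⟩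
    have hq1 := s₁.le_front_of_mem_labels hq
    exact ⟨q, labels_subset_alive _ _ _ _ hq, rfl, hq1.trans (le_max_left _ _),
      fun hc => absurd hq1 (not_le.2 hc)⟩
  · have hpa := hp.1
    rw [supply_of_lt ((h.front_le hθ).trans_lt hx)] at hpa
    refine ⟨p, ⟨by rwa [supply_of_lt hx], ?_⟩, h.fix p hx hpa, le_max_right _ _, fun _ => rfl⟩
    have := hp.2
    rw [hbb hx, ENNReal.coe_add] at this
    exact (ENNReal.add_le_add_iff_left ENNReal.coe_ne_top).1 this

/-- Strong induction on the distance to the front at time `u`. A particle that first reaches the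
site in one system corresponds, at the same position, to one in the other system, which gives one
inequality in each direction. -/
theorem birthTime_eq (hθ : 0 < θ) (h : IsRestart a s s₁ z w u g) {x : ℤ} (hx : s₁.front < x) :
    birthTime a (paths (ambient a s (concatFamily u (z, w)))) s.front s.occ x =
      u + birthTime a (paths (ambient a s₁ fun i => w (g i))) s₁.front s₁.occ x := by
  obtain ⟨m, hm⟩ : ∃ m : ℕ, x = s₁.front + (m + 1 : ℕ) :=
    ⟨(x - s₁.front - 1).toNat, by push_cast; omega⟩
  induction m using Nat.strong_induction_on generalizing x with
  | _ m ih =>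
  have ih' {x' : ℤ} (h1 : x' ≤ s₁.front + m) (h2 : s₁.front < x') :
      birthTime a (paths (ambient a s (concatFamily u (z, w)))) s.front s.occ x' =
      u + birthTime a (paths (ambient a s₁ fun i => w (g i))) s₁.front s₁.occ x' :=
    ih (x' - s₁.front - 1).toNat (by omega) h2 (by push_cast; omega)
  obtain ⟨k, hk⟩ : ∃ k : ℕ, s₁.front = s.front + k :=
    ⟨(s₁.front - s.front).toNat, by have := h.front_le hθ; omega⟩
  have hx1 : x = s.front + ((k + m + 1 : ℕ) : ℤ) := by rw [hm, hk]; push_cast; ring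
  have hgt : (u : ℝ≥0∞) <
      birthTime a (paths (ambient a s (concatFamily u (z, w)))) s.front s.occ x := by
    rw [← not_le, h.birthTime_le_iff hθ, not_le]
    exact hx
  have e1 : birthTime a (paths (ambient a s (concatFamily u (z, w)))) s.front s.occ x =
    frontTime a (paths (ambient a s (concatFamily u (z, w)))) s.front s.occ (k + m + 1) := by
    rw [hx1, birthTime_add]
  have e2 : birthTime a (paths (ambient a s₁ fun i => w (g i))) s₁.front s₁.occ x =
    frontTime a (paths (ambient a s₁ fun i => w (g i))) s₁.front s₁.occ (m + 1) := by
    rw [hm, birthTime_add]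
  rw [e1] at hgt
  rw [e1, e2]
  refine le_antisymm ?_ ?_
  · by_cases hi : frontTime a (paths (ambient a s₁ fun i => w (g i))) s₁.front s₁.occ (m + 1) = ∞
    · rw [hi, add_top]; exact le_top
    · obtain ⟨t, ht⟩ : ∃ t : ℝ≥0, frontTime a (paths (ambient a s₁ fun i => w (g i)))
        s₁.front s₁.occ (m + 1) = t := ⟨_, (ENNReal.coe_toNNReal hi).symm⟩
      obtain ⟨q, hq, hqx, hqp⟩ := exists_position_eq hθ h.good'.weight ht
      obtain ⟨h1, h2, h3⟩ := h.alive_of_alive hθ (ih' hqx) hq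
      rw [ht, ← ENNReal.coe_add]
      refine frontTime_le_of_position h1 ?_ ?_
      · have : max s₁.front q.1 ≤ s₁.front + m := max_le (by omega) hqx
        push_cast
        omega
      · rw [h2, hqp]
        push_cast
        omega
  · by_cases hi : frontTime a (paths (ambient a s (concatFamily u (z, w)))) s.front s.occ
        (k + m + 1) = ∞
    · rw [hi]; exact le_top
    · obtain ⟨t', ht'⟩ : ∃ t : ℝ≥0, frontTime a (paths (ambient a s (concatFamily u (z, w))))
        s.front s.occ (k + m + 1) = t := ⟨_, (ENNReal.coe_toNNReal hi).symm⟩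
      rw [ht'] at hgt
      obtain ⟨t, rfl⟩ := exists_add_of_le (show u ≤ t' by exact_mod_cast hgt.le)
      obtain ⟨p, hp, hpx, hpp⟩ := exists_position_eq hθ h.good.weight ht'
      have hpx' : p.1 ≤ s₁.front + m := by push_cast at hpx; omega
      obtain ⟨q, hq, hqp, hqx, hqq⟩ := h.exists_alive hθ (ih' hpx') hp
      have hqx' : q.1 ≤ s₁.front + m := hqx.trans (max_le (by omega) hpx')
      obtain ⟨-, h2, -⟩ := h.alive_of_alive hθ (ih' hqx') hq
      rw [ht', ENNReal.coe_add]
      refine add_le_add_right (frontTime_le_of_position hq hqx' ?_) _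
      rw [← h2, hqp, hpp]
      push_cast
      omega

/-- The flow property. -/
theorem dyn_add (hθ : 0 < θ) (h : IsRestart a s s₁ z w u g) (hg : Function.Injective g) (t : ℝ≥0) :
    dyn a s (u + t) (ambient a s (concatFamily u (z, w))) =
      dyn a s₁ t (ambient a s₁ fun i => w (g i)) := by
  have hiff (x : ℤ) (hx : s₁.front ≤ x) :
      birthTime a (paths (ambient a s (concatFamily u (z, w)))) s.front s.occ x ≤ (u + t : ℝ≥0) ↔
      birthTime a (paths (ambient a s₁ fun i => w (g i))) s₁.front s₁.occ x ≤ t := by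
    rcases hx.eq_or_lt with rfl | hx
    · rw [birthTime_of_le (a := a) (r := s₁.front) le_rfl]
      simp only [zero_le, iff_true]
      exact ((h.birthTime_le_iff hθ).2 le_rfl).trans (by exact_mod_cast le_self_add)
    · rw [h.birthTime_eq hθ hx, ENNReal.coe_add, ENNReal.add_le_add_iff_left ENNReal.coe_ne_top]
  refine State.ext ?_ (funext fun x => ?_)
  · rw [h.good.dyn_front hθ, h.good'.dyn_front hθ]
    have hle' := front_le_frontAt a s₁ (ambient a s₁ fun i => w (g i)) t
    have h1 : s₁.front ≤ frontAt a (paths (ambient a s (concatFamily u (z, w)))) s.front s.occ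
        (u + t) := by
      rw [← h.good.birthTime_le_iff, hiff _ le_rfl, birthTime_of_le le_rfl]
      exact zero_le
    refine le_antisymm ?_ ?_
    · rw [← h.good'.birthTime_le_iff, ← hiff _ h1, h.good.birthTime_le_iff]
    · rw [← h.good.birthTime_le_iff, hiff _ hle', h.good'.birthTime_le_iff]
  · rw [h.good.dyn_occ hθ, h.good'.dyn_occ hθ]
    refine Eq.trans ?_ (Set.ncard_image_of_injective {p | p ∈ alive a s₁
      (ambient a s₁ fun i => w (g i)) t ∧ position a s₁ (ambient a s₁ fun i => w (g i)) t p = x} hg)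
    congr 1
    ext p
    constructor
    · rintro ⟨h1, h2⟩
      obtain ⟨q, hq, hqp, -, -⟩ := h.exists_alive hθ (fun hx => h.birthTime_eq hθ hx) h1
      obtain ⟨-, h4, -⟩ := h.alive_of_alive hθ (fun hx => h.birthTime_eq hθ hx) hq
      exact ⟨q, ⟨hq, by rw [← h4, hqp, h2]⟩, hqp⟩
    · rintro ⟨q, ⟨h1, h2⟩, rfl⟩
      obtain ⟨h3, h4, -⟩ := h.alive_of_alive hθ (fun hx => h.birthTime_eq hθ hx) h1
      exact ⟨h3, h4.trans h2⟩

end IsRestart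

end Flow

/-! ### The Markov property -/

section Markov

variable {θ : ℝ} {a : ℕ} {W : Measure WalkPath}

/-- The state at `u` and the labelling `g` are fixed by the past `z` before `w` is drawn. For fixed
`g` the relabelled future is again an independent family with the product law, so it is almost
surely good for the state at `u`. -/
theorem IsWalkLaw.ae_isRestart (hW : IsWalkLaw W) (hθ : 0 < θ) (a : ℕ) (s : State θ) (u : ℝ≥0) :
    ∀ᵐ z ∂(Combustion.familyLaw W), IsGood a s (ambient a s z) ∧ ∃ g, Function.Injective g ∧
      ∀ᵐ w ∂(Combustion.familyLaw W), IsGood a s (ambient a s (concatFamily u (z, w))) ∧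
        IsRestart a s (dyn a s u (ambient a s z)) z w u g := by
  have := hW.familyLaw
  have h1 : ∀ᵐ z ∂(Combustion.familyLaw W), IsGood a s (ambient a s z) :=
    (hW.ownTime a s.front s.occ).quasiMeasurePreserving.ae (hW.ae_isGood hθ a s)
  have h2 : ∀ᵐ q ∂((Combustion.familyLaw W).prod (Combustion.familyLaw W)),
      IsGood a s (ambient a s (concatFamily u q)) :=
    (hW.concat_family u).quasiMeasurePreserving.ae h1
  filter_upwards [h1, Measure.ae_ae_of_ae_prod h2] with z hz hzw
  obtain ⟨g, hg, hlab, hsurj, hfix⟩ := hz.exists_relabelling hθ u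
  refine ⟨hz, g, hg, ?_⟩
  set s₁ := dyn a s u (ambient a s z)
  have h3 : ∀ᵐ w ∂(Combustion.familyLaw W), IsGood a s₁ (ambient a s₁ fun i => w (g i)) :=
    ((hW.ownTime a s₁.front s₁.occ).comp (hW.relabel hg)).quasiMeasurePreserving.ae
      (hW.ae_isGood hθ a s₁)
  filter_upwards [hzw, h3] with w hw hw'
  have h : ∀ p : ℤ × ℕ, ∀ v ≤ u, (z p).1 v = (concatFamily u (z, w) p).1 v :=
    fun p v hv => (WalkPath.concat_of_le _ _ hv).symm
  have halive {p : ℤ × ℕ} (hp : p ∈ alive a s (ambient a s z) u) :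
      p ∈ alive a s (ambient a s (concatFamily u (z, w))) u :=
    ⟨hp.1, (birthTime_agree hθ h hz hw (Or.inl hp.2)).le.trans hp.2⟩
  refine ⟨hw, hw, hw', (dyn_agree hθ h hz hw le_rfl).symm, fun q hq => halive (hlab q hq).1,
    fun q hq => ?_, fun p hp => ?_, hfix⟩
  · obtain ⟨h4, h5⟩ := hlab q hq
    rw [position_agree h le_rfl h4.2 (birthTime_agree hθ h hz hw (Or.inl h4.2)), h5]
  · exact hsurj p ⟨hp.1, (birthTime_agree hθ h hz hw (Or.inr hp.2)).ge.trans hp.2⟩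

/-- The Markov property. -/
theorem IsWalkLaw.markov (hW : IsWalkLaw W) (hθ : 0 < θ) {t : ℝ≥0}
    {κ : Kernel (State θ) (State θ)} (hκ : ∀ s, κ s = (Combustion.familyLaw W).map (dyn a s t))
    (s : State θ) (u : ℝ≥0) {A : Set (Set.Iic u → State θ)} (hA : MeasurableSet A)
    {B : Set (State θ)} (hB : MeasurableSet B) :
    Combustion.familyLaw W
        ((fun y (v : Set.Iic u) => dyn a s v y) ⁻¹' A ∩ dyn a s (u + t) ⁻¹' B) =
      ∫⁻ y in (fun y (v : Set.Iic u) => dyn a s v y) ⁻¹' A, κ (dyn a s u y) B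
        ∂(Combustion.familyLaw W) := by
  have := hW.familyLaw
  set μ := Combustion.familyLaw W
  set ξ : Family → Set.Iic u → State θ := fun y v => dyn a s v y
  have hξ : Measurable ξ := measurable_pi_lambda _ fun v => measurable_dyn a s v
  have hξA : MeasurableSet (ξ ⁻¹' A) := hξ hA
  have hE : MeasurableSet (ξ ⁻¹' A ∩ dyn a s (u + t) ⁻¹' B) :=
    hξA.inter (measurable_dyn a s (u + t) hB)
  have hO := hW.ownTime a s.front s.occ
  have hF := hO.comp (hW.concat_family u)
  have hm : Measurable fun y => (ξ ⁻¹' A).indicator (fun y => κ (dyn a s u y) B) y :=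
    ((κ.measurable_coe hB).comp (measurable_dyn a s u)).indicator hξA
  -- The paths are represented as `ambient` of a concatenation of independent families `z` and `w`;
  -- by Fubini it remains to identify the integral over `w` for almost every `z`.
  rw [← hF.measure_preimage hE.nullMeasurableSet, Measure.prod_apply (hF.measurable hE),
    ← lintegral_indicator hξA, ← hO.lintegral_comp hm]
  refine lintegral_congr_ae ?_
  filter_upwards [hW.ae_isRestart hθ a s u] with z hz
  obtain ⟨hz, g, hg, hr⟩ := hz
  have hξw : ∀ᵐ w ∂μ, ξ (ambient a s (concatFamily u (z, w))) = ξ (ambient a s z) := by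
    filter_upwards [hr] with w hw
    funext v
    exact dyn_agree hθ (fun p v hv => (WalkPath.concat_of_le _ _ hv).symm) hz hw.1 v.2
  -- For fixed `z` the paths driving the restarted process have the law `familyLaw W`, so the inner
  -- integral is the kernel at the state at time `u`.
  have hR := (hW.ownTime a (dyn a s u (ambient a s z)).front (dyn a s u (ambient a s z)).occ).comp
    (hW.relabel hg)
  by_cases hzA : ambient a s z ∈ ξ ⁻¹' A
  · rw [Set.indicator_of_mem hzA, hκ, Measure.map_apply (measurable_dyn a _ t) hB,
      ← hR.measure_preimage ((measurable_dyn a _ t) hB).nullMeasurableSet]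
    refine measure_congr ?_
    filter_upwards [hr, hξw] with w hw hw'
    have hd := hw.2.dyn_add hθ hg t
    have hzA' : ξ (ambient a s (concatFamily u (z, w))) ∈ A := hw' ▸ hzA
    refine propext ⟨fun h => ?_, fun h => ⟨hzA', ?_⟩⟩
    · change dyn a _ t (ambient a _ fun i => w (g i)) ∈ B
      rw [← hd]
      exact h.2
    · change dyn a s (u + t) (ambient a s (concatFamily u (z, w))) ∈ B
      rw [hd]
      exact h
  · rw [Set.indicator_of_notMem hzA]
    refine measure_mono_null_ae ?_ measure_empty
    filter_upwards [hξw] with w hw h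
    exact hzA (show ξ (ambient a s z) ∈ A from hw ▸ h.1)

end Markov

/-! ### Comparison of configurations -/

section Compare

variable {θ : ℝ} {a : ℕ}

theorem abs_ncard_sub_le {α : Type*} {S S' D : Set α} (hS : S.Finite) (hS' : S'.Finite)
    (h : ∀ p ∉ D, p ∈ S ↔ p ∈ S') :
    ENNReal.ofReal |(S.ncard : ℝ) - S'.ncard| ≤ ((S ∩ D).ncard : ℝ≥0∞) + ((S' ∩ D).ncard : ℝ≥0∞) := by
  have h1 : S \ D = S' \ D := by
    ext p
    simp only [Set.mem_sdiff]
    exact ⟨fun hp => ⟨(h p hp.2).1 hp.1, hp.2⟩, fun hp => ⟨(h p hp.2).2 hp.1, hp.2⟩⟩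
  have h2 := Set.ncard_inter_add_ncard_sdiff_eq_ncard S D hS
  have h3 := Set.ncard_inter_add_ncard_sdiff_eq_ncard S' D hS'
  rw [h1] at h2
  rw [← Nat.cast_add]
  refine ENNReal.ofReal_le_of_le_toReal ?_
  rw [ENNReal.toReal_natCast, ← h2, ← h3, abs_le]
  push_cast
  constructor <;> linarith [Nat.cast_nonneg (α := ℝ) (S ∩ D).ncard,
    Nat.cast_nonneg (α := ℝ) (S' ∩ D).ncard]

/-- Two systems of particles that differ only in the particles with labels in `D`. -/
theorem tsum_mul_abs_ncard_sub_le (g : ℤ → ℝ≥0∞) {A A' D : Set (ℤ × ℕ)} {pos pos' : ℤ × ℕ → ℤ}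
    (hA : ∀ x, {p | p ∈ A ∧ pos p = x}.Finite) (hA' : ∀ x, {p | p ∈ A' ∧ pos' p = x}.Finite)
    (h : ∀ p ∉ D, p ∈ A ↔ p ∈ A') (hpos : ∀ p ∉ D, p ∈ A → pos p = pos' p) :
    ∑' x, g x * ENNReal.ofReal
        |({p | p ∈ A ∧ pos p = x}.ncard : ℝ) - {p | p ∈ A' ∧ pos' p = x}.ncard| ≤
      ∑' p, (A ∩ D).indicator (fun p => g (pos p)) p +
        ∑' p, (A' ∩ D).indicator (fun p => g (pos' p)) p := by
  refine le_trans ?_ (add_le_add (tsum_mul_ncard_le g (A ∩ D) pos)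
    (tsum_mul_ncard_le g (A' ∩ D) pos'))
  rw [← ENNReal.tsum_add]
  refine ENNReal.tsum_le_tsum fun x => ?_
  rw [← mul_add]
  refine mul_le_mul_right ((abs_ncard_sub_le (D := D) (hA x) (hA' x) fun p hp => ?_).trans_eq ?_) _
  · constructor
    · rintro ⟨h1, h2⟩
      exact ⟨(h p hp).1 h1, by rw [← hpos p hp h1, h2]⟩
    · rintro ⟨h1, h2⟩
      exact ⟨(h p hp).2 h1, by rw [hpos p hp ((h p hp).2 h1), h2]⟩
  · have (B : Set (ℤ × ℕ)) (f : ℤ × ℕ → ℤ) :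
        {p | p ∈ B ∧ f p = x} ∩ D = {p | p ∈ B ∩ D ∧ f p = x} := by
      ext p
      simp only [Set.mem_inter_iff, Set.mem_ofPred_eq]
      tauto
    rw [this, this]

theorem State.ofReal_dist_of_front_eq {s s' : State θ} (h : s.front = s'.front) :
    ENNReal.ofReal (dist s s') = ∑' x : ℤ, ENNReal.ofReal (Real.exp (θ * ((x : ℝ) - s.front))) *
      ENNReal.ofReal |(s.occ x : ℝ) - s'.occ x| := by
  rw [ofReal_dist, ← h, sub_self, abs_zero, ENNReal.ofReal_zero, zero_add,
    ← (Equiv.addRight s.front).tsum_eq fun x : ℤ => ENNReal.ofReal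
      (Real.exp (θ * ((x : ℝ) - s.front))) * ENNReal.ofReal |(s.occ x : ℝ) - s'.occ x|]
  refine tsum_congr fun x => ?_
  rw [distTerm, ENNReal.ofReal_mul (Real.exp_pos _).le, ← h]
  simp

variable {s s' : State θ} {y : Family}

/-- Labels at a site form an initial segment of `ℕ`, so the symmetric difference has exactly `|η(x)
- η'(x)|` labels at `x`. Thus the metric measures the weight of the particles in which two states
differ. -/
theorem State.initialWeight_symmDiff (h : s.front = s'.front) :
    initialWeight θ s.front (symmDiff s.labels s'.labels) = ENNReal.ofReal (dist s s') := by
  rw [State.ofReal_dist_of_front_eq h, initialWeight_eq (c := fun x =>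
    max (s.occ x) (s'.occ x) - min (s.occ x) (s'.occ x)) _ fun x => ?_]
  · refine tsum_congr fun x => ?_
    rw [← ENNReal.ofReal_mul (Real.exp_pos _).le, Nat.cast_sub min_le_max, Nat.cast_max,
      Nat.cast_min, max_sub_min_eq_abs, abs_sub_comm]
  · have : {i : ℕ | (x, i) ∈ symmDiff s.labels s'.labels} =
        Finset.Ico (min (s.occ x) (s'.occ x)) (max (s.occ x) (s'.occ x)) := by
      ext i
      simp only [Set.mem_symmDiff, State.labels, Set.mem_ofPred_eq, Finset.coe_Ico, Set.mem_Ico]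
      omega
    rw [this, Set.encard_coe_eq_coe_finsetCard, Nat.card_Ico]

/-- The distance of two processes is controlled by the particles in which they differ. -/
theorem ofReal_dist_dyn_le (hθ : 0 < θ) (hf : s.front = s'.front) (h : IsGood a s y)
    (h' : IsGood a s' y) {N : ℕ} {t : ℝ≥0} (ht : t < N)
    (hD : labelWeight θ N s.front (symmDiff s.labels s'.labels) y < 1) :
    ENNReal.ofReal (dist (dyn a s t y) (dyn a s' t y)) ≤
      2 * labelWeight θ N s.front (symmDiff s.labels s'.labels) y := by
  set D := symmDiff s.labels s'.labels with hDdef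
  have hlab (p : ℤ × ℕ) (hp : p ∉ D) : p ∈ s.labels ↔ p ∈ s'.labels := by
    simp only [hDdef, Set.mem_symmDiff] at hp
    tauto
  -- A total weight below one keeps all differing particles left of the front, so they cannot
  -- advance it before `N`.
  have hhit (p : ℤ × ℕ) (hp : p ∈ D) :
      (N : ℝ≥0∞) ≤ hitTime (fun t => walks p.1 p.2 t y) (s.front + 1) := by
    by_contra! hc
    obtain ⟨v, hv, hv'⟩ := (isWalkPath_walks y p.1 p.2).exists_hitTime
      (hc.trans (ENNReal.natCast_lt_top N))
    rw [hv'] at hc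
    have := walk_le_of_labelWeight_lt_one hθ hD hp (t := v) (by exact_mod_cast hc.le)
    omega
  have hmin (n : ℕ) : min (frontTime a (paths y) s.front s.occ n) (N : ℝ≥0∞) =
      min (frontTime a (paths y) s'.front s'.occ n) (N : ℝ≥0∞) := by
    rw [← hf]
    refine min_frontTime_eq (fun x _ i hi => ?_) (fun x _ i hi => ?_) n
    · by_cases hp : (x, i) ∈ D
      · exact Or.inr (hhit _ hp)
      · exact Or.inl ((hlab _ hp).1 hi)
    · by_cases hp : (x, i) ∈ D
      · exact Or.inr (hhit _ hp)
      · exact Or.inl ((hlab _ hp).2 hi)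
  have htN : (t : ℝ≥0∞) < N := by exact_mod_cast ht
  have hfr : (dyn a s t y).front = (dyn a s' t y).front := by
    have hset : {n : ℕ | frontTime a (paths y) s.front s.occ n ≤ t} =
        {n : ℕ | frontTime a (paths y) s'.front s'.occ n ≤ t} := by
      ext n
      exact (le_coe_iff_of_min_eq (hmin n) htN).1
    rw [h.dyn_front hθ, h'.dyn_front hθ, frontAt, frontAt, hset, hf]
  have hbirth (x : ℤ) : (birthTime a (paths y) s.front s.occ x ≤ t ↔
      birthTime a (paths y) s'.front s'.occ x ≤ t) ∧ (birthTime a (paths y) s.front s.occ x ≤ t →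
      birthTime a (paths y) s.front s.occ x = birthTime a (paths y) s'.front s'.occ x) := by
    have := le_coe_iff_of_min_eq (hmin (x - s.front).toNat) htN
    simp only [birthTime, ← hf] at this ⊢
    exact this
  have hsup (p : ℤ × ℕ) (hp : p ∉ D) :
      p.2 < supply a s.front s.occ p.1 ↔ p.2 < supply a s'.front s'.occ p.1 := by
    rw [supply, supply, ← hf]
    split_ifs with hx
    · exact hlab p hp
    · rfl
  have hDx (p : ℤ × ℕ) (hp : p ∈ D) : p.1 ≤ s.front := by
    rcases hp with hp | hp
    · exact s.le_front_of_mem_labels hp.1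
    · exact hf ▸ s'.le_front_of_mem_labels hp.1
  have hle : s.front ≤ (dyn a s t y).front := h.dyn_front hθ t ▸ front_le_frontAt a s y t
  rw [State.ofReal_dist_of_front_eq hfr]
  simp only [h.dyn_occ hθ, h'.dyn_occ hθ]
  refine (tsum_mul_abs_ncard_sub_le (D := D) _ (h.finite_position hθ t) (h'.finite_position hθ t)
    (fun p hp => ?_) fun p hp hpa => ?_).trans ?_
  · simp only [alive, Set.mem_ofPred_eq, hsup p hp, (hbirth p.1).1]
  · rw [position, position, (hbirth p.1).2 hpa.2]
  · rw [two_mul]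
    have hexp (p : ℤ × ℕ) (hp : p ∈ D) : ENNReal.ofReal (Real.exp (θ * ((walks p.1 p.2 t y : ℝ) -
        (dyn a s t y).front))) ≤ D.indicator (fun p => ENNReal.ofReal
          (Real.exp (θ * ((p.1 : ℝ) - s.front))) * pathWeight θ N (y p)) p := by
      rw [Set.indicator_of_mem hp]
      refine le_trans (ENNReal.ofReal_le_ofReal (Real.exp_le_exp.2 ?_))
        (exp_walk_le hθ s.front p y ht.le)
      have : (s.front : ℝ) ≤ (dyn a s t y).front := by exact_mod_cast hle
      gcongr
    refine add_le_add (ENNReal.tsum_le_tsum fun p => ?_) (ENNReal.tsum_le_tsum fun p => ?_)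
    · by_cases hp : p ∈ alive a s y t ∩ D
      · rw [Set.indicator_of_mem hp,
          position_of_mem_labels (mem_labels_of_mem_alive hp.1 (hDx p hp.2))]
        exact hexp p hp.2
      · rw [Set.indicator_of_notMem hp]
        exact zero_le
    · by_cases hp : p ∈ alive a s' y t ∩ D
      · rw [Set.indicator_of_mem hp,
          position_of_mem_labels (mem_labels_of_mem_alive hp.1 (hf ▸ hDx p hp.2))]
        exact hexp p hp.2
      · rw [Set.indicator_of_notMem hp]
        exact zero_le

/-- Markov's inequality for the weight of the differing particles: a distance of at least `ε` forces
this weight to be at least one, where the coupling may fail, or at least `ε / 2`. -/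
theorem IsWalkLaw.measure_le_edist_dyn {W : Measure WalkPath} (hW : IsWalkLaw W) (hθ : 0 < θ)
    (a : ℕ) (hf : s.front = s'.front) {N : ℕ} {t : ℝ≥0} (ht : t < N) {ε : ℝ≥0∞} (hε : ε ≠ 0) :
    Combustion.familyLaw W {y | ε ≤ edist (dyn a s t y) (dyn a s' t y)} ≤
      (∫⁻ e, pathWeight θ N e ∂W) * edist s s' / min 1 (ε / 2) := by
  rw [edist_dist s s', ← State.initialWeight_symmDiff hf, ← hW.lintegral_labelWeight]
  refine le_trans ?_ (meas_ge_le_lintegral_div (measurable_labelWeight N s.front _).aemeasurable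
    (lt_min one_pos (ENNReal.half_pos hε)).ne' (ne_top_of_le_ne_top ENNReal.one_ne_top
      (min_le_left _ _)))
  refine measure_mono_ae ?_
  filter_upwards [hW.ae_isGood hθ a s, hW.ae_isGood hθ a s'] with y h h' (hy : ε ≤ _)
  change min 1 (ε / 2) ≤ _
  by_contra! hc
  have h1 := ofReal_dist_dyn_le hθ hf h h' ht (hc.trans_le (min_le_left _ _))
  rw [← edist_dist] at h1
  refine absurd (hy.trans h1) (not_le.2 ?_)
  rw [mul_comm]
  exact ENNReal.mul_lt_of_lt_div (hc.trans_le (min_le_right _ _))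

theorem State.eventually_front_eq (s : State θ) : ∀ᶠ s' in 𝓝 s, s'.front = s.front := by
  have := State.continuous_front.tendsto s
  rwa [nhds_discrete ℤ, tendsto_pure] at this

theorem IsWalkLaw.tendsto_edist_div {W : Measure WalkPath} (hW : IsWalkLaw W) (hθ : 0 < θ)
    (N : ℕ) (s : State θ) {c : ℝ≥0∞} (hc : c ≠ 0) :
    Tendsto (fun s' => (∫⁻ e, pathWeight θ N e ∂W) * edist s' s / c) (𝓝 s) (𝓝 0) := by
  have h1 : Tendsto (fun s' => edist s' s) (𝓝 s) (𝓝 0) := by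
    have : Continuous fun s' : State θ => edist s' s := by fun_prop
    simpa using this.tendsto s
  have h2 := ENNReal.Tendsto.const_mul (a := ∫⁻ e, pathWeight θ N e ∂W) h1
    (Or.inr (hW.lintegral_pathWeight hθ N).ne)
  simpa using ENNReal.Tendsto.div_const h2 (b := c) (Or.inr hc)

theorem IsWalkLaw.tendstoInMeasure_dyn {W : Measure WalkPath} (hW : IsWalkLaw W) (hθ : 0 < θ)
    (a : ℕ) (s : State θ) (t : ℝ≥0) :
    TendstoInMeasure (Combustion.familyLaw W) (fun s' => dyn a s' t) (𝓝 s) (dyn a s t) := by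
  intro ε hε
  obtain ⟨N, hN⟩ := exists_nat_gt t
  refine tendsto_of_tendsto_of_tendsto_of_le_of_le' tendsto_const_nhds
    (hW.tendsto_edist_div hθ N s (lt_min one_pos (ENNReal.half_pos hε.ne')).ne')
    (Eventually.of_forall fun _ => zero_le) ?_
  filter_upwards [s.eventually_front_eq] with s' hs'
  exact hW.measure_le_edist_dyn hθ a hs' hN hε.ne'

end Compare

/-! ### Small times -/

section SmallTime

variable {θ : ℝ} {a : ℕ} {s : State θ} {y : Family}

theorem State.occ_eq_ncard (s : State θ) (x : ℤ) : s.occ x = {p | p ∈ s.labels ∧ p.1 = x}.ncard := by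
  have : {p | p ∈ s.labels ∧ p.1 = x} = (fun i => (x, i)) '' (Finset.range (s.occ x) : Set ℕ) := by
    ext ⟨x', i⟩
    simp only [labels, Set.mem_ofPred_eq, Set.mem_image, Finset.coe_range, Set.mem_Iio,
      Prod.mk.injEq]
    constructor
    · rintro ⟨h, rfl⟩
      exact ⟨i, h, rfl, rfl⟩
    · rintro ⟨j, h, rfl, rfl⟩
      exact ⟨h, rfl⟩
  rw [this, Set.ncard_image_of_injective _ fun i j h => congrArg Prod.snd h, Set.ncard_coe_finset,
    Finset.card_range]

theorem State.finite_labels (s : State θ) (x : ℤ) : {p | p ∈ s.labels ∧ p.1 = x}.Finite := by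
  refine ((Set.finite_Iio (s.occ x)).image fun i => (x, i)).subset ?_
  rintro ⟨x', i⟩ ⟨h, rfl⟩
  exact ⟨i, h, rfl⟩

/-- Before `τ_1` no particle is added, so only displaced particles matter, each counted at its old
and its new site. -/
theorem ofReal_dist_dyn_self_le (hθ : 0 < θ) (h : IsGood a s y) {t : ℝ≥0} (ht : t ≤ 1)
    (h1 : t < frontTime a (paths y) s.front s.occ 1) :
    ENNReal.ofReal (dist (dyn a s t y) s) ≤ ∑' p, 2 * (s.labels ∩ {p | (y p).1 t ≠ 0}).indicator
      (fun p => ENNReal.ofReal (Real.exp (θ * ((p.1 : ℝ) - s.front))) * pathWeight θ 1 (y p)) p := by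
  have hfr : frontAt a (paths y) s.front s.occ t = s.front := by
    rw [frontAt_eq (k := 0) (by rw [frontTime_zero]; exact zero_le) (by simpa using h1)]
    simp
  have hfront : (dyn a s t y).front = s.front := by rw [h.dyn_front hθ, hfr]
  have halive : alive a s y t = s.labels := by
    refine Set.Subset.antisymm (fun p hp => mem_labels_of_mem_alive hp ?_) (labels_subset_alive a s y t)
    exact hfr ▸ h.le_frontAt hp
  rw [State.ofReal_dist_of_front_eq hfront]
  simp only [h.dyn_occ hθ, s.occ_eq_ncard]
  refine (tsum_mul_abs_ncard_sub_le (D := {p | (y p).1 t ≠ 0}) _ (h.finite_position hθ t)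
    s.finite_labels (fun p hp => by rw [halive]) fun p hp hpa => ?_).trans ?_
  · rw [position_of_mem_labels (halive ▸ hpa), walks]
    simp only [Set.mem_ofPred_eq, not_not] at hp
    change p.1 + (y p).1 t = p.1
    rw [hp, add_zero]
  · rw [halive, hfront, ← ENNReal.tsum_add]
    refine ENNReal.tsum_le_tsum fun p => ?_
    rw [two_mul]
    by_cases hp : p ∈ s.labels ∩ {p | (y p).1 t ≠ 0}
    · simp only [Set.indicator_of_mem hp]
      refine add_le_add ?_ (le_mul_of_one_le_right zero_le (one_le_pathWeight θ 1 (y p)))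
      rw [position_of_mem_labels hp.1]
      exact exp_walk_le hθ s.front p y (by simpa using ht)
    · simp only [Set.indicator_of_notMem hp, add_zero, le_refl]

theorem IsGood.frontTime_one_pos (hθ : 0 < θ) (h : IsGood a s y) :
    0 < frontTime a (paths y) s.front s.occ 1 := by
  by_contra! h0
  obtain ⟨p, hp, hx, hpos⟩ := exists_position_eq hθ h.weight (n := 0) (t := 0)
    (by simpa using h0)
  simp only [Nat.cast_zero, add_zero] at hx hpos
  rw [position_of_mem_labels (mem_labels_of_mem_alive hp hx), walks] at hpos
  rw [WalkPath.apply_zero] at hpos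
  omega

/-- Dominated convergence over labels: by right continuity each particle is still at its starting
site for small `t`, and the label weight dominates. -/
theorem IsGood.tendsto_dyn_zero (hθ : 0 < θ) (h : IsGood a s y) :
    Tendsto (fun t => dyn a s t y) (𝓝 0) (𝓝 s) := by
  rw [tendsto_iff_edist_tendsto_0]
  have hev : ∀ᶠ t : ℝ≥0 in 𝓝 0, t ≤ 1 ∧ t < frontTime a (paths y) s.front s.occ 1 := by
    refine (eventually_le_nhds one_pos).and ?_
    exact (ENNReal.continuous_coe.tendsto 0).eventually_lt_const
      (by simpa using h.frontTime_one_pos hθ)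
  have hlim : Tendsto (fun t : ℝ≥0 => ∑' p, 2 * (s.labels ∩ {p | (y p).1 t ≠ 0}).indicator
      (fun p => ENNReal.ofReal (Real.exp (θ * ((p.1 : ℝ) - s.front))) * pathWeight θ 1 (y p)) p)
      (𝓝 0) (𝓝 0) := by
    simp only [← lintegral_count]
    have := tendsto_lintegral_filter_of_dominated_convergence (μ := Measure.count) (l := 𝓝 (0 : ℝ≥0))
      (F := fun t p => 2 * (s.labels ∩ {p | (y p).1 t ≠ 0}).indicator (fun p => ENNReal.ofReal
        (Real.exp (θ * ((p.1 : ℝ) - s.front))) * pathWeight θ 1 (y p)) p) (f := fun _ => 0)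
      (fun p => 2 * s.labels.indicator (fun p => ENNReal.ofReal
        (Real.exp (θ * ((p.1 : ℝ) - s.front))) * pathWeight θ 1 (y p)) p)
      (Eventually.of_forall fun t => Measurable.of_discrete)
      (Eventually.of_forall fun t => ae_of_all _ fun p => mul_le_mul_right
        (Set.indicator_le_indicator_apply_of_subset Set.inter_subset_left zero_le) _) ?_
      (ae_of_all _ fun p => ?_)
    · simpa using this
    · rw [lintegral_count, ENNReal.tsum_mul_left]
      exact ENNReal.mul_ne_top (by simp) (h.weight 1)
    · have hr := (y p).2.right_cont 0
      rw [show Set.Ici (0 : ℝ≥0) = Set.univ from Set.Ici_bot, nhdsWithin_univ,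
        WalkPath.apply_zero] at hr
      refine tendsto_const_nhds.congr' ?_
      filter_upwards [hr] with t ht
      rw [Set.indicator_of_notMem fun hp => hp.2 ht, mul_zero]
  refine tendsto_of_tendsto_of_tendsto_of_le_of_le' tendsto_const_nhds hlim
    (Eventually.of_forall fun _ => zero_le) ?_
  filter_upwards [hev] with t ht
  rw [edist_dist]
  exact ofReal_dist_dyn_self_le hθ h ht.1 ht.2

theorem IsGood.dyn_zero (hθ : 0 < θ) (h : IsGood a s y) : dyn a s 0 y = s := by
  have h1 := ofReal_dist_dyn_self_le hθ h zero_le (by simpa using h.frontTime_one_pos hθ)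
  have : ∑' p, 2 * (s.labels ∩ {p | (y p).1 0 ≠ 0}).indicator (fun p => ENNReal.ofReal
      (Real.exp (θ * ((p.1 : ℝ) - s.front))) * pathWeight θ 1 (y p)) p = 0 := by
    simp [WalkPath.apply_zero]
  rw [this] at h1
  exact dist_le_zero.1 (ENNReal.ofReal_eq_zero.1 (nonpos_iff_eq_zero.1 h1))

theorem IsWalkLaw.tendsto_measure_dyn_zero {W : Measure WalkPath} (hW : IsWalkLaw W) (hθ : 0 < θ)
    (a : ℕ) (s : State θ) {ε : ℝ≥0∞} (hε : 0 < ε) :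
    Tendsto (fun t => Combustion.familyLaw W {y | ε ≤ edist (dyn a s t y) s}) (𝓝 0) (𝓝 0) := by
  have := hW.familyLaw
  refine tendsto_of_seq_tendsto fun t ht => ?_
  refine tendstoInMeasure_of_tendsto_ae_of_measurable_edist (μ := Combustion.familyLaw W)
    (f := fun n => dyn a s (t n)) (g := fun _ => s) (fun n => ?_) ?_ ε hε
  · exact (measurable_dyn a s (t n)).edist measurable_const
  · filter_upwards [hW.ae_isGood hθ a s] with y hy
    exact (hy.tendsto_dyn_zero hθ).comp ht

/-- Stochastic continuity at time `0`, locally uniformly in the starting point. -/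
theorem IsWalkLaw.tendstoInMeasure_dyn_zero {W : Measure WalkPath} (hW : IsWalkLaw W) (hθ : 0 < θ)
    (a : ℕ) (s : State θ) : TendstoInMeasure (Combustion.familyLaw W)
      (fun (q : ℝ≥0 × State θ) => dyn a q.2 q.1) (𝓝 0 ×ˢ 𝓝 s) (fun _ => s) := by
  intro ε hε
  have hε2 := ENNReal.half_pos hε.ne'
  have h1 := (hW.tendsto_measure_dyn_zero hθ a s hε2).comp (tendsto_fst (g := 𝓝 s))
  have h2 := (hW.tendsto_edist_div hθ 1 s (lt_min one_pos (ENNReal.half_pos hε2.ne')).ne').comp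
    (tendsto_snd (f := 𝓝 (0 : ℝ≥0)))
  have h3 := h1.add h2
  rw [add_zero] at h3
  refine tendsto_of_tendsto_of_tendsto_of_le_of_le' tendsto_const_nhds h3
    (Eventually.of_forall fun _ => zero_le) ?_
  filter_upwards [(eventually_lt_nhds (one_pos : (0 : ℝ≥0) < 1)).prod_mk s.eventually_front_eq]
    with q hq
  have hq1 : q.1 < (1 : ℕ) := by simpa using hq.1
  refine le_trans ?_ (add_le_add_right (hW.measure_le_edist_dyn hθ a hq.2 hq1 hε2.ne') _)
  refine (measure_mono fun y (hy : ε ≤ edist (dyn a q.2 q.1 y) s) => ?_).trans (measure_union_le _ _)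
  by_contra! hc
  simp only [Set.mem_union, Set.mem_ofPred_eq, not_or, not_le] at hc
  refine absurd ((edist_triangle _ (dyn a s q.1 y) _).trans_lt ?_) (not_lt.2 hy)
  rw [← ENNReal.add_halves ε]
  exact ENNReal.add_lt_add hc.2 hc.1

end SmallTime

/-! ### The semigroup -/

section Semigroup

variable {θ : ℝ} {W : Measure WalkPath}

theorem tendsto_integral_of_tendstoInMeasure {Ω S ι : Type*} [MeasurableSpace Ω] {μ : Measure Ω}
    [IsProbabilityMeasure μ] [PseudoEMetricSpace S] [MeasurableSpace S] [BorelSpace S]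
    {l : Filter ι} [l.IsCountablyGenerated] [l.NeBot] {X : ι → Ω → S} {Z : Ω → S}
    (h : TendstoInMeasure μ X l Z) (hX : ∀ i, Measurable (X i)) (hZ : Measurable Z) (f : S →ᵇ ℝ) :
    Tendsto (fun i => ∫ ω, f (X i ω) ∂μ) l (𝓝 (∫ ω, f (Z ω) ∂μ)) := by
  have h1 := (h.tendstoInDistribution fun i => (hX i).aemeasurable).tendsto
  have h2 := ProbabilityMeasure.tendsto_iff_forall_integral_tendsto.1 h1 f
  have hf : Measurable f := f.continuous.measurable
  simp only [ProbabilityMeasure.coe_mk] at h2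
  rw [integral_map hZ.aemeasurable hf.aestronglyMeasurable] at h2
  refine h2.congr fun i => ?_
  rw [integral_map (hX i).aemeasurable hf.aestronglyMeasurable]

theorem IsWalkLaw.continuous_integral_dyn (hW : IsWalkLaw W) (hθ : 0 < θ) (a : ℕ) (t : ℝ≥0)
    (f : State θ →ᵇ ℝ) :
    Continuous fun s : State θ => ∫ y, f (dyn a s t y) ∂(Combustion.familyLaw W) := by
  have := hW.familyLaw
  exact continuous_iff_continuousAt.2 fun s => tendsto_integral_of_tendstoInMeasure
    (hW.tendstoInMeasure_dyn hθ a s t) (fun s' => measurable_dyn a s' t) (measurable_dyn a s t) f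

/-- Closed sets form a generating π-system, and the mass of a closed set is a limit of integrals of
thickened indicators, which depend continuously on the state. -/
theorem IsWalkLaw.measurable_map_dyn (hW : IsWalkLaw W) (hθ : 0 < θ) (a : ℕ) (t : ℝ≥0) :
    Measurable fun s : State θ => (Combustion.familyLaw W).map (dyn a s t) := by
  have := hW.familyLaw
  have hprob (s : State θ) : IsProbabilityMeasure ((Combustion.familyLaw W).map (dyn a s t)) :=
    Measure.isProbabilityMeasure_map (measurable_dyn a s t).aemeasurable
  refine Measurable.measure_of_isPiSystem_of_isProbabilityMeasure
    (BorelSpace.measurable_eq.trans borel_eq_generateFrom_isClosed) isPiSystem_isClosed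
    fun F (hF : IsClosed F) => ?_
  have hpos (n : ℕ) : (0 : ℝ) < 1 / ((n : ℝ) + 1) := by positivity
  let f (n : ℕ) : State θ →ᵇ ℝ := BoundedContinuousFunction.mkOfBound
    ⟨fun s => (thickenedIndicator (hpos n) F s : ℝ), by fun_prop⟩ 1 fun s s' => by
      have h1 := thickenedIndicator_le_one (hpos n) F s
      have h2 := thickenedIndicator_le_one (hpos n) F s'
      rw [Real.dist_eq, abs_le]
      have h1' : (thickenedIndicator (hpos n) F s : ℝ) ≤ 1 := by exact_mod_cast h1
      have h2' : (thickenedIndicator (hpos n) F s' : ℝ) ≤ 1 := by exact_mod_cast h2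
      constructor <;> simp only [ContinuousMap.coe_mk] <;>
        linarith [(thickenedIndicator (hpos n) F s).2, (thickenedIndicator (hpos n) F s').2,
          NNReal.coe_nonneg (thickenedIndicator (hpos n) F s),
          NNReal.coe_nonneg (thickenedIndicator (hpos n) F s')]
  have hreal : Measurable fun s : State θ => ((Combustion.familyLaw W).map (dyn a s t)).real F := by
    refine measurable_of_tendsto_metrizable (f := fun n s => ∫ y, f n (dyn a s t y)
      ∂(Combustion.familyLaw W))
      (fun n => (hW.continuous_integral_dyn hθ a t (f n)).measurable) (tendsto_pi_nhds.2 fun s => ?_)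
    refine (tendsto_integral_thickenedIndicator_of_isClosed _ hF hpos
      tendsto_one_div_add_atTop_nhds_zero_nat).congr fun n => ?_
    exact integral_map (measurable_dyn a s t).aemeasurable
      (f n).continuous.measurable.aestronglyMeasurable
  have heq : (fun s : State θ => ((Combustion.familyLaw W).map (dyn a s t)) F) =
      fun s => ENNReal.ofReal (((Combustion.familyLaw W).map (dyn a s t)).real F) :=
    funext fun s => (ofReal_measureReal (measure_ne_top _ _)).symm
  rw [heq]
  exact hreal.ennreal_ofReal

/-- The transition kernels. -/
noncomputable def IsWalkLaw.kernel (hW : IsWalkLaw W) (hθ : 0 < θ) (a : ℕ) (t : ℝ≥0) :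
    Kernel (State θ) (State θ) :=
  ⟨fun s => (Combustion.familyLaw W).map (dyn a s t), hW.measurable_map_dyn hθ a t⟩

theorem IsWalkLaw.kernel_apply (hW : IsWalkLaw W) (hθ : 0 < θ) (a : ℕ) (t : ℝ≥0) (s : State θ) :
    hW.kernel hθ a t s = (Combustion.familyLaw W).map (dyn a s t) := rfl

theorem IsWalkLaw.isMarkovKernel (hW : IsWalkLaw W) (hθ : 0 < θ) (a : ℕ) (t : ℝ≥0) :
    IsMarkovKernel (hW.kernel hθ a t) := by
  have := hW.familyLaw
  exact ⟨fun s => Measure.isProbabilityMeasure_map (measurable_dyn a s t).aemeasurable⟩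

/-- The Chapman–Kolmogorov equation is the Markov property without conditioning on the past. -/
theorem IsWalkLaw.kernel_add (hW : IsWalkLaw W) (hθ : 0 < θ) (a : ℕ) (u t : ℝ≥0) :
    hW.kernel hθ a (u + t) = hW.kernel hθ a t ∘ₖ hW.kernel hθ a u := by
  ext s B hB
  rw [Kernel.comp_apply' _ _ _ hB, hW.kernel_apply, hW.kernel_apply,
    lintegral_map ((hW.kernel hθ a t).measurable_coe hB) (measurable_dyn a s u),
    Measure.map_apply (measurable_dyn a s _) hB]
  have := hW.markov hθ (hW.kernel_apply hθ a t) s u MeasurableSet.univ hB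
  simpa using this

theorem IsWalkLaw.integral_kernel (hW : IsWalkLaw W) (hθ : 0 < θ) (a : ℕ) (t : ℝ≥0) (s : State θ)
    (f : State θ →ᵇ ℝ) :
    ∫ s', f s' ∂(hW.kernel hθ a t s) = ∫ y, f (dyn a s t y) ∂(Combustion.familyLaw W) := by
  rw [hW.kernel_apply, integral_map (measurable_dyn a s t).aemeasurable
    f.continuous.measurable.aestronglyMeasurable]

theorem IsWalkLaw.norm_integral_dyn_le (hW : IsWalkLaw W) (a : ℕ) (t : ℝ≥0) (f : State θ →ᵇ ℝ)
    (s : State θ) : ‖∫ y, f (dyn a s t y) ∂(Combustion.familyLaw W)‖ ≤ ‖f‖ := by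
  have := hW.familyLaw
  simpa using norm_integral_le_of_norm_le_const (μ := Combustion.familyLaw W)
    (ae_of_all _ fun y => f.norm_coe_le_norm (dyn a s t y))

theorem IsWalkLaw.integrable_dyn (hW : IsWalkLaw W) (a : ℕ) (t : ℝ≥0) (f : State θ →ᵇ ℝ)
    (s : State θ) : Integrable (fun y => f (dyn a s t y)) (Combustion.familyLaw W) := by
  have := hW.familyLaw
  exact Integrable.of_bound
    (f.continuous.measurable.comp (measurable_dyn a s t)).aestronglyMeasurable ‖f‖
    (ae_of_all _ fun y => f.norm_coe_le_norm _)

/-- The transition semigroup. -/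
noncomputable def IsWalkLaw.semigroup (hW : IsWalkLaw W) (hθ : 0 < θ) (a : ℕ) (t : ℝ≥0) :
    (State θ →ᵇ ℝ) →L[ℝ] (State θ →ᵇ ℝ) :=
  LinearMap.mkContinuous
    { toFun := fun f => BoundedContinuousFunction.ofNormedAddCommGroup
        (fun s => ∫ y, f (dyn a s t y) ∂(Combustion.familyLaw W))
        (hW.continuous_integral_dyn hθ a t f) ‖f‖ (hW.norm_integral_dyn_le a t f)
      map_add' := fun f g => by
        ext s
        exact integral_add (hW.integrable_dyn a t f s) (hW.integrable_dyn a t g s)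
      map_smul' := fun c f => by
        ext s
        exact integral_const_mul c _ }
    1 fun f => by
      rw [one_mul]
      exact BoundedContinuousFunction.norm_ofNormedAddCommGroup_le _ (norm_nonneg f)
        (hW.norm_integral_dyn_le a t f)

theorem IsWalkLaw.semigroup_apply (hW : IsWalkLaw W) (hθ : 0 < θ) (a : ℕ) (t : ℝ≥0)
    (f : State θ →ᵇ ℝ) (s : State θ) :
    hW.semigroup hθ a t f s = ∫ y, f (dyn a s t y) ∂(Combustion.familyLaw W) := rfl

theorem IsWalkLaw.isFellerSemigroup (hW : IsWalkLaw W) (hθ : 0 < θ) (a : ℕ) :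
    IsFellerSemigroup (hW.semigroup (θ := θ) hθ a) := by
  have := hW.familyLaw
  refine ⟨fun f => ?_, fun t u f => ?_, fun t => ?_, fun t f hf s => ?_, fun t f => ?_,
    fun t f hf => ?_, fun f K hK => ?_⟩
  · ext s
    rw [hW.semigroup_apply]
    have : (fun y => f (dyn a s 0 y)) =ᵐ[Combustion.familyLaw W] fun _ => f s := by
      filter_upwards [hW.ae_isGood hθ a s] with y hy
      rw [hy.dyn_zero hθ]
    rw [integral_congr_ae this]
    simp
  · ext s
    have := hW.isMarkovKernel hθ a t
    have := hW.isMarkovKernel hθ a u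
    have h1 : Integrable f ((hW.kernel hθ a u ∘ₖ hW.kernel hθ a t) s) :=
      Integrable.of_bound f.continuous.measurable.aestronglyMeasurable ‖f‖
        (ae_of_all _ fun y => f.norm_coe_le_norm _)
    rw [hW.semigroup_apply, hW.semigroup_apply, ← hW.integral_kernel hθ, hW.kernel_add,
      Kernel.integral_comp h1, ← hW.integral_kernel hθ]
    refine integral_congr_ae (ae_of_all _ fun s' => ?_)
    exact hW.integral_kernel hθ a u s' f
  · ext s
    rw [hW.semigroup_apply]
    simp
  · exact integral_nonneg fun y => hf _
  · exact BoundedContinuousFunction.norm_ofNormedAddCommGroup_le _ (norm_nonneg f)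
      (hW.norm_integral_dyn_le a t f)
  -- The only function that vanishes at infinity is `0`.
  · rw [State.eq_zero_of_tendsto_cocompact hθ hf, map_zero]
    exact tendsto_const_nhds
  -- On a compact set local uniformity suffices, and that follows from convergence as time and
  -- starting point vary jointly.
  · refine (tendstoLocallyUniformlyOn_iff_tendstoUniformlyOn_of_compact hK).1 fun U hU s _ => ?_
    have h1 : Tendsto (fun q : ℝ≥0 × State θ => hW.semigroup hθ a q.1 f q.2) (𝓝 0 ×ˢ 𝓝 s)
        (𝓝 (f s)) := by
      have := tendsto_integral_of_tendstoInMeasure (hW.tendstoInMeasure_dyn_zero hθ a s)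
        (fun q => measurable_dyn a q.2 q.1) measurable_const f
      simp only [integral_const, probReal_univ, one_smul] at this
      exact this
    have h2 : Tendsto (fun q : ℝ≥0 × State θ => f q.2) (𝓝 0 ×ˢ 𝓝 s) (𝓝 (f s)) :=
      (f.continuous.tendsto s).comp tendsto_snd
    have h3 : ∀ᶠ q in 𝓝 (0 : ℝ≥0) ×ˢ 𝓝 s, (f q.2, hW.semigroup hθ a q.1 f q.2) ∈ U :=
      (h2.prodMk_nhds h1).eventually (nhds_le_uniformity _ hU)
    obtain ⟨p, hp, q, hq, hpq⟩ := eventually_prod_iff.1 h3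
    exact ⟨{s' | q s'}, mem_nhdsWithin_of_mem_nhds hq, hp.mono fun t ht s' hs' => hpq ht hs'⟩

end Semigroup

/-! ### Families of random walks -/

section Transfer

variable {θ : ℝ} {Ω : Type*} [MeasurableSpace Ω] {P : Measure Ω} {Y : ℤ → ℕ → ℝ≥0 → Ω → ℤ}

namespace IsWalkFamily

/-- The paths of the walks, moved to the origin. -/
def family (hY : IsWalkFamily P Y) (ω : Ω) : Family := fun p =>
  ⟨fun t => Y p.1 p.2 t ω - p.1, by
    have := (hY.path p.1 p.2 ω).add_const (-p.1)
    simpa [sub_eq_add_neg] using this⟩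

theorem walks_family (hY : IsWalkFamily P Y) (ω : Ω) :
    paths (hY.family ω) = fun x i t => Y x i t ω := by
  funext x i t
  simp [walks, family]

theorem measurable_family (hY : IsWalkFamily P Y) : Measurable hY.family :=
  measurable_pi_lambda _ fun p => Measurable.subtype_mk
    (measurable_pi_lambda _ fun t => (hY.measurable p.1 p.2 t).sub_const _)

theorem process_eq (hY : IsWalkFamily P Y) (a : ℕ) (s : State θ) (t : ℝ≥0) :
    process a Y s t = dyn a s t ∘ hY.family := by
  funext ω
  have h : process a Y s t ω = process a (fun x i t (_ : Unit) => Y x i t ω) s t () := rfl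
  have h' : dyn a s t (hY.family ω) =
    process a (fun x i t (_ : Unit) => paths (hY.family ω) x i t) s t () := rfl
  rw [Function.comp_apply, h, h', hY.walks_family]

theorem isWalkLaw (hY : IsWalkFamily P Y) [IsProbabilityMeasure P] (p : ℤ × ℕ) :
    IsWalkLaw (P.map fun ω => hY.family ω p) := by
  have hm : Measurable fun ω => hY.family ω p := (measurable_pi_apply p).comp hY.measurable_family
  have hsub (s t : ℝ≥0) : Measurable fun e : WalkPath => e.1 t - e.1 s :=
    (WalkPath.measurable_apply t).sub (WalkPath.measurable_apply s)
  have hprob := Measure.isProbabilityMeasure_map (μ := P) hm.aemeasurable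
  refine ⟨hprob, fun n t ht => ?_, fun s t => ?_⟩
  · have h : iIndepFun (fun (i : Fin n) => (fun e : WalkPath => e.1 (t i.succ) - e.1 (t i.castSucc)) ∘
        fun ω => hY.family ω p) P := by
      refine (congrArg (iIndepFun · P) ?_).mp (hY.indep_increments p.1 p.2 n t ht)
      funext i ω
      simp [family]
    rw [iIndepFun_iff_map_fun_eq_pi_map fun i => (hsub _ _).aemeasurable,
      Measure.map_map (measurable_pi_lambda _ fun i => hsub _ _) hm]
    simp only [Measure.map_map (hsub _ _) hm]
    exact h.map_fun_eq_pi_map fun i => ((hsub _ _).comp hm).aemeasurable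
  · rw [Measure.map_map (hsub _ _) hm, ← hY.law_increment p.1 p.2 s t]
    congr 1
    funext ω
    simp [family]

/-- The walks are independent and, by uniqueness of the walk law, identically distributed once moved
to the origin; any label could serve as the reference. -/
theorem map_family (hY : IsWalkFamily P Y) [IsProbabilityMeasure P] :
    MeasurePreserving hY.family P (familyLaw (P.map fun ω => hY.family ω (0, 0))) := by
  refine ⟨hY.measurable_family, ?_⟩
  have hi : iIndepFun (fun (p : ℤ × ℕ) ω => hY.family ω p) P := by
    have h := hY.indep.comp (fun (p : ℤ × ℕ) (f : ℝ≥0 → ℤ) t => f t - p.1) fun p =>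
      measurable_pi_lambda _ fun t => (measurable_pi_apply t).sub_const _
    rw [iIndepFun_iff_iIndep] at h ⊢
    convert! h using 2 with p
    exact MeasurableSpace.comap_comp
  have h := hi.map_fun_eq_infinitePi_map
    fun p => (measurable_pi_apply p).comp hY.measurable_family
  refine h.trans ?_
  unfold familyLaw
  congr 1
  funext p
  exact (hY.isWalkLaw p).unique (hY.isWalkLaw (0, 0))

/-- The process is a Markov process. -/
theorem isMarkovProcess (hY : IsWalkFamily P Y) [IsProbabilityMeasure P] (hθ : 0 < θ) (a : ℕ)
    (s : State θ) :
    IsMarkovProcess P ((hY.isWalkLaw (0, 0)).kernel hθ a) (process a Y s) := by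
  set W := P.map fun ω => hY.family ω (0, 0)
  have hW : IsWalkLaw W := hY.isWalkLaw (0, 0)
  have hmeas (t : ℝ≥0) : Measurable (process a Y s t) := by
    rw [hY.process_eq]
    exact (measurable_dyn a s t).comp hY.measurable_family
  refine ⟨hmeas, fun u t B hB => ?_⟩
  have := hW.isMarkovKernel hθ a t
  have hm : (⨆ v : Set.Iic u, MeasurableSpace.comap (process a Y s v) inferInstance) ≤
      ‹MeasurableSpace Ω› := iSup_le fun v => (hmeas v).comap_le
  have hκ : Measurable fun s' => (hW.kernel hθ a t s').real B :=
    ((hW.kernel hθ a t).measurable_coe hB).ennreal_toReal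
  have hg : Integrable (fun ω => (hW.kernel hθ a t (process a Y s u ω)).real B) P := by
    refine Integrable.of_bound (hκ.comp (hmeas u)).aestronglyMeasurable 1 (ae_of_all _ fun ω => ?_)
    rw [Real.norm_of_nonneg measureReal_nonneg]
    exact measureReal_le_one
  refine (ae_eq_condExp_of_forall_setIntegral_eq hm
    ((integrable_const (1 : ℝ)).indicator (hmeas (u + t) hB)) (fun A _ _ => hg.integrableOn)
    (fun A hA _ => ?_) ?_).symm
  -- Events of the natural filtration at `u` are preimages under the restriction of the process to
  -- times up to `u`, which is the form `IsWalkLaw.markov` treats.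
  · have hpi : (⨆ v : Set.Iic u, MeasurableSpace.comap (process a Y s v) inferInstance) =
        MeasurableSpace.comap (fun ω (v : Set.Iic u) => process a Y s v ω) inferInstance := by
      rw [MeasurableSpace.pi, MeasurableSpace.comap_iSup]
      simp only [MeasurableSpace.comap_comp]
      rfl
    rw [hpi] at hA
    obtain ⟨C, hC, rfl⟩ := hA
    have hξ : Measurable fun ω (v : Set.Iic u) => process a Y s v ω :=
      measurable_pi_lambda _ fun v => hmeas v
    have hCm := hξ hC
    rw [setIntegral_indicator (hmeas (u + t) hB), setIntegral_const, smul_eq_mul, mul_one,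
      Measure.real]
    have h1 := hW.markov hθ (hW.kernel_apply hθ a t) s u hC hB
    have hξd : Measurable fun y (v : Set.Iic u) => dyn a s v y :=
      measurable_pi_lambda _ fun v => measurable_dyn a s v
    have hmp : MeasurePreserving hY.family P (familyLaw W) := hY.map_family
    have hκd : Measurable fun y => hW.kernel hθ a t (dyn a s u y) B :=
      ((hW.kernel hθ a t).measurable_coe hB).comp (measurable_dyn a s u)
    rw [← hmp.measure_preimage ((hξd hC).inter (measurable_dyn a s _ hB)).nullMeasurableSet,
      ← hmp.setLIntegral_comp_preimage (hξd hC) hκd] at h1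
    have h2 : hY.family ⁻¹' ((fun y (v : Set.Iic u) => dyn a s v y) ⁻¹' C) =
        (fun ω (v : Set.Iic u) => process a Y s v ω) ⁻¹' C := by
      simp only [hY.process_eq]
      rfl
    rw [Set.preimage_inter, h2, ← Set.preimage_comp, ← hY.process_eq] at h1
    rw [h1]
    change _ = ENNReal.toReal (∫⁻ ω in _, hW.kernel hθ a t ((dyn a s u ∘ hY.family) ω) B ∂P)
    rw [← hY.process_eq]
    exact integral_toReal (((hW.kernel hθ a t).measurable_coe hB).comp (hmeas u)).aemeasurable
      (ae_of_all _ fun ω => measure_lt_top _ _)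
  · have : Measurable[⨆ v : Set.Iic u, MeasurableSpace.comap (process a Y s v) inferInstance]
        (process a Y s u) :=
      (comap_measurable _).mono (le_iSup (fun v : Set.Iic u =>
        MeasurableSpace.comap (process a Y s v) inferInstance) ⟨u, Set.self_mem_Iic⟩) le_rfl
    exact (hκ.comp this).aestronglyMeasurable

end IsWalkFamily

end Transfer

end Combustion

theorem mainTheorem3 (a : ℕ) (ha : 1 ≤ a) (θ : ℝ) (hθ : 0 < θ)
    {Ω : Type*} [MeasurableSpace Ω] (P : Measure Ω) [IsProbabilityMeasure P]
    (Y : ℤ → ℕ → ℝ≥0 → Ω → ℤ) (hY : Combustion.IsWalkFamily P Y) :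
    -- the truncated processes do not explode
    (∀ s : Combustion.State θ, ∀ᵐ ω ∂P, ∀ l : ℕ,
      Tendsto (Combustion.frontTime a (fun x i u => Y x i u ω) s.front
        (Combustion.truncate s.front s.occ l)) atTop (𝓝 ∞)) ∧
    -- they converge to finite limits, and the limit is in the state space
    (∀ s : Combustion.State θ, ∀ᵐ ω ∂P, ∀ t : ℝ≥0, ∃ s' : Combustion.State θ,
      Combustion.ConvergesTo a (fun x i u => Y x i u ω) s t s') ∧
    -- the limit is a Markov process, and its semigroup is Feller
    (∃ κ : ℝ≥0 → Kernel (Combustion.State θ) (Combustion.State θ),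
      (∀ t s, κ t s = P.map (Combustion.process a Y s t)) ∧
      ∀ s, Combustion.IsMarkovProcess P κ (Combustion.process a Y s)) ∧
    (∃ T : ℝ≥0 → (Combustion.State θ →ᵇ ℝ) →L[ℝ] (Combustion.State θ →ᵇ ℝ),
      (∀ t f s, T t f s = ∫ ω, f (Combustion.process a Y s t ω) ∂P) ∧
      Combustion.IsFellerSemigroup T) := by
  have hW := hY.isWalkLaw (0, 0)
  have hmp := hY.map_family
  have hgood (s : Combustion.State θ) : ∀ᵐ ω ∂P, Combustion.IsGood a s (hY.family ω) :=
    hmp.quasiMeasurePreserving.ae (hW.ae_isGood hθ a s)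
  refine ⟨fun s => ?_, fun s => ?_, ⟨hW.kernel hθ a, fun t s => ?_, hY.isMarkovProcess hθ a⟩,
    hW.semigroup hθ a, fun t f s => ?_, hW.isFellerSemigroup hθ a⟩
  · filter_upwards [hgood s] with ω hω l
    rw [← hY.walks_family]
    exact hω.tendsto_truncate l
  · filter_upwards [hgood s] with ω hω t
    rw [← hY.walks_family]
    exact ⟨_, hω.convergesTo hθ t⟩
  · rw [hW.kernel_apply, hY.process_eq, ← hmp.map_eq,
      Measure.map_map (Combustion.measurable_dyn a s t) hY.measurable_family]
  · rw [hW.semigroup_apply, hY.process_eq, ← hmp.map_eq]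
    exact integral_map hY.measurable_family.aemeasurable
      (f.continuous.measurable.comp (Combustion.measurable_dyn a s t)).aestronglyMeasurable
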